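/- Let $\mathsf{fab}$ be the category of finitely generated free abelian groups. For a commutative ring $R$, a cubic $R$-module is a (not necessarily additive) functor $F$ from $\mathsf{fab}$ to finitely generated $R$-modules which sends zero morphisms to zero morphisms and is polynomial of degree at most $3$, i.e. its cross-effects $F_m(A_1|\dots|A_m)$ vanish for all $m>3$. Here $F_m(A_1|\dots|A_m)$ is the image of the endomorphism $\sum_{S\subseteq\{1,\dots,m\}}(-1)^{m-|S|}F\big(\sum_{k\in S}e_k\big)$ of $F(A_1\oplus\dots\oplus A_m)$, where $e_k$ is the projection onto the summand $A_k$ followed by its embedding. A 2-divisible cubic module is a cubic $\mathbb Z[1/2]$-module. Let $\mathbb Z_{(p)}=\{a/b\mid a,b\in\mathbb Z,\ p\nmid b\}$, $M_{(p)}=\mathbb Z_{(p)}\otimes M$, and let $\mathrm tM$ be the torsion part of $M$; tensor products, torsion parts, direct sums and torsion freeness are taken objectwise on $\mathsf{fab}$, and isomorphisms are natural isomorphisms. 1. Two 2-divisible cubic modules $M,N$ are isomorphic if and only if $M_{(p)}\simeq N_{(p)}$ for every odd prime $p$. 2. Let a cubic $\mathbb Z_{(p)}$-module $N_p$ be given for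 every odd prime $p$. There is a 2-divisible cubic module $M$ such that $M_{(p)}\simeq N_p$ for all odd primes $p$ if and only if all but finitely many of the $N_p$ are torsion free (possibly zero) and $\mathbb Q\otimes N_p\simeq\mathbb Q\otimes N_q$ for all odd primes $p,q$. In this case, for every such $M$, $\mathbb Q\otimes M\simeq\mathbb Q\otimes N_p$ for all odd primes $p$, and $\mathrm tM\simeq\bigoplus_p\mathrm tN_p$. -/

import Mathlib

open CategoryTheory

universe u

namespace CubicModules

/-! ### The coefficient rings -/

/-- The ring `ℤ[1/2]`, as the subring of `ℚ` of the fractions whose reduced denominator divides a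
power of `2`. -/
def ZInvTwo : Subring ℚ where
  carrier := {q | ∃ k : ℕ, q.den ∣ 2 ^ k}
  zero_mem' := ⟨0, by simp⟩
  one_mem' := ⟨0, by simp⟩
  add_mem' := by
    rintro a b ⟨k, hk⟩ ⟨l, hl⟩
    exact ⟨k + l, (Rat.add_den_dvd a b).trans (by rw [pow_add]; exact mul_dvd_mul hk hl)⟩
  mul_mem' := by
    rintro a b ⟨k, hk⟩ ⟨l, hl⟩
    exact ⟨k + l, (Rat.mul_den_dvd a b).trans (by rw [pow_add]; exact mul_dvd_mul hk hl)⟩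
  neg_mem' := by
    rintro a ⟨k, hk⟩
    exact ⟨k, by simpa using hk⟩

/-- The localization `ℤ_(p)`, as the subring of `ℚ` of the fractions whose reduced denominator is
prime to `p` (for a prime `p`: is not divisible by `p`). -/
def ZLoc (p : ℕ) : Subring ℚ where
  carrier := {q | q.den.Coprime p}
  zero_mem' := by simp
  one_mem' := by simp
  add_mem' := by
    intro a b ha hb
    exact Nat.Coprime.of_dvd_left (Rat.add_den_dvd a b) (Nat.Coprime.mul_left ha hb)
  mul_mem' := by
    intro a b ha hb
    exact Nat.Coprime.of_dvd_left (Rat.mul_den_dvd a b) (Nat.Coprime.mul_left ha hb)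
  neg_mem' := by
    intro a ha
    simpa using ha

/-- The set of odd primes. -/
abbrev OddPrime : Type := {p : ℕ // p.Prime ∧ Odd p}

theorem zInvTwo_le_zLoc (p : OddPrime) : ZInvTwo ≤ ZLoc p.1 := by
  rintro q ⟨k, hk⟩
  exact Nat.Coprime.of_dvd_left hk
    (Nat.Coprime.pow_left k (Nat.coprime_two_left.2 p.2.2))

/-- The inclusion `ℤ[1/2] ⊆ ℤ_(p)` for an odd prime `p`. -/
def zInvTwoToZLoc (p : OddPrime) : ZInvTwo →+* ZLoc p.1 :=
  Subring.inclusion (zInvTwo_le_zLoc p)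

/-! ### Polynomial functors on finitely generated free abelian groups -/

/-- The property of an abelian group to be free and finitely generated. -/
def isFreeFinite : ObjectProperty AddCommGrpCat.{0} :=
  fun A => Module.Free ℤ A ∧ Module.Finite ℤ A

/-- The category of finitely generated free abelian groups and all homomorphisms. -/
abbrev Fab : Type 1 := isFreeFinite.FullSubcategory

/-- The direct sum `A₁ ⊕ ⋯ ⊕ Aₘ` of finitely generated free abelian groups. -/
def directSum {m : ℕ} (A : Fin m → Fab) : Fab where
  obj := AddCommGrpCat.of (∀ k, (A k).obj)
  property := by
    have h1 : ∀ k, Module.Free ℤ (A k).obj := fun k => (A k).property.1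
    have h2 : ∀ k, Module.Finite ℤ (A k).obj := fun k => (A k).property.2
    exact ⟨inferInstanceAs (Module.Free ℤ (∀ k, (A k).obj)),
      inferInstanceAs (Module.Finite ℤ (∀ k, (A k).obj))⟩

/-- The idempotent endomorphism `∑ k ∈ S, e_k` of `A₁ ⊕ ⋯ ⊕ Aₘ`, where `e_k` is the projection
onto the summand `A_k` followed by its embedding. -/
def summandIdem {m : ℕ} (A : Fin m → Fab) (S : Finset (Fin m)) : directSum A ⟶ directSum A :=
  ObjectProperty.homMk (AddCommGrpCat.ofHom
    (∑ k ∈ S, (AddMonoidHom.single (fun k => (A k).obj) k).comp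
      (Pi.evalAddMonoidHom (fun k => (A k).obj) k)))

section Functors

variable {R : Type} [CommRing R]

/-- The endomorphism `f(1 2 … m)` of `F(A₁ ⊕ ⋯ ⊕ Aₘ)`: the solution, given by inclusion-exclusion,
of the recursion `F(∑ k ∈ S, e_k) = ∑ T ⊆ S, f(T)`. -/
def crossIdem (F : Fab ⥤ ModuleCat.{u} R) {m : ℕ} (A : Fin m → Fab) :
    F.obj (directSum A) ⟶ F.obj (directSum A) :=
  ∑ T : Finset (Fin m), (-1 : ℤ) ^ (m - T.card) • F.map (summandIdem A T)

/-- The cross-effect `F_m(A₁ | ⋯ | Aₘ)`, the image of `f(1 2 … m)`. -/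
def crossEffect (F : Fab ⥤ ModuleCat.{u} R) {m : ℕ} (A : Fin m → Fab) :
    Submodule R (F.obj (directSum A)) :=
  LinearMap.range (crossIdem F A).hom

/-- A cubic `R`-module: a functor (not assumed additive) from finitely generated free abelian
groups to finitely generated `R`-modules which sends zero morphisms to zero morphisms and is
polynomial of degree at most `3`, i.e. all its cross-effects `F_m` with `m > 3` vanish. -/
structure IsCubic (F : Fab ⥤ ModuleCat.{u} R) : Prop where
  map_zero : ∀ A B : Fab, F.map (0 : A ⟶ B) = 0
  finite : ∀ A : Fab, Module.Finite R (F.obj A)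
  degree_le : ∀ m : ℕ, 3 < m → ∀ A : Fin m → Fab, crossEffect F A = ⊥

/-- The extension of scalars `A ↦ S ⊗_R F(A)` along a ring homomorphism `f : R →+* S`. It is used
below only for subrings `R ⊆ S` of `ℚ`, where `S ⊗_R V = S ⊗_ℤ V` for every `R`-module `V`. -/
noncomputable def extendAlong {S : Type} [CommRing S] (f : R →+* S)
    (F : Fab ⥤ ModuleCat.{u} R) : Fab ⥤ ModuleCat.{u} S :=
  F ⋙ ModuleCat.extendScalars f

theorem map_mem_torsion {V W : Type u} [AddCommGroup V] [Module R V] [AddCommGroup W] [Module R W]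
    (φ : V →ₗ[R] W) (x : V) (hx : x ∈ Submodule.torsion R V) : φ x ∈ Submodule.torsion R W := by
  obtain ⟨a, ha⟩ := hx
  refine ⟨a, ?_⟩
  have h := congrArg φ (show (a : R) • x = 0 from ha)
  rw [_root_.map_smul, _root_.map_zero] at h
  exact h

/-- The torsion part `t F : A ↦ t(F(A))` of `F`. -/
def torsion (F : Fab ⥤ ModuleCat.{u} R) : Fab ⥤ ModuleCat.{u} R where
  obj A := ModuleCat.of R (Submodule.torsion R (F.obj A))
  map f := ModuleCat.ofHom ((F.map f).hom.restrict (map_mem_torsion (F.map f).hom))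
  map_id A := by
    refine ModuleCat.hom_ext (LinearMap.ext fun x => Subtype.ext ?_)
    change (F.map (𝟙 A)).hom x.1 = x.1
    rw [F.map_id]
    rfl
  map_comp f g := by
    refine ModuleCat.hom_ext (LinearMap.ext fun x => Subtype.ext ?_)
    change (F.map (f ≫ g)).hom x.1 = (F.map g).hom ((F.map f).hom x.1)
    rw [F.map_comp]
    rfl

/-- `F` is torsion free: all its values are torsion free modules. -/
def IsTorsionFree (F : Fab ⥤ ModuleCat.{u} R) : Prop :=
  ∀ A : Fab, Submodule.torsion R (F.obj A) = ⊥

/-- The direct sum `⨁ i, F i : A ↦ ⨁ i, F i (A)` of a family of functors. -/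
noncomputable def directSumFunctor {ι : Type} (F : ι → Fab ⥤ ModuleCat.{u} R) :
    Fab ⥤ ModuleCat.{u} R where
  obj A := ModuleCat.of R (DirectSum ι fun i => (F i).obj A)
  map f := ModuleCat.ofHom (DirectSum.lmap fun i => ((F i).map f).hom)
  map_id A := by
    classical
    ext i x
    simp
  map_comp f g := by
    classical
    ext i x
    simp

end Functors

/-- The localization `M_(p) = ℤ_(p) ⊗ M` of a functor with values in `ℤ[1/2]`-modules. -/
noncomputable abbrev localize (p : OddPrime) (M : Fab ⥤ ModuleCat.{u} ZInvTwo) :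
    Fab ⥤ ModuleCat.{u} (ZLoc p.1) :=
  extendAlong (zInvTwoToZLoc p) M

/-- The rationalization `ℚ ⊗ F` of a functor with values in modules over a subring `R` of `ℚ`. -/
noncomputable abbrev rationalize {R : Subring ℚ} (F : Fab ⥤ ModuleCat.{u} R) :
    Fab ⥤ ModuleCat.{u} ℚ :=
  extendAlong R.subtype F

/-- A functor with values in `ℤ_(p)`-modules, regarded as one with values in
`ℤ[1/2]`-modules. -/
noncomputable abbrev toZInvTwo (p : OddPrime) (N : Fab ⥤ ModuleCat.{u} (ZLoc p.1)) :
    Fab ⥤ ModuleCat.{u} ZInvTwo :=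
  N ⋙ ModuleCat.restrictScalars (zInvTwoToZLoc p)

end CubicModules

/-! A cubic functor is determined by its value at ℤ³ together with the action of the multiplicative
monoid `Mat3` on it. The identity of a free group is a sum of maps of rank one; a cubic map sends a
sum into the span of its values at sums of three of the summands; and a sum of three maps of rank
one factors through ℤ³. Thus natural transformations amount to linear maps over the monoid ring
`MatRing` (`exists_natTrans`, `nonempty_iso_of_equiv`), and the theorem becomes a statement on
modules on which matrices act by a cubic map.

Where 6 is invertible these modules are as simple as possible. There are six types: the linear one,
the symmetric and exterior squares, and the three irreducible representations of the symmetric group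
on three letters. Each has a quasi-idempotent; its corner consists of integral multiples of itself,
corners between different types vanish (`symmetrizer_corner`), and together they generate an ideal
containing 216 = 6³ (`smul_one_mem_symmetrizerIdeal`). Hence a map of modules is the same as six
linear maps between the images of the quasi-idempotents (`exists_extension_of_typePart`). Over a
subring of ℚ, a principal ideal domain, it follows that torsion splits off and that a finitely
generated torsion free module is determined by six ranks, hence by its rationalization.

Only the prime 3 resists. For uniqueness, the localizations determine the torsion
(`exists_torsion_map`), and the torsion prime to 3 is a direct summand
(`exists_primeToThree_retraction`). An isomorphism of the localizations at 3 of the complements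
lifts, up to a factor prime to 3, to an injective map whose cokernel is torsion prime to 3. After
inverting 3 this map is diagonal in suitable bases of the six types. Powers of 2 represent all unit
classes modulo powers of 3, so the diagonal entries can be changed into units of ℤ[1/6] by a
correction divisible by 3 (`exists_unit_congr`). The corrected map is surjective both modulo 3 and
after inverting 3, hence surjective (`exists_surjective_of_injective`). Surjections in both
directions between Noetherian modules are isomorphisms.

For existence, a ℤ[1/2]-lattice L in the module given at 3 is generated by finitely many elements
(`exists_lattice_subfunctor`), and the torsion parts at the finitely many other primes with torsion
are added to it. At p ≠ 3 the localization of L and the torsion free part of the given module are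
lattices in the same rational module, so they are isomorphic because 6 is invertible in ℤ_(p)
(`exists_lattice_map`). -/

namespace CubicModules

/-! ### Deviations of functions between abelian groups -/

section Deviations

variable {A B : Type*} [AddCommGroup A] [AddCommGroup B]

/-- The second deviation of a function. -/
def dev2 (f : A → B) (a b : A) : B := f (a + b) - f a - f b

/-- The third deviation of a function vanishing at zero. -/
def dev3 (f : A → B) (a b c : A) : B :=
  f (a + b + c) - f (a + b) - f (a + c) - f (b + c) + f a + f b + f c

/-- The fourth deviation of a function vanishing at zero. -/
def dev4 (f : A → B) (a b c d : A) : B :=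
  f (a + b + c + d) - f (a + b + c) - f (a + b + d) - f (a + c + d) - f (b + c + d)
    + f (a + b) + f (a + c) + f (a + d) + f (b + c) + f (b + d) + f (c + d)
    - f a - f b - f c - f d

theorem dev3_comm (f : A → B) (a b c : A) : dev3 f a b c = dev3 f b a c := by
  simp only [dev3, add_comm b a]; abel

theorem dev3_comm' (f : A → B) (a b c : A) : dev3 f a b c = dev3 f a c b := by
  simp only [dev3, add_right_comm a c b, add_comm c b]; abel

/-- Each deviation measures the failure of the previous one to be additive. Vanishing of the fourth
therefore makes the third one trilinear. -/
theorem dev3_add_sub (f : A → B) (a d b c : A) :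
    dev3 f (a + d) b c - dev3 f a b c - dev3 f d b c = dev4 f a d b c := by
  simp only [dev3, dev4]
  abel

theorem dev2_add_sub (f : A → B) (a d b : A) :
    dev2 f (a + d) b - dev2 f a b - dev2 f d b = dev3 f a d b := by
  simp only [dev3, dev2]
  abel

theorem map_zsmul_of_additive {f : A → B} (h : ∀ a b, f (a + b) = f a + f b) (n : ℤ) (a : A) :
    f (n • a) = n • f a :=
  map_zsmul (AddMonoidHom.mk' f h) n a

/-- A function vanishing at zero whose fourth deviation vanishes. -/
structure IsCubicMap (f : A → B) : Prop where
  map_zero : f 0 = 0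
  dev4_eq_zero : ∀ a b c d, dev4 f a b c d = 0

namespace IsCubicMap

variable {f : A → B} (hf : IsCubicMap f)

include hf

theorem dev3_add (a d b c : A) : dev3 f (a + d) b c = dev3 f a b c + dev3 f d b c := by
  have := dev3_add_sub f a d b c
  rw [hf.dev4_eq_zero, sub_sub, sub_eq_zero] at this
  exact this

theorem dev3_add' (a b d c : A) : dev3 f a (b + d) c = dev3 f a b c + dev3 f a d c := by
  rw [dev3_comm, hf.dev3_add, dev3_comm f b, dev3_comm f d]

theorem dev3_add'' (a b c d : A) : dev3 f a b (c + d) = dev3 f a b c + dev3 f a b d := by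
  rw [dev3_comm', hf.dev3_add', dev3_comm' f a c, dev3_comm' f a d]

end IsCubicMap
end Deviations

/-! ### Homogeneous parts of a cubic map, with denominators cleared. -/

section Polarization

variable {A B : Type*} [AddCommGroup A] [AddCommGroup B]

/-- Polarization: the factor is 3!. This is why `quadPart` starts from 6f: subtracting the diagonal
of the third deviation then removes the cubic part. -/
theorem dev3_cube {C : A → A → A → B} (h : ∀ a d b c, C (a + d) b c = C a b c + C d b c)
    (s : ∀ a b c, C a b c = C b a c) (s' : ∀ a b c, C a b c = C a c b) (a b c : A) :
    dev3 (fun g => C g g g) a b c = (6 : ℤ) • C a b c := by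
  have h2 : ∀ a b d c, C a (b + d) c = C a b c + C a d c := fun a b d c => by
    rw [s, h, s b, s d]
  have h3 : ∀ a b c d, C a b (c + d) = C a b c + C a b d := fun a b c d => by
    rw [s', h2, s' a c, s' a d]
  simp only [dev3, h, h2, h3]
  have e1 : C a c b = C a b c := s' _ _ _
  have e2 : C b a c = C a b c := s _ _ _
  have e3 : C b c a = C a b c := by rw [s', s]
  have e4 : C c a b = C a b c := by rw [s, s']
  have e5 : C c b a = C a b c := by rw [s', s, s']
  rw [e1, e2, e3, e4, e5, show (6 : ℤ) = 1 + 1 + 1 + 1 + 1 + 1 by norm_num]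
  simp only [add_smul, one_smul]
  abel

theorem dev2_square {C : A → A → B} (h : ∀ a d b, C (a + d) b = C a b + C d b)
    (s : ∀ a b, C a b = C b a) (a b : A) :
    dev2 (fun g => C g g) a b = (2 : ℤ) • C a b := by
  have h2 : ∀ a b d, C a (b + d) = C a b + C a d := fun a b d => by
    rw [s, h, s b, s d]
  simp only [dev2, h, h2]
  rw [s b a, show (2 : ℤ) = 1 + 1 by norm_num, add_smul, one_smul]
  abel

/-- Six times the part of degree at most two of a cubic function. -/
def quadPart (f : A → B) (g : A) : B := (6 : ℤ) • f g - dev3 f g g g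

/-- Six times the polarization of the quadratic part of a cubic function. -/
def bilPart (f : A → B) (a b : A) : B := dev2 (quadPart f) a b

/-- Twelve times the linear part of a cubic function. -/
def linPart (f : A → B) (g : A) : B := (2 : ℤ) • quadPart f g - bilPart f g g

/-- The decomposition into parts of degree 3, 2 and 1. It is formal, since `linPart` is the
remainder; cubicity is what makes the three parts homogeneous. -/
theorem twelve_smul_eq (f : A → B) (g : A) :
    (12 : ℤ) • f g = (2 : ℤ) • dev3 f g g g + bilPart f g g + linPart f g := by
  simp only [linPart, quadPart]
  module

theorem bilPart_comm (f : A → B) (a b : A) : bilPart f a b = bilPart f b a := by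
  simp only [bilPart, dev2, add_comm b a]; abel

namespace IsCubicMap

variable {f : A → B} (hf : IsCubicMap f)

include hf

theorem dev3_quadPart (a b c : A) : dev3 (quadPart f) a b c = 0 := by
  have h1 := dev3_cube hf.dev3_add (dev3_comm f) (dev3_comm' f) a b c
  have h2 : dev3 (quadPart f) a b c =
      (6 : ℤ) • dev3 f a b c - dev3 (fun g => dev3 f g g g) a b c := by
    simp only [dev3, quadPart]
    module
  rw [h2, h1, sub_self]

theorem bilPart_add (a d b : A) : bilPart f (a + d) b = bilPart f a b + bilPart f d b := by
  have := dev2_add_sub (quadPart f) a d b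
  rw [hf.dev3_quadPart, sub_sub, sub_eq_zero] at this
  exact this

theorem bilPart_add' (a b d : A) : bilPart f a (b + d) = bilPart f a b + bilPart f a d := by
  rw [bilPart_comm, hf.bilPart_add, bilPart_comm f b, bilPart_comm f d]

theorem linPart_add (a b : A) : linPart f (a + b) = linPart f a + linPart f b := by
  have h1 := dev2_square hf.bilPart_add (bilPart_comm f) a b
  have h2 : dev2 (linPart f) a b =
      (2 : ℤ) • bilPart f a b - dev2 (fun g => bilPart f g g) a b := by
    simp only [dev2, linPart, bilPart]
    module
  rw [h1, sub_self, dev2, sub_sub, sub_eq_zero] at h2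
  exact h2

theorem dev3_smul (n m k : ℤ) (a b c : A) :
    dev3 f (n • a) (m • b) (k • c) = (n * m * k) • dev3 f a b c := by
  rw [map_zsmul_of_additive (f := fun x => dev3 f x (m • b) (k • c))
      (fun x y => hf.dev3_add x y _ _),
    map_zsmul_of_additive (f := fun x => dev3 f a x (k • c)) (fun x y => hf.dev3_add' a x y _),
    map_zsmul_of_additive (f := fun x => dev3 f a b x) (fun x y => hf.dev3_add'' a b x y),
    smul_smul, smul_smul]

theorem bilPart_smul (n m : ℤ) (a b : A) :
    bilPart f (n • a) (m • b) = (n * m) • bilPart f a b := by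
  rw [map_zsmul_of_additive (f := fun x => bilPart f x (m • b))
      (fun x y => hf.bilPart_add x y _),
    map_zsmul_of_additive (f := fun x => bilPart f a x) (fun x y => hf.bilPart_add' a x y),
    smul_smul]

theorem linPart_smul (n : ℤ) (a : A) : linPart f (n • a) = n • linPart f a :=
  map_zsmul_of_additive hf.linPart_add n a

end IsCubicMap
end Polarization

/-! ### Cubic representations of a ring -/

section Multiplicative

variable {A B : Type*} [Ring A] [Ring B]

variable {f : A →* B}

theorem mul_dev3 (x a b c : A) : f x * dev3 f a b c = dev3 f (x * a) (x * b) (x * c) := by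
  simp only [dev3, mul_add, mul_sub, ← map_mul]

theorem dev3_mul (x a b c : A) : dev3 f a b c * f x = dev3 f (a * x) (b * x) (c * x) := by
  simp only [dev3, add_mul, sub_mul, ← map_mul]

theorem mul_quadPart (x a : A) : f x * quadPart f a = quadPart f (x * a) := by
  simp only [quadPart, mul_sub, mul_dev3, mul_smul_comm, map_mul]

theorem quadPart_mul (x a : A) : quadPart f a * f x = quadPart f (a * x) := by
  simp only [quadPart, sub_mul, dev3_mul, smul_mul_assoc, map_mul]

theorem mul_bilPart (x a b : A) : f x * bilPart f a b = bilPart f (x * a) (x * b) := by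
  simp only [bilPart, dev2, mul_sub, mul_quadPart, mul_add]

theorem bilPart_mul (x a b : A) : bilPart f a b * f x = bilPart f (a * x) (b * x) := by
  simp only [bilPart, dev2, sub_mul, quadPart_mul, add_mul]

theorem mul_linPart (x a : A) : f x * linPart f a = linPart f (x * a) := by
  simp only [linPart, mul_sub, mul_quadPart, mul_bilPart, mul_smul_comm]

theorem linPart_mul (x a : A) : linPart f a * f x = linPart f (a * x) := by
  simp only [linPart, sub_mul, quadPart_mul, bilPart_mul, smul_mul_assoc]

namespace IsCubicMap

variable (hf : IsCubicMap f)

include hf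

/-- The right factor is an alternating sum of values at partial sums of x, y, z. After expansion by
trilinearity of the left factor, inclusion-exclusion leaves only the terms in which each of x, y, z
occurs once. -/
theorem dev3_mul_dev3 (a b c x y z : A) :
    dev3 f a b c * dev3 f x y z =
      dev3 f (a * x) (b * y) (c * z) + dev3 f (a * x) (b * z) (c * y) +
      dev3 f (a * y) (b * x) (c * z) + dev3 f (a * y) (b * z) (c * x) +
      dev3 f (a * z) (b * x) (c * y) + dev3 f (a * z) (b * y) (c * x) := by
  rw [show dev3 f x y z = f (x + y + z) - f (x + y) - f (x + z) - f (y + z) + f x + f y + f z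
    from rfl]
  simp only [mul_add, mul_sub, dev3_mul, hf.dev3_add, hf.dev3_add', hf.dev3_add'']
  abel

variable (h6 : ∀ b : B, (6 : ℤ) • b = 0 → b = 0)

-- The difference of the two scalars divides 36, so cancelling 6 twice suffices.
omit hf in
include h6 in
theorem eq_zero_of_smul_eq {b : B} {n m k : ℤ} (h : n • b = m • b) (hk : (n - m) * k = 36) :
    b = 0 := by
  refine h6 _ (h6 _ ?_)
  rw [smul_smul, show (6 : ℤ) * 6 = k * (n - m) by linarith, mul_smul, sub_smul, h, sub_self,
    smul_zero]

theorem dev3_mul_scalar (a b c : A) : dev3 f a b c * f ((2 : ℤ) • 1) = (8 : ℤ) • dev3 f a b c := by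
  rw [dev3_mul]; simp only [mul_smul_comm, mul_one]; rw [hf.dev3_smul]; norm_num

theorem scalar_mul_dev3 (a b c : A) : f ((2 : ℤ) • 1) * dev3 f a b c = (8 : ℤ) • dev3 f a b c := by
  rw [mul_dev3]; simp only [smul_mul_assoc, one_mul]; rw [hf.dev3_smul]; norm_num

theorem bilPart_mul_scalar (a b : A) : bilPart f a b * f ((2 : ℤ) • 1) = (4 : ℤ) • bilPart f a b := by
  rw [bilPart_mul]; simp only [mul_smul_comm, mul_one]; rw [hf.bilPart_smul]; norm_num

theorem scalar_mul_bilPart (a b : A) : f ((2 : ℤ) • 1) * bilPart f a b = (4 : ℤ) • bilPart f a b := by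
  rw [mul_bilPart]; simp only [smul_mul_assoc, one_mul]; rw [hf.bilPart_smul]; norm_num

theorem linPart_mul_scalar (a : A) : linPart f a * f ((2 : ℤ) • 1) = (2 : ℤ) • linPart f a := by
  rw [linPart_mul]; simp only [mul_smul_comm, mul_one]; rw [hf.linPart_smul]

theorem scalar_mul_linPart (a : A) : f ((2 : ℤ) • 1) * linPart f a = (2 : ℤ) • linPart f a := by
  rw [mul_linPart]; simp only [smul_mul_assoc, one_mul]; rw [hf.linPart_smul]

-- Comparison of eigenvalues. In the applications z is the image of the scalar matrix 2, which acts
-- on the part of degree d by 2^d, so parts of different degrees are orthogonal.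
omit hf in
include h6 in
theorem mul_eq_zero_of_weights {x y z : B} {n m k : ℤ} (hx : x * z = n • x) (hy : z * y = m • y)
    (hk : (n - m) * k = 36) : x * y = 0 := by
  refine eq_zero_of_smul_eq h6 (n := n) (m := m) ?_ hk
  rw [← smul_mul_assoc, ← hx, mul_assoc, hy, mul_smul_comm]

include h6

theorem bilPart_mul_dev3 (a b x y z : A) : bilPart f a b * dev3 f x y z = 0 :=
  mul_eq_zero_of_weights h6 (k := -9) (hf.bilPart_mul_scalar _ _) (hf.scalar_mul_dev3 _ _ _)
    (by norm_num)

theorem linPart_mul_dev3 (a x y z : A) : linPart f a * dev3 f x y z = 0 :=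
  mul_eq_zero_of_weights h6 (k := -6) (hf.linPart_mul_scalar _) (hf.scalar_mul_dev3 _ _ _)
    (by norm_num)

theorem linPart_mul_bilPart (a x y : A) : linPart f a * bilPart f x y = 0 :=
  mul_eq_zero_of_weights h6 (k := -18) (hf.linPart_mul_scalar _) (hf.scalar_mul_bilPart _ _)
    (by norm_num)

theorem bilPart_mul_quadPart (a b x : A) :
    bilPart f a b * quadPart f x = (6 : ℤ) • bilPart f (a * x) (b * x) := by
  rw [quadPart, mul_sub, hf.bilPart_mul_dev3 h6, sub_zero, mul_smul_comm, bilPart_mul]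

theorem bilPart_mul_bilPart (a b x y : A) :
    bilPart f a b * bilPart f x y =
      (6 : ℤ) • (bilPart f (a * x) (b * y) + bilPart f (a * y) (b * x)) := by
  rw [show bilPart f x y = quadPart f (x + y) - quadPart f x - quadPart f y from rfl, mul_sub,
    mul_sub, hf.bilPart_mul_quadPart h6, hf.bilPart_mul_quadPart h6, hf.bilPart_mul_quadPart h6,
    mul_add, mul_add, hf.bilPart_add, hf.bilPart_add', hf.bilPart_add']
  module

theorem linPart_mul_linPart (a x : A) :
    linPart f a * linPart f x = (12 : ℤ) • linPart f (a * x) := by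
  rw [show linPart f x = (2 : ℤ) • quadPart f x - bilPart f x x from rfl, mul_sub,
    hf.linPart_mul_bilPart h6, quadPart, mul_smul_comm, mul_sub, hf.linPart_mul_dev3 h6,
    mul_smul_comm, linPart_mul]
  module

end IsCubicMap
end Multiplicative


/-! ### Young symmetrizers for the symmetric group on three letters -/

section Young

variable {B : Type*} [Ring B]

/-- The sum of the elements of the group generated by two involutions with a braid relation. -/
def symElt (s t : B) : B := 1 + s + t + s * t + t * s + s * t * s

/-- The alternating sum of the elements of that group. -/
def altElt (s t : B) : B := 1 - s - t + s * t + t * s - s * t * s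

/-- A Young symmetrizer of shape `(2, 1)`. -/
def hookElt (s t : B) : B := 1 + s - t - s * t

variable {s t : B} (hs : s * s = 1) (ht : t * t = 1) (hst : t * s * t = s * t * s)

include hs ht hst

theorem braid_simps : (∀ x, s * (s * x) = x) ∧ (∀ x, t * (t * x) = x) ∧
    (t * (s * t) = s * (t * s)) ∧ ∀ x, t * (s * (t * x)) = s * (t * (s * x)) :=
  ⟨fun x => by rw [← mul_assoc, hs, one_mul], fun x => by rw [← mul_assoc, ht, one_mul],
    by rw [← mul_assoc, hst, mul_assoc],
    fun x => by rw [← mul_assoc, ← mul_assoc, hst, mul_assoc, mul_assoc]⟩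

/-- A general element of the group algebra. -/
abbrev braidComb (s t : B) (n : Fin 6 → ℤ) : B :=
  n 0 • 1 + n 1 • s + n 2 • t + n 3 • (s * t) + n 4 • (t * s) + n 5 • (s * t * s)

theorem braidComb_mul_symElt (n : Fin 6 → ℤ) :
    braidComb s t n * symElt s t = (n 0 + n 1 + n 2 + n 3 + n 4 + n 5) • symElt s t := by
  obtain ⟨h1, h2, h3, h4⟩ := braid_simps hs ht hst
  have e1 : s * symElt s t = symElt s t := by
    simp only [symElt, mul_add, mul_one, mul_assoc, hs, h1]; abel
  have e2 : t * symElt s t = symElt s t := by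
    simp only [symElt, mul_add, mul_one, mul_assoc, hs, ht, h2, h3, h4]; abel
  simp only [braidComb, add_mul, smul_mul_assoc, mul_assoc, e1, e2, one_mul]
  module

theorem braidComb_mul_altElt (n : Fin 6 → ℤ) :
    braidComb s t n * altElt s t = (n 0 - n 1 - n 2 + n 3 + n 4 - n 5) • altElt s t := by
  obtain ⟨h1, h2, h3, h4⟩ := braid_simps hs ht hst
  have e1 : s * altElt s t = - altElt s t := by
    simp only [altElt, mul_add, mul_sub, mul_one, mul_assoc, hs, h1]; abel
  have e2 : t * altElt s t = - altElt s t := by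
    simp only [altElt, mul_add, mul_sub, mul_one, mul_assoc, hs, ht, h2, h3, h4]; abel
  simp only [braidComb, add_mul, smul_mul_assoc, mul_assoc, e1, e2, one_mul, mul_neg, neg_neg]
  module

theorem symElt_mul_braidComb (n : Fin 6 → ℤ) :
    symElt s t * braidComb s t n = (n 0 + n 1 + n 2 + n 3 + n 4 + n 5) • symElt s t := by
  obtain ⟨h1, h2, h3, h4⟩ := braid_simps hs ht hst
  have e1 : symElt s t * s = symElt s t := by
    simp only [symElt, add_mul, one_mul, mul_assoc, hs, mul_one]; abel
  have e2 : symElt s t * t = symElt s t := by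
    simp only [symElt, add_mul, one_mul, mul_one, mul_assoc, ht, h1, h3]; abel
  simp only [braidComb, mul_add, mul_smul_comm, ← mul_assoc, e1, e2, mul_one]
  module

theorem altElt_mul_braidComb (n : Fin 6 → ℤ) :
    altElt s t * braidComb s t n = (n 0 - n 1 - n 2 + n 3 + n 4 - n 5) • altElt s t := by
  obtain ⟨h1, h2, h3, h4⟩ := braid_simps hs ht hst
  have e1 : altElt s t * s = - altElt s t := by
    simp only [altElt, add_mul, sub_mul, one_mul, mul_one, mul_assoc, hs]; abel
  have e2 : altElt s t * t = - altElt s t := by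
    simp only [altElt, add_mul, sub_mul, one_mul, mul_one, mul_assoc, ht, h1, h3]
    abel
  simp only [braidComb, mul_add, mul_smul_comm, ← mul_assoc, e1, e2, mul_one, neg_mul, neg_neg]
  module

/-- Here `hookElt` is (1 + s)(1 - t), a multiple of a primitive idempotent of the two-dimensional
representation, so its corner is scalar. The factor 3 is the order of the group divided by that
dimension. -/
theorem hookElt_mul_braidComb_mul_hookElt (n : Fin 6 → ℤ) :
    hookElt s t * braidComb s t n * hookElt s t =
      (3 * (n 0 + n 1 - n 2 - n 4)) • hookElt s t := by
  obtain ⟨h1, h2, h3, h4⟩ := braid_simps hs ht hst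
  simp only [braidComb, hookElt, add_mul, sub_mul, mul_add, mul_sub, smul_mul_assoc,
    mul_smul_comm, one_mul, mul_one, mul_assoc, hs, ht, h1, h2, h3, h4, smul_add, smul_sub]
  module

omit hs ht hst in
theorem symElt_eq : symElt s t = braidComb s t ![1, 1, 1, 1, 1, 1] := by
  simp [symElt, braidComb]

omit hs ht hst in
theorem altElt_eq : altElt s t = braidComb s t ![1, -1, -1, 1, 1, -1] := by
  simp [altElt, braidComb]; abel

omit hs ht hst in
theorem hookElt_eq : hookElt s t = braidComb s t ![1, 1, -1, -1, 0, 0] := by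
  simp [hookElt, braidComb]; abel

theorem young_corner_sym (n : Fin 6 → ℤ) :
    symElt s t * braidComb s t n * symElt s t =
        (6 * (n 0 + n 1 + n 2 + n 3 + n 4 + n 5)) • symElt s t ∧
      symElt s t * braidComb s t n * altElt s t = 0 ∧
      symElt s t * braidComb s t n * hookElt s t = 0 := by
  have h : ∀ m, symElt s t * braidComb s t m =
    (m 0 + m 1 + m 2 + m 3 + m 4 + m 5) • symElt s t := symElt_mul_braidComb hs ht hst
  refine ⟨?_, ?_, ?_⟩ <;> rw [h, smul_mul_assoc]
  · nth_rw 2 [symElt_eq]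
    rw [h, smul_smul, mul_comm]; simp
  · rw [altElt_eq, h]; simp
  · rw [hookElt_eq, h]; simp

theorem young_corner_alt (n : Fin 6 → ℤ) :
    altElt s t * braidComb s t n * symElt s t = 0 ∧
      altElt s t * braidComb s t n * altElt s t =
        (6 * (n 0 - n 1 - n 2 + n 3 + n 4 - n 5)) • altElt s t ∧
      altElt s t * braidComb s t n * hookElt s t = 0 := by
  have h : ∀ m, altElt s t * braidComb s t m =
    (m 0 - m 1 - m 2 + m 3 + m 4 - m 5) • altElt s t := altElt_mul_braidComb hs ht hst
  refine ⟨?_, ?_, ?_⟩ <;> rw [h, smul_mul_assoc]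
  · rw [symElt_eq, h]; simp
  · nth_rw 2 [altElt_eq]
    rw [h, smul_smul, mul_comm]; simp
  · rw [hookElt_eq, h]; simp

theorem young_corner_hook (n : Fin 6 → ℤ) :
    hookElt s t * braidComb s t n * symElt s t = 0 ∧
      hookElt s t * braidComb s t n * altElt s t = 0 := by
  refine ⟨?_, ?_⟩ <;> rw [mul_assoc]
  · rw [braidComb_mul_symElt hs ht hst, mul_smul_comm, hookElt_eq,
      braidComb_mul_symElt hs ht hst]
    simp
  · rw [braidComb_mul_altElt hs ht hst, mul_smul_comm, hookElt_eq,
      braidComb_mul_altElt hs ht hst]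
    simp

/-- The unit is the sum of the three central idempotents. The symmetric and alternating sums are 6
times theirs, and the sum of the conjugates of the hook element, 6 - 3(st + ts), is 9 times the
remaining one. -/
theorem sum_conj_hookElt :
    (3 : ℤ) • symElt s t + (3 : ℤ) • altElt s t + (2 : ℤ) • (hookElt s t + s * hookElt s t * s +
      t * hookElt s t * t + s * t * hookElt s t * (t * s) + t * s * hookElt s t * (s * t) +
      s * t * s * hookElt s t * (s * t * s)) = (18 : ℤ) • 1 := by
  obtain ⟨h1, h2, h3, h4⟩ := braid_simps hs ht hst
  simp only [symElt, altElt, hookElt, add_mul, sub_mul, mul_add, mul_sub,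
    one_mul, mul_one, mul_assoc, hs, ht, h1, h2, h3, h4]
  module

end Young

/-! ### The quasi-idempotents attached to the six simple types -/

/-- The multiplicative monoid of integral matrices of size three. -/
abbrev Mat3 : Type := Matrix (Fin 3) (Fin 3) ℤ

/-- The matrix units. -/
def unitMat (i j : Fin 3) : Mat3 := Matrix.single i j 1

theorem unitMat_mul (i j k l : Fin 3) :
    unitMat i j * unitMat k l = if j = k then unitMat i l else 0 := by
  unfold unitMat
  split_ifs with h
  · subst h; simp
  · exact Matrix.single_mul_single_of_ne _ _ _ _ h _

theorem one_eq_sum_unitMat : (1 : Mat3) = unitMat 0 0 + unitMat 1 1 + unitMat 2 2 := by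
  ext a b; fin_cases a <;> fin_cases b <;> simp [unitMat]

theorem unitMat_mul_mul (i j : Fin 3) (x : Mat3) :
    unitMat i i * x * unitMat j j = x i j • unitMat i j := by
  unfold unitMat
  rw [Matrix.single_mul_mul_single]
  simp

/-- The permutation matrix of the transposition of the first two indices. -/
def swapMat : Mat3 := unitMat 0 1 + unitMat 1 0 + unitMat 2 2

/-- The permutation matrix of the transposition of the last two indices. -/
def swapMat' : Mat3 := unitMat 0 0 + unitMat 1 2 + unitMat 2 1

theorem swapMat_mul_self : swapMat * swapMat = 1 := by
  simp [swapMat, mul_add, add_mul, unitMat_mul, one_eq_sum_unitMat]; abel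

theorem swapMat'_mul_self : swapMat' * swapMat' = 1 := by
  simp [swapMat', mul_add, add_mul, unitMat_mul, one_eq_sum_unitMat]; abel

theorem swapMat_braid : swapMat' * swapMat * swapMat' = swapMat * swapMat' * swapMat := by
  simp [swapMat, swapMat', mul_add, add_mul, unitMat_mul]; abel

section

variable {B : Type*} [Ring B] (f : Mat3 →* B)

/-- The multilinear part of a cubic representation. -/
def cubeUnit : B := dev3 f (unitMat 0 0) (unitMat 1 1) (unitMat 2 2)

/-- The bilinear part of a cubic representation. -/
def squareUnit : B := bilPart f (unitMat 0 0) (unitMat 1 1)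

/-- The six quasi-idempotents. -/
def symmetrizer : Fin 6 → B :=
  ![linPart f (unitMat 0 0), squareUnit f * (1 + f swapMat), squareUnit f * (1 - f swapMat),
    cubeUnit f * symElt (f swapMat) (f swapMat'), cubeUnit f * altElt (f swapMat) (f swapMat'),
    cubeUnit f * hookElt (f swapMat) (f swapMat')]

/-- The coefficient of the reduction of a matrix in the group algebra of the permutations. -/
def permCoeff (x : Mat3) : Fin 6 → ℤ :=
  ![x 0 0 * x 1 1 * x 2 2, x 0 1 * x 1 0 * x 2 2, x 0 0 * x 1 2 * x 2 1, x 0 2 * x 1 0 * x 2 1,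
    x 0 1 * x 1 2 * x 2 0, x 0 2 * x 1 1 * x 2 0]

/-- The scalars by which the corners of the six quasi-idempotents act. -/
def cornerScalar (x : Mat3) : Fin 6 → ℤ :=
  ![12 * x 0 0, 12 * (x 0 0 * x 1 1 + x 0 1 * x 1 0), 12 * (x 0 0 * x 1 1 - x 0 1 * x 1 0),
    6 * (permCoeff x 0 + permCoeff x 1 + permCoeff x 2 + permCoeff x 3 + permCoeff x 4 +
      permCoeff x 5),
    6 * (permCoeff x 0 - permCoeff x 1 - permCoeff x 2 + permCoeff x 3 + permCoeff x 4 -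
      permCoeff x 5),
    3 * (permCoeff x 0 + permCoeff x 1 - permCoeff x 2 - permCoeff x 4)]

/-- Twice the weights of the central scalar `2` on the six types. -/
def typeWeight : Fin 6 → ℤ := ![2, 4, 4, 8, 8, 8]

variable {f}

theorem swap_mul_self : f swapMat * f swapMat = 1 := by
  rw [← map_mul, swapMat_mul_self, map_one]

theorem swap'_mul_self : f swapMat' * f swapMat' = 1 := by
  rw [← map_mul, swapMat'_mul_self, map_one]

theorem swap_braid : f swapMat' * f swapMat * f swapMat' = f swapMat * f swapMat' * f swapMat := by
  simp only [← map_mul, swapMat_braid]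

theorem cubeUnit_comm_swap : f swapMat * cubeUnit f = cubeUnit f * f swapMat := by
  rw [cubeUnit, mul_dev3, dev3_mul]
  simp [swapMat, mul_add, add_mul, unitMat_mul]
  rw [dev3_comm]

theorem cubeUnit_comm_swap' : f swapMat' * cubeUnit f = cubeUnit f * f swapMat' := by
  rw [cubeUnit, mul_dev3, dev3_mul]
  simp [swapMat', mul_add, add_mul, unitMat_mul]
  rw [dev3_comm']

theorem squareUnit_comm_swap : f swapMat * squareUnit f = squareUnit f * f swapMat := by
  rw [squareUnit, mul_bilPart, bilPart_mul]
  simp [swapMat, mul_add, add_mul, unitMat_mul]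
  rw [bilPart_comm]

theorem cubeUnit_comm_braidComb (n : Fin 6 → ℤ) :
    braidComb (f swapMat) (f swapMat') n * cubeUnit f =
      cubeUnit f * braidComb (f swapMat) (f swapMat') n := by
  have h : Commute (f swapMat) (cubeUnit f) := cubeUnit_comm_swap
  have h' : Commute (f swapMat') (cubeUnit f) := cubeUnit_comm_swap'
  refine Commute.eq ?_
  have c : ∀ {x : B} (m : ℤ), Commute x (cubeUnit f) → Commute (m • x) (cubeUnit f) :=
    fun m hx => hx.smul_left m
  exact ((((((c _ (Commute.one_left _)).add_left (c _ h)).add_left (c _ h')).add_left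
    (c _ (h.mul_left h'))).add_left (c _ (h'.mul_left h))).add_left
    (c _ ((h.mul_left h').mul_left h)))

variable (hf : IsCubicMap f)

include hf

/-- The product formula for third deviations gives one term per permutation, and the matrix units
extract the corresponding product of entries of x. The corner is thus the group algebra of the
permutation matrices, where Young symmetrizers apply. -/
theorem cubeUnit_corner (x : Mat3) :
    cubeUnit f * f x * cubeUnit f =
      cubeUnit f * braidComb (f swapMat) (f swapMat') (permCoeff x) := by
  rw [cubeUnit, dev3_mul, hf.dev3_mul_dev3]
  simp only [unitMat_mul_mul, hf.dev3_smul, braidComb, mul_add, mul_smul_comm, mul_one, dev3_mul,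
    ← map_mul]
  simp [swapMat, swapMat', mul_add, add_mul, unitMat_mul, permCoeff]
  abel

variable (h6 : ∀ b : B, (6 : ℤ) • b = 0 → b = 0)

include h6

theorem squareUnit_corner (x : Mat3) :
    squareUnit f * f x * squareUnit f =
      (6 : ℤ) • (squareUnit f * ((x 0 0 * x 1 1) • 1 + (x 0 1 * x 1 0) • f swapMat)) := by
  rw [squareUnit, bilPart_mul, hf.bilPart_mul_bilPart h6]
  simp only [unitMat_mul_mul, hf.bilPart_smul, mul_add, mul_smul_comm, mul_one, bilPart_mul]
  simp [swapMat, mul_add, unitMat_mul]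

theorem linPart_corner (x : Mat3) :
    linPart f (unitMat 0 0) * f x * linPart f (unitMat 0 0) =
      (12 * x 0 0) • linPart f (unitMat 0 0) := by
  rw [linPart_mul, hf.linPart_mul_linPart h6, unitMat_mul_mul, hf.linPart_smul, smul_smul]

end

section

variable {B : Type*} [Ring B] {f : Mat3 →* B}

theorem symmetrizer_three_eq : symmetrizer f 3 = cubeUnit f * symElt (f swapMat) (f swapMat') := rfl
theorem symmetrizer_four_eq : symmetrizer f 4 = cubeUnit f * altElt (f swapMat) (f swapMat') := rfl
theorem symmetrizer_five_eq : symmetrizer f 5 = cubeUnit f * hookElt (f swapMat) (f swapMat') := rfl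

variable (hf : IsCubicMap f)

include hf

theorem scalar_mul_symmetrizer (i : Fin 6) :
    f ((2 : ℤ) • 1) * symmetrizer f i = typeWeight i • symmetrizer f i := by
  fin_cases i <;>
    simp only [symmetrizer, typeWeight, cubeUnit, squareUnit, ← mul_assoc, Fin.reduceFinMk,
      Matrix.cons_val, hf.scalar_mul_linPart, hf.scalar_mul_bilPart, hf.scalar_mul_dev3,
      smul_mul_assoc]

omit hf in
theorem symmetrizer_two_comm (n : ℤ) :
    (1 + n • f swapMat) * squareUnit f = squareUnit f * (1 + n • f swapMat) := by
  rw [add_mul, mul_add, smul_mul_assoc, squareUnit_comm_swap, mul_smul_comm, one_mul, mul_one]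

theorem symmetrizer_mul_scalar (i : Fin 6) :
    symmetrizer f i * f ((2 : ℤ) • 1) = typeWeight i • symmetrizer f i := by
  have h : ∀ y, f y * f ((2 : ℤ) • 1) = f ((2 : ℤ) • 1) * f y := fun y => by
    rw [← map_mul, ← map_mul, mul_smul_comm, smul_mul_assoc, one_mul, mul_one]
  have hc : ∀ i, f ((2 : ℤ) • 1) * symmetrizer f i = symmetrizer f i * f ((2 : ℤ) • 1) := by
    have hl : ∀ y, f ((2 : ℤ) • 1) * linPart f y = linPart f y * f ((2 : ℤ) • 1) := fun y => by
      rw [hf.linPart_mul_scalar, hf.scalar_mul_linPart]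
    have hb : Commute (f ((2 : ℤ) • 1)) (squareUnit f) := by
      rw [Commute, SemiconjBy, squareUnit, hf.bilPart_mul_scalar, hf.scalar_mul_bilPart]
    have hd : Commute (f ((2 : ℤ) • 1)) (cubeUnit f) := by
      rw [Commute, SemiconjBy, cubeUnit, hf.dev3_mul_scalar, hf.scalar_mul_dev3]
    have hs : Commute (f ((2 : ℤ) • 1)) (f swapMat) := (h _).symm
    have ht : Commute (f ((2 : ℤ) • 1)) (f swapMat') := (h _).symm
    have h1 : Commute (f ((2 : ℤ) • 1)) 1 := Commute.one_right _
    intro i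
    fin_cases i
    · exact hl _
    · exact hb.mul_right (h1.add_right hs)
    · exact hb.mul_right (h1.sub_right hs)
    · exact hd.mul_right (((((h1.add_right hs).add_right ht).add_right (hs.mul_right ht)).add_right
        (ht.mul_right hs)).add_right ((hs.mul_right ht).mul_right hs))
    · exact hd.mul_right (((((h1.sub_right hs).sub_right ht).add_right (hs.mul_right ht)).add_right
        (ht.mul_right hs)).sub_right ((hs.mul_right ht).mul_right hs))
    · exact hd.mul_right (((h1.add_right hs).sub_right ht).sub_right (hs.mul_right ht))
  rw [← hc, scalar_mul_symmetrizer hf]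

theorem cube_corner (n m : Fin 6 → ℤ) (x : Mat3) :
    cubeUnit f * braidComb (f swapMat) (f swapMat') n * f x *
      (cubeUnit f * braidComb (f swapMat) (f swapMat') m) =
    cubeUnit f * (braidComb (f swapMat) (f swapMat') n *
      braidComb (f swapMat) (f swapMat') (permCoeff x) *
      braidComb (f swapMat) (f swapMat') m) := by
  have h := cubeUnit_corner hf x
  rw [← cubeUnit_comm_braidComb n]
  calc _ = braidComb (f swapMat) (f swapMat') n * (cubeUnit f * f x * cubeUnit f) *
        braidComb (f swapMat) (f swapMat') m := by simp only [mul_assoc]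
    _ = _ := by
      rw [h, ← mul_assoc, cubeUnit_comm_braidComb n]
      simp only [mul_assoc]

variable (h6 : ∀ b : B, (6 : ℤ) • b = 0 → b = 0)

include h6

theorem square_corner (n m : ℤ) (x : Mat3) :
    squareUnit f * (1 + n • f swapMat) * f x * (squareUnit f * (1 + m • f swapMat)) =
      (6 : ℤ) • (squareUnit f * ((1 + n • f swapMat) *
        ((x 0 0 * x 1 1) • 1 + (x 0 1 * x 1 0) • f swapMat) * (1 + m • f swapMat))) := by
  have h := squareUnit_corner hf h6 x
  rw [← symmetrizer_two_comm n]
  calc _ = (1 + n • f swapMat) * (squareUnit f * f x * squareUnit f) * (1 + m • f swapMat) := by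
        simp only [mul_assoc]
    _ = _ := by
      rw [h, mul_smul_comm, smul_mul_assoc, ← mul_assoc, symmetrizer_two_comm n]
      simp only [mul_assoc]

theorem symmetrizer_corner_of_weight {i j : Fin 6} {k : ℤ}
    (h : (typeWeight i - typeWeight j) * k = 36) (x : Mat3) :
    symmetrizer f i * f x * symmetrizer f j = 0 := by
  rw [mul_assoc]
  refine IsCubicMap.mul_eq_zero_of_weights h6 (symmetrizer_mul_scalar hf i)
    (m := typeWeight j) ?_ h
  have : f ((2 : ℤ) • 1) * f x = f x * f ((2 : ℤ) • 1) := by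
    rw [← map_mul, ← map_mul, mul_smul_comm, smul_mul_assoc, one_mul, mul_one]
  rw [← mul_assoc, this, mul_assoc, scalar_mul_symmetrizer hf, mul_smul_comm]

/-- Different degrees are separated by the weights 2, 4, 8 of the scalar 2. Within one degree, the
corner computation reduces to the group algebra of the symmetric group on two or three letters,
where the symmetrizers are orthogonal. -/
theorem symmetrizer_corner (i j : Fin 6) (x : Mat3) :
    symmetrizer f i * f x * symmetrizer f j =
      if i = j then cornerScalar x i • symmetrizer f i else 0 := by
  have hs := swap_mul_self (f := f)
  have ht := swap'_mul_self (f := f)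
  have hst := swap_braid (f := f)
  have hsq1 : symmetrizer f 1 = squareUnit f * (1 + (1 : ℤ) • f swapMat) := by
    rw [one_smul]; rfl
  have hsq2 : symmetrizer f 2 = squareUnit f * (1 + (-1 : ℤ) • f swapMat) := by
    rw [neg_one_smul, ← sub_eq_add_neg]; rfl
  -- The weight differences between degrees are ±2, ±4, ±6; k is the cofactor giving 36.
  fin_cases i <;> fin_cases j <;>
    first
    | exact symmetrizer_corner_of_weight hf h6 (k := 9) (by decide) x
    | exact symmetrizer_corner_of_weight hf h6 (k := 6) (by decide) x
    | exact symmetrizer_corner_of_weight hf h6 (k := 18) (by decide) x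
    | exact symmetrizer_corner_of_weight hf h6 (k := -9) (by decide) x
    | exact symmetrizer_corner_of_weight hf h6 (k := -6) (by decide) x
    | exact symmetrizer_corner_of_weight hf h6 (k := -18) (by decide) x
    | exact linPart_corner hf h6 x
    | skip
  · change symmetrizer f 1 * f x * symmetrizer f 1 =
      (12 * (x 0 0 * x 1 1 + x 0 1 * x 1 0)) • symmetrizer f 1
    rw [hsq1, square_corner hf h6, ← mul_smul_comm, ← mul_smul_comm]
    simp only [mul_add, add_mul, mul_one, one_mul, smul_mul_assoc, mul_smul_comm, hs]
    module
  · change symmetrizer f 1 * f x * symmetrizer f 2 = 0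
    rw [hsq1, hsq2, square_corner hf h6]
    simp only [mul_add, add_mul, mul_one, one_mul, smul_mul_assoc, mul_smul_comm, hs]
    module
  · change symmetrizer f 2 * f x * symmetrizer f 1 = 0
    rw [hsq1, hsq2, square_corner hf h6]
    simp only [mul_add, add_mul, mul_one, one_mul, smul_mul_assoc, mul_smul_comm, hs]
    module
  · change symmetrizer f 2 * f x * symmetrizer f 2 =
      (12 * (x 0 0 * x 1 1 - x 0 1 * x 1 0)) • symmetrizer f 2
    rw [hsq2, square_corner hf h6, ← mul_smul_comm, ← mul_smul_comm]
    simp only [mul_add, add_mul, mul_one, one_mul, smul_mul_assoc, mul_smul_comm, hs]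
    module
  all_goals
    simp only [Fin.reduceFinMk, symmetrizer_three_eq, symmetrizer_four_eq, symmetrizer_five_eq]
    simp only [symElt_eq, altElt_eq, hookElt_eq, cube_corner hf]
    simp only [← symElt_eq, ← altElt_eq, ← hookElt_eq]
  · rw [(young_corner_sym hs ht hst _).1, mul_smul_comm]; rfl
  · rw [(young_corner_sym hs ht hst _).2.1, mul_zero]; rfl
  · rw [(young_corner_sym hs ht hst _).2.2, mul_zero]; rfl
  · rw [(young_corner_alt hs ht hst _).1, mul_zero]; rfl
  · rw [(young_corner_alt hs ht hst _).2.1, mul_smul_comm]; rfl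
  · rw [(young_corner_alt hs ht hst _).2.2, mul_zero]; rfl
  · rw [(young_corner_hook hs ht hst _).1, mul_zero]; rfl
  · rw [(young_corner_hook hs ht hst _).2, mul_zero]; rfl
  · rw [hookElt_mul_braidComb_mul_hookElt hs ht hst, mul_smul_comm]; rfl

end

/-! ### The quasi-idempotents generate the unit up to 216. -/

section Generation

variable {B : Type*} [Ring B] (f : Mat3 →* B)

/-- The additive group spanned by the products through the six quasi-idempotents. -/
def symmetrizerIdeal : AddSubgroup B :=
  AddSubgroup.closure {b | ∃ (i : Fin 6) (x y : Mat3), b = f x * symmetrizer f i * f y}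

variable {f}

theorem mem_symmetrizerIdeal (i : Fin 6) (x y : Mat3) :
    f x * symmetrizer f i * f y ∈ symmetrizerIdeal f :=
  AddSubgroup.subset_closure ⟨i, x, y, rfl⟩

theorem mul_mul_mem_symmetrizerIdeal {b : B} (hb : b ∈ symmetrizerIdeal f) (x y : Mat3) :
    f x * b * f y ∈ symmetrizerIdeal f := by
  induction hb using AddSubgroup.closure_induction with
  | mem b hb =>
    obtain ⟨i, v, w, rfl⟩ := hb
    have := mem_symmetrizerIdeal (f := f) i (x * v) (w * y)
    simpa only [map_mul, mul_assoc] using this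
  | zero => simp
  | add a b _ _ ha hb => rw [mul_add, add_mul]; exact add_mem ha hb
  | neg a _ ha => rw [mul_neg, neg_mul]; exact neg_mem ha

/-- Permutation matrices commute with `cubeUnit`, so conjugates of the hook symmetrizer stay in the
ideal, and `sum_conj_hookElt` can be multiplied by `cubeUnit`. -/
theorem cubeUnit_mem : (18 : ℤ) • cubeUnit f ∈ symmetrizerIdeal f := by
  have hs := swap_mul_self (f := f)
  have ht := swap'_mul_self (f := f)
  have hst := swap_braid (f := f)
  have h1 : ∀ i, symmetrizer f i ∈ symmetrizerIdeal f := fun i => by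
    simpa using mem_symmetrizerIdeal (f := f) i 1 1
  have hc : ∀ a b : Mat3, f a * cubeUnit f = cubeUnit f * f a → f a * symmetrizer f 5 * f b =
      cubeUnit f * (f a * hookElt (f swapMat) (f swapMat') * f b) := by
    intro a b h
    rw [symmetrizer_five_eq, ← mul_assoc, h]
    simp only [mul_assoc]
  have c1 := cubeUnit_comm_swap (f := f)
  have c2 := cubeUnit_comm_swap' (f := f)
  have e := congrArg (cubeUnit f * ·) (sum_conj_hookElt hs ht hst)
  simp only [mul_smul_comm (18 : ℤ), mul_one] at e
  rw [← e]
  simp only [mul_add, mul_smul_comm, smul_add]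
  have key : ∀ a b : Mat3, f a * cubeUnit f = cubeUnit f * f a →
      cubeUnit f * (f a * hookElt (f swapMat) (f swapMat') * f b) ∈ symmetrizerIdeal f :=
    fun a b h => by rw [← hc a b h]; exact mem_symmetrizerIdeal 5 a b
  have k0 := key 1 1 (by rw [map_one, one_mul, mul_one])
  have k1 := key swapMat swapMat c1
  have k2 := key swapMat' swapMat' c2
  have k3 := key (swapMat * swapMat') (swapMat' * swapMat)
    (by rw [map_mul, mul_assoc, c2, ← mul_assoc, c1, mul_assoc])
  have k4 := key (swapMat' * swapMat) (swapMat * swapMat')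
    (by rw [map_mul, mul_assoc, c1, ← mul_assoc, c2, mul_assoc])
  have k5 := key (swapMat * swapMat' * swapMat) (swapMat * swapMat' * swapMat)
    (by rw [map_mul, map_mul, mul_assoc, c1, ← mul_assoc, mul_assoc (f swapMat), c2, ← mul_assoc,
      c1]; simp only [mul_assoc])
  simp only [map_mul, map_one, one_mul, mul_one] at k0 k1 k2 k3 k4 k5
  have h3 := h1 3
  have h4 := h1 4
  exact add_mem (add_mem (zsmul_mem h3 _) (zsmul_mem h4 _))
    (add_mem (add_mem (add_mem (add_mem (add_mem (zsmul_mem k0 _) (zsmul_mem k1 _))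
      (zsmul_mem k2 _)) (zsmul_mem k3 _)) (zsmul_mem k4 _)) (zsmul_mem k5 _))

theorem squareUnit_mem : (2 : ℤ) • squareUnit f ∈ symmetrizerIdeal f := by
  have h1 : ∀ i, symmetrizer f i ∈ symmetrizerIdeal f := fun i => by
    simpa using mem_symmetrizerIdeal (f := f) i 1 1
  have e : (2 : ℤ) • squareUnit f = symmetrizer f 1 + symmetrizer f 2 := by
    change _ = squareUnit f * (1 + f swapMat) + squareUnit f * (1 - f swapMat)
    rw [mul_add, mul_sub, mul_one, two_smul]; abel
  rw [e]
  exact add_mem (h1 1) (h1 2)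

theorem linPart_unitMat_mem (i : Fin 3) : linPart f (unitMat i i) ∈ symmetrizerIdeal f := by
  have h := mem_symmetrizerIdeal (f := f) 0 (unitMat i 0) (unitMat 0 i)
  change f (unitMat i 0) * linPart f (unitMat 0 0) * f (unitMat 0 i) ∈ _ at h
  rw [mul_linPart, linPart_mul] at h
  simpa [unitMat_mul] using h

theorem bilPart_unitMat_mem (i j : Fin 3) :
    (2 : ℤ) • bilPart f (unitMat i i) (unitMat j j) ∈ symmetrizerIdeal f := by
  have h := mul_mul_mem_symmetrizerIdeal (squareUnit_mem (f := f))
    (unitMat i 0 + unitMat j 1) (unitMat 0 i + unitMat 1 j)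
  rw [mul_smul_comm, smul_mul_assoc, squareUnit, mul_bilPart, bilPart_mul] at h
  simpa [unitMat_mul, mul_add, add_mul] using h

/-- Multiplication on the left by a matrix sending the indices 0, 1, 2 to i, j, k, and on the right
by its transpose, carries `cubeUnit` to this deviation. Coincidences among i, j, k are harmless. -/
theorem dev3_unitMat_mem (i j k : Fin 3) :
    (18 : ℤ) • dev3 f (unitMat i i) (unitMat j j) (unitMat k k) ∈ symmetrizerIdeal f := by
  have h := mul_mul_mem_symmetrizerIdeal (cubeUnit_mem (f := f))
    (unitMat i 0 + unitMat j 1 + unitMat k 2) (unitMat 0 i + unitMat 1 j + unitMat 2 k)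
  rw [mul_smul_comm, smul_mul_assoc, cubeUnit, mul_dev3, dev3_mul] at h
  simpa [unitMat_mul, mul_add, add_mul] using h

/-- The number `216` lies in the ideal spanned by the quasi-idempotents. -/
theorem smul_one_mem_symmetrizerIdeal (hf : IsCubicMap f) :
    (216 : ℤ) • (1 : B) ∈ symmetrizerIdeal f := by
  have hl : (18 : ℤ) • linPart f 1 ∈ symmetrizerIdeal f := by
    rw [one_eq_sum_unitMat, hf.linPart_add, hf.linPart_add]
    exact zsmul_mem (add_mem (add_mem (linPart_unitMat_mem _) (linPart_unitMat_mem _))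
      (linPart_unitMat_mem _)) _
  have hb : (2 : ℤ) • bilPart f 1 1 ∈ symmetrizerIdeal f := by
    rw [one_eq_sum_unitMat]
    simp only [hf.bilPart_add, hf.bilPart_add', smul_add]
    repeat' apply add_mem
    all_goals exact bilPart_unitMat_mem _ _
  have hd : (18 : ℤ) • dev3 f 1 1 1 ∈ symmetrizerIdeal f := by
    rw [one_eq_sum_unitMat]
    simp only [hf.dev3_add, hf.dev3_add', hf.dev3_add'', smul_add]
    repeat' apply add_mem
    all_goals exact dev3_unitMat_mem _ _ _
  have h := twelve_smul_eq f 1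
  rw [map_one] at h
  have e : (216 : ℤ) • (1 : B) = (2 : ℤ) • ((18 : ℤ) • dev3 f 1 1 1) +
      (9 : ℤ) • ((2 : ℤ) • bilPart f 1 1) + (18 : ℤ) • linPart f 1 := by
    -- The factor 12 comes from the decomposition into homogeneous parts, the factor 18 from the
    -- hook symmetrizer. Their product 6³ is a unit wherever 6 is.
    rw [show (216 : ℤ) = 18 * 12 by norm_num, mul_smul, h]
    module
  rw [e]
  exact add_mem (add_mem (zsmul_mem hd _) (zsmul_mem hb _)) hl

end Generation

/-! ### Subrings of the rational numbers -/

section SubringRat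

variable {A : Subring ℚ}

theorem inv_den_mem {q : ℚ} (hq : q ∈ A) : (q.den : ℚ)⁻¹ ∈ A := by
  have hc : IsCoprime q.num (q.den : ℤ) := by
    rw [Int.isCoprime_iff_gcd_eq_one]
    simpa [Int.gcd] using q.reduced
  obtain ⟨a, b, hab⟩ := hc
  have hd : (q.den : ℚ) ≠ 0 := by exact_mod_cast q.den_nz
  have h : (q.den : ℚ)⁻¹ = a * q + b := by
    have hn : q * q.den = q.num := Rat.mul_den_eq_num q
    have h' : (a : ℚ) * q.num + b * q.den = 1 := by exact_mod_cast hab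
    rw [← hn] at h'
    field_simp
    linear_combination -h'
  rw [h]
  exact A.add_mem (A.mul_mem (intCast_mem A a) hq) (intCast_mem A b)

theorem isUnit_den (q : A) : IsUnit ((q.1.den : ℕ) : A) := by
  refine IsUnit.of_mul_eq_one ⟨_, inv_den_mem q.2⟩ ?_
  ext
  have hd : (q.1.den : ℚ) ≠ 0 := by exact_mod_cast q.1.den_nz
  simp [hd]

theorem den_mul_eq (q : A) : ((q.1.den : ℕ) : A) * q = ((q.1.num : ℤ) : A) := by
  ext
  simp [Rat.den_mul_eq_num]

/-- The reduced denominator of an element of A is a unit of A, so an ideal is generated by the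
integers it contains. -/
instance : IsPrincipalIdealRing A where
  principal I := by
    obtain ⟨n, hn⟩ := (inferInstance : (I.comap (Int.castRingHom A)).IsPrincipal).principal
    refine ⟨⟨(n : A), ?_⟩⟩
    apply le_antisymm
    · intro q hq
      have h1 : q.1.num ∈ I.comap (Int.castRingHom A) := by
        rw [Ideal.mem_comap, eq_intCast, ← den_mul_eq]
        exact I.mul_mem_left _ hq
      rw [hn, Submodule.mem_span_singleton] at h1
      obtain ⟨m, hm⟩ := h1
      obtain ⟨v, hv⟩ := isUnit_den q
      rw [Submodule.mem_span_singleton]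
      refine ⟨(↑v⁻¹ : A) * (m : A), ?_⟩
      have h2 := den_mul_eq q
      rw [← hv, ← hm] at h2
      rw [smul_eq_mul, mul_assoc]
      have h3 : ((m : A)) * (n : A) = v * q := by rw [h2]; simp
      rw [h3, ← mul_assoc, Units.inv_mul, one_mul]
    · rw [Submodule.span_le, Set.singleton_subset_iff]
      have : n ∈ I.comap (Int.castRingHom A) := by
        rw [hn]; exact Submodule.mem_span_singleton_self n
      simpa using this

variable {V W : Type*} [AddCommGroup V] [Module A V] [AddCommGroup W] [Module A W]

/-- Denominators act invertibly, so linearity over A follows from additivity. Hence actions of A and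
of the matrices commute automatically, and no compatibility has to be assumed below. -/
theorem map_subring_smul (g : V →+ W) (a : A) (v : V) : g (a • v) = a • g v := by
  obtain ⟨c, hc⟩ := isUnit_den a
  have h : (c : A) • g (a • v) = (c : A) • (a • g v) := by
    rw [smul_smul, hc, den_mul_eq, Nat.cast_smul_eq_nsmul, Int.cast_smul_eq_zsmul, ← map_nsmul,
      ← map_zsmul, ← Nat.cast_smul_eq_nsmul A, smul_smul, den_mul_eq, Int.cast_smul_eq_zsmul]
  have h' := congrArg ((↑c⁻¹ : A) • ·) h
  simpa only [smul_smul, Units.inv_mul, one_smul, ← mul_assoc, one_mul] using h'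

/-- An additive map between modules over a subring of `ℚ` is linear. -/
noncomputable def linearOfSubring (A : Subring ℚ) {V W : Type*} [AddCommGroup V] [Module A V] [AddCommGroup W]
    [Module A W] (g : V →+ W) : V →ₗ[A] W where
  __ := g
  map_smul' := map_subring_smul g

end SubringRat

/-! ### Modules over the ring of the monoid of integral matrices -/

/-- The integral monoid ring of the monoid of matrices. -/
abbrev MatRing : Type := MonoidAlgebra ℤ Mat3

/-- The basis element of a matrix. -/
noncomputable abbrev mat : Mat3 →* MatRing := MonoidAlgebra.of ℤ Mat3

section MatModule

variable {W W' : Type*} [AddCommGroup W] [Module MatRing W] [AddCommGroup W'] [Module MatRing W']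

/-- An additive map compatible with the action of the matrices is linear. -/
noncomputable def linearOfMat (g : W →+ W') (h : ∀ x w, g (mat x • w) = mat x • g w) : W →ₗ[MatRing] W' where
  __ := g
  map_smul' t w := by
    change g (t • w) = t • g w
    induction t using MonoidAlgebra.induction_on with
    | of x => exact h x w
    | add s t hs ht => rw [add_smul, map_add, hs, ht, add_smul]
    | smul r t ht => rw [smul_assoc, map_zsmul, ht, smul_assoc]

variable (W) in
/-- The action of the matrices. -/
noncomputable def matAct : Mat3 →* Module.End ℤ W :=
  (Module.toModuleEnd ℤ (S := MatRing) W : MatRing →* Module.End ℤ W).comp mat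

@[simp]
theorem matAct_apply (x : Mat3) (w : W) : matAct W x w = mat x • w := rfl

variable (W) in
/-- A module over the ring of the monoid of matrices on which this monoid acts by a cubic map. -/
def IsCubicModule : Prop := IsCubicMap (matAct W)

theorem map_symmetrizer {B B' : Type*} [Ring B] [Ring B'] (f : Mat3 →* B) (g : B →+* B')
    (i : Fin 6) : g (symmetrizer f i) = symmetrizer ((g : B →* B').comp f) i := by
  have h3 : ∀ a b c, g (dev3 f a b c) = dev3 ((g : B →* B').comp f) a b c := fun a b c => by
    simp [dev3]
  have hq : ∀ a, g (quadPart f a) = quadPart ((g : B →* B').comp f) a := fun a => by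
    rw [quadPart, quadPart, map_sub, map_zsmul, h3]; rfl
  have hb : ∀ a b, g (bilPart f a b) = bilPart ((g : B →* B').comp f) a b := fun a b => by
    simp [bilPart, dev2, hq]
  have hl : ∀ a, g (linPart f a) = linPart ((g : B →* B').comp f) a := fun a => by
    rw [linPart, linPart, map_sub, map_zsmul, hq, hb]
  fin_cases i <;>
    simp [symmetrizer, squareUnit, cubeUnit, h3, hl, hb, symElt, altElt, hookElt]

/-- The quasi-idempotents in the monoid ring. -/
noncomputable def typeElt (i : Fin 6) : MatRing := symmetrizer mat i

theorem symmetrizer_matAct (i : Fin 6) (w : W) : symmetrizer (matAct W) i w = typeElt i • w := by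
  have h := map_symmetrizer mat (Module.toModuleEnd ℤ (S := MatRing) W) i
  exact (DFunLike.congr_fun h w).symm

theorem corner_smul (hW : IsCubicModule W) (h6 : ∀ w : W, (6 : ℤ) • w = 0 → w = 0) (i j : Fin 6)
    (x : Mat3) (w : W) : typeElt i • mat x • typeElt j • w =
      if i = j then cornerScalar x i • typeElt i • w else 0 := by
  have h := symmetrizer_corner (f := matAct W) hW (fun b hb => by
    ext w
    exact h6 _ (DFunLike.congr_fun hb w)) i j x
  have h' := DFunLike.congr_fun h w
  rw [Module.End.mul_apply, Module.End.mul_apply] at h'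
  simp only [symmetrizer_matAct, matAct_apply] at h'
  rw [h']
  split_ifs
  · rw [← symmetrizer_matAct]; rfl
  · rfl

/-- The elements tested span a subgroup containing 216 W, and 216 = 6³ can be cancelled in the
target. -/
theorem addMonoidHom_ext_of_type (hW : IsCubicModule W) {V : Type*} [AddCommGroup V]
    (h6 : ∀ w : V, (6 : ℤ) • w = 0 → w = 0) {g h : W →+ V}
    (H : ∀ x i w, g (mat x • typeElt i • w) = h (mat x • typeElt i • w)) : g = h := by
  have key : ∀ t ∈ symmetrizerIdeal (matAct W), ∀ w, g (t w) = h (t w) := by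
    intro t ht
    induction ht using AddSubgroup.closure_induction with
    | mem b hb =>
      obtain ⟨i, x, y, rfl⟩ := hb
      intro w
      have := H x i (mat y • w)
      rw [← symmetrizer_matAct] at this
      exact this
    | zero => intro w; simp
    | add a b _ _ ha hb =>
      intro w
      rw [LinearMap.add_apply, map_add, map_add, ha, hb]
    | neg a _ ha =>
      intro w
      rw [LinearMap.neg_apply, map_neg, map_neg, ha]
  ext w
  have h1 := key _ (smul_one_mem_symmetrizerIdeal (f := matAct W) hW) w
  rw [LinearMap.smul_apply, Module.End.one_apply, map_zsmul, map_zsmul] at h1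
  have h2 : (6 : ℤ) • (6 : ℤ) • (6 : ℤ) • (g w - h w) = 0 := by
    rw [smul_smul, smul_smul, smul_sub]
    norm_num [h1]
  exact sub_eq_zero.1 (h6 _ (h6 _ (h6 _ h2)))

variable (A : Subring ℚ) [Module A W] [Module A W']

/-- Multiplication by an element of the monoid ring, as a linear map. -/
noncomputable def smulLinear (W : Type*) [AddCommGroup W] [Module MatRing W] [Module A W] (t : MatRing) :
    W →ₗ[A] W :=
  linearOfSubring A (Module.toModuleEnd ℤ (S := MatRing) W t).toAddMonoidHom

/-- The image of a quasi-idempotent. -/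
noncomputable def typePart (W : Type*) [AddCommGroup W] [Module MatRing W] [Module A W] (i : Fin 6) :
    Submodule A W :=
  LinearMap.range (smulLinear A W (typeElt i))

theorem typeElt_smul_mem (i : Fin 6) (w : W) : typeElt i • w ∈ typePart A W i := ⟨w, rfl⟩

variable {A}

omit [Module MatRing W] in
theorem six_torsion_free (hA : IsUnit (6 : A)) (w : W) (h : (6 : ℤ) • w = 0) : w = 0 := by
  rw [← Int.cast_smul_eq_zsmul A, Int.cast_ofNat] at h
  exact hA.smul_eq_zero.1 h

/-- Together with `matLinear_ext_of_typePart` this says that a module is freely determined by its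
six type parts. The extension is given by a formula, which avoids a verification of well-definedness
on generators. -/
theorem exists_extension_of_typePart (hA : IsUnit (6 : A)) (hW : IsCubicModule W)
    (hW' : IsCubicModule W') (φ : ∀ i, typePart A W i →ₗ[A] typePart A W' i) :
    ∃ Φ : W →ₗ[MatRing] W', ∀ i (w : typePart A W i), Φ w = φ i w := by
  have h6 : ∀ w : W, (6 : ℤ) • w = 0 → w = 0 := six_torsion_free hA
  have h6' : ∀ w : W', (6 : ℤ) • w = 0 → w = 0 := six_torsion_free hA
  let e : ∀ i, W →ₗ[A] typePart A W i := fun i => (smulLinear A W (typeElt i)).rangeRestrict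
  have he : ∀ i w, (e i w : W) = typeElt i • w := fun i w => rfl
  -- This is the desired extension followed by t. For t = v e_j u it is w ↦ v φ_j(e_j u w); the
  -- scalars of the corners agree in W and W', so φ_j may be moved past them. The case t = 216 is
  -- then divided by 6³.
  have key : ∀ t ∈ symmetrizerIdeal (matAct W'), ∃ ψ : W →+ W', ∀ x i w,
      ψ (mat x • typeElt i • w) = t (mat x • (φ i (e i w) : W')) := by
    intro t ht
    induction ht using AddSubgroup.closure_induction with
    | mem b hb =>
      obtain ⟨j, v, u, rfl⟩ := hb
      refine ⟨(matAct W' v).toAddMonoidHom.comp ((typePart A W' j).subtype.toAddMonoidHom.comp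
        ((φ j).toAddMonoidHom.comp ((e j).toAddMonoidHom.comp (matAct W u).toAddMonoidHom))), fun x i w => ?_⟩
      change mat v • (φ j (e j (mat u • mat x • typeElt i • w)) : W') =
        mat v • symmetrizer (matAct W') j (mat u • mat x • (φ i (e i w) : W'))
      rw [symmetrizer_matAct]
      congr 1
      obtain ⟨w', hw'⟩ := (φ i (e i w)).2
      change typeElt i • w' = _ at hw'
      rw [← hw', smul_smul (mat u), smul_smul (mat u), ← map_mul, corner_smul hW' h6']
      have h1 : e j (mat (u * x) • typeElt i • w) =
          if j = i then cornerScalar (u * x) j • e j w else 0 := by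
        ext
        rw [he, corner_smul hW h6]
        split_ifs <;> simp [he]
      rw [h1]
      split_ifs with hij
      · subst hij
        rw [map_zsmul, hw']
        simp
      · simp
    | zero => exact ⟨0, fun x i w => by simp⟩
    | add a b _ _ ha hb =>
      obtain ⟨ψ, h⟩ := ha
      obtain ⟨ψ', h'⟩ := hb
      exact ⟨ψ + ψ', fun x i w => by rw [AddMonoidHom.add_apply, h, h']; rfl⟩
    | neg a _ ha =>
      obtain ⟨ψ, h⟩ := ha
      exact ⟨-ψ, fun x i w => by rw [AddMonoidHom.neg_apply, h]; rfl⟩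
  obtain ⟨ψ, hψ⟩ := key _ (smul_one_mem_symmetrizerIdeal (f := matAct W') hW')
  obtain ⟨c, hc⟩ := hA
  let Φ : W →+ W' := (DistribSMul.toAddMonoidHom W' ((↑c⁻¹ : A) ^ 3)).comp ψ
  have hΦ : ∀ x i w, Φ (mat x • typeElt i • w) = mat x • (φ i (e i w) : W') := by
    intro x i w
    change (↑c⁻¹ : A) ^ 3 • ψ _ = _
    rw [hψ, LinearMap.smul_apply, Module.End.one_apply, ← Int.cast_smul_eq_zsmul A,
      show ((216 : ℤ) : A) = (c : A) ^ 3 by rw [hc]; norm_num, smul_smul, ← mul_pow,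
      Units.inv_mul, one_pow, one_smul]
  refine ⟨linearOfMat Φ fun y w => ?_, fun i w => ?_⟩
  · have := addMonoidHom_ext_of_type hW (g := Φ.comp (matAct W y).toAddMonoidHom)
      (h := (matAct W' y).toAddMonoidHom.comp Φ) h6'
      (fun x i w => by
        change Φ (mat y • mat x • typeElt i • w) = mat y • Φ (mat x • typeElt i • w)
        rw [smul_smul, ← map_mul, hΦ, hΦ, smul_smul, ← map_mul])
    exact DFunLike.congr_fun this w
  · obtain ⟨_, w', rfl⟩ := w
    have := hΦ 1 i w'
    rw [map_one, one_smul, one_smul] at this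
    exact this

theorem matLinear_ext_of_typePart (hA : IsUnit (6 : A)) (hW : IsCubicModule W)
    {Φ Ψ : W →ₗ[MatRing] W'} (h : ∀ i, ∀ w ∈ typePart A W i, Φ w = Ψ w) : Φ = Ψ := by
  have := addMonoidHom_ext_of_type hW (six_torsion_free (A := A) (W := W') hA)
    (g := Φ.toAddMonoidHom) (h := Ψ.toAddMonoidHom) (fun x i w => by
      change Φ _ = Ψ _
      rw [map_smul Φ, map_smul Ψ, h i _ (typeElt_smul_mem A i w)])
  ext w
  exact DFunLike.congr_fun this w

theorem map_mem_typePart (Φ : W →ₗ[MatRing] W') (i : Fin 6) {w : W} (hw : w ∈ typePart A W i) :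
    Φ w ∈ typePart A W' i := by
  obtain ⟨v, rfl⟩ := hw
  exact ⟨Φ v, (map_smul Φ (typeElt i) v).symm⟩

end MatModule

/-! ### Finitely generated modules over a subring of the rational numbers -/

section Torsion

theorem torsion_free_of_int {A : Subring ℚ} {W : Type*} [AddCommGroup W] [Module A W]
    (h : ∀ (n : ℤ) (w : W), n ≠ 0 → n • w = 0 → w = 0) : Module.IsTorsionFree A W := by
  refine Module.IsTorsionFree.of_smul_eq_zero fun a w haw => ?_
  by_contra! hc
  refine hc.2 (h a.1.num w ?_ ?_)
  · rw [Ne, Rat.num_eq_zero]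
    exact fun h0 => hc.1 (Subtype.ext h0)
  · rw [← Int.cast_smul_eq_zsmul A, ← den_mul_eq, mul_smul, haw, smul_zero]

theorem mem_torsion_iff_int {A : Subring ℚ} {W : Type*} [AddCommGroup W] [Module A W] {w : W} :
    w ∈ Submodule.torsion A W ↔ ∃ n : ℤ, n ≠ 0 ∧ n • w = 0 := by
  constructor
  · rintro ⟨a, ha⟩
    have ha' : (a : A) • w = 0 := ha
    refine ⟨a.1.1.num, ?_, ?_⟩
    · rw [Ne, Rat.num_eq_zero]
      exact fun h0 => nonZeroDivisors.ne_zero a.2 (Subtype.ext h0)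
    · rw [← Int.cast_smul_eq_zsmul A, ← den_mul_eq, mul_smul, ha', smul_zero]
  · rintro ⟨n, hn, h⟩
    refine ⟨⟨(n : A), mem_nonZeroDivisors_of_ne_zero (Int.cast_ne_zero.2 hn)⟩, ?_⟩
    change ((n : A)) • w = 0
    rw [Int.cast_smul_eq_zsmul, h]

theorem exists_torsion_retraction {R X : Type*} [CommRing R] [IsDomain R] [IsPrincipalIdealRing R]
    [AddCommGroup X] [Module R X] [Module.Finite R X] :
    ∃ r : X →ₗ[R] X, (∀ x, r x ∈ Submodule.torsion R X) ∧ ∀ x ∈ Submodule.torsion R X, r x = x := by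
  have : Module.IsTorsionFree R (X ⧸ Submodule.torsion R X) := inferInstance
  have : Module.Free R (X ⧸ Submodule.torsion R X) := Module.free_of_finite_type_torsion_free'
  obtain ⟨σ, hσ⟩ := Module.projective_lifting_property (Submodule.torsion R X).mkQ LinearMap.id
    (Submodule.mkQ_surjective _)
  refine ⟨LinearMap.id - σ.comp (Submodule.torsion R X).mkQ, fun x => ?_, fun x hx => ?_⟩
  · rw [← Submodule.Quotient.mk_eq_zero, ← Submodule.mkQ_apply]
    have := LinearMap.congr_fun hσ ((Submodule.torsion R X).mkQ x)
    simp only [LinearMap.comp_apply, LinearMap.id_apply] at this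
    rw [LinearMap.sub_apply, map_sub, LinearMap.comp_apply, this, LinearMap.id_apply, sub_self]
  · have : (Submodule.torsion R X).mkQ x = 0 := by simpa using hx
    simp [this]

/-- Elements which are multiplied into a submodule by elements of a multiplicative set of integers
are so by a common one. -/
theorem exists_common_smul_mem {R X : Type*} [CommRing R] [AddCommGroup X] [Module R X]
    [Module.Finite R X] (Q : Submodule R X) (S : Submonoid ℤ) (h : ∀ x, ∃ s ∈ S, s • x ∈ Q) :
    ∃ s ∈ S, ∀ x, s • x ∈ Q := by
  obtain ⟨F, hF⟩ := (inferInstance : Module.Finite R X).fg_top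
  have key : ∀ F : Finset X, ∃ s ∈ S, ∀ x ∈ F, s • x ∈ Q := by
    classical
    intro F
    induction F using Finset.induction_on with
    | empty => exact ⟨1, S.one_mem, by simp⟩
    | insert a F _ ih =>
      obtain ⟨s, hs, h1⟩ := ih
      obtain ⟨t, ht, h2⟩ := h a
      refine ⟨s * t, S.mul_mem hs ht, fun x hx => ?_⟩
      rcases Finset.mem_insert.1 hx with rfl | hx
      · rw [mul_smul]; exact zsmul_mem h2 s
      · rw [mul_comm, mul_smul]; exact zsmul_mem (h1 x hx) t
  obtain ⟨s, hs, h1⟩ := key F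
  refine ⟨s, hs, fun x => ?_⟩
  have hx : x ∈ Submodule.span R (F : Set X) := by rw [hF]; trivial
  induction hx using Submodule.span_induction with
  | mem x hx => exact h1 x hx
  | zero => simp
  | add x y _ _ hx hy => rw [smul_add]; exact add_mem hx hy
  | smul a x _ hx => rw [smul_comm]; exact Q.smul_mem a hx

end Torsion

/-! ### Splitting of torsion and comparison of lattices when 6 is invertible. -/

section Splitting

variable {A : Subring ℚ} {W W' : Type*} [AddCommGroup W] [Module MatRing W] [Module A W]
  [AddCommGroup W'] [Module MatRing W'] [Module A W']

/-- Torsion splits off each type part, a finitely generated module over a principal ideal domain.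
The six retractions extend to the whole module. -/
theorem exists_torsion_matRetraction (hA : IsUnit (6 : A)) (hW : IsCubicModule W)
    [Module.Finite A W] :
    ∃ r : W →ₗ[MatRing] W, (∀ w, r w ∈ Submodule.torsion A W) ∧
      ∀ w ∈ Submodule.torsion A W, r w = w := by
  choose r hr hr' using fun i => exists_torsion_retraction (R := A) (X := typePart A W i)
  obtain ⟨Φ, hΦ⟩ := exists_extension_of_typePart hA hW hW r
  have hmat : ∀ x : Mat3, ∀ w ∈ Submodule.torsion A W, mat x • w ∈ Submodule.torsion A W := by
    intro x w hw
    exact map_mem_torsion (smulLinear A W (mat x)) w hw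
  refine ⟨Φ, fun w => ?_, fun w hw => ?_⟩
  · rw [← Submodule.ker_mkQ (Submodule.torsion A W), LinearMap.mem_ker]
    have := addMonoidHom_ext_of_type hW
      (g := (Submodule.torsion A W).mkQ.toAddMonoidHom.comp Φ.toAddMonoidHom) (h := 0)
      (six_torsion_free (A := A) hA) (fun x i w => by
        change (Submodule.torsion A W).mkQ (Φ (mat x • typeElt i • w)) = 0
        rw [map_smul Φ]
        have h1 := hΦ i ⟨_, typeElt_smul_mem A i w⟩
        simp only at h1
        rw [h1, Submodule.mkQ_apply, Submodule.Quotient.mk_eq_zero]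
        exact hmat _ _ (map_mem_torsion (typePart A W i).subtype _ (hr i _)))
    exact DFunLike.congr_fun this w
  · have key : ∀ t ∈ symmetrizerIdeal (matAct W), Φ (t w) = t w := by
      intro t ht
      induction ht using AddSubgroup.closure_induction with
      | mem b hb =>
        obtain ⟨i, x, y, rfl⟩ := hb
        change Φ (mat x • symmetrizer (matAct W) i (mat y • w)) =
          mat x • symmetrizer (matAct W) i (mat y • w)
        rw [symmetrizer_matAct, map_smul Φ]
        have h1 := hΦ i ⟨_, typeElt_smul_mem A i (mat y • w)⟩
        rw [hr' i] at h1
        · rw [h1]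
        · obtain ⟨n, hn, h⟩ := mem_torsion_iff_int.1 hw
          refine mem_torsion_iff_int.2 ⟨n, hn, Subtype.ext ?_⟩
          change n • typeElt i • mat y • w = 0
          rw [smul_comm n, smul_comm n, h, smul_zero, smul_zero]
      | zero => simp
      | add a b _ _ ha hb => rw [LinearMap.add_apply, map_add, ha, hb]
      | neg a _ ha => rw [LinearMap.neg_apply, map_neg, ha]
    have h1 := key _ (smul_one_mem_symmetrizerIdeal (f := matAct W) hW)
    rw [LinearMap.smul_apply, Module.End.one_apply, map_zsmul] at h1
    have h2 : (6 : ℤ) • (6 : ℤ) • (6 : ℤ) • (Φ w - w) = 0 := by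
      rw [smul_smul, smul_smul, smul_sub]
      norm_num [h1]
    have h6 := fun w : W => six_torsion_free (A := A) hA w
    exact sub_eq_zero.1 (h6 _ (h6 _ (h6 _ h2)))

theorem typePart_torsionFree (hW : ∀ (n : ℤ) (w : W), n ≠ 0 → n • w = 0 → w = 0) (i : Fin 6) :
    Module.IsTorsionFree A (typePart A W i) :=
  torsion_free_of_int fun n w hn h => Subtype.ext (hW n w hn (congrArg Subtype.val h))

/-- The restriction of a linear map to the images of a quasi-idempotent. -/
noncomputable def typeMap (A : Subring ℚ) {W W' : Type*} [AddCommGroup W] [Module MatRing W]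
    [Module A W] [AddCommGroup W'] [Module MatRing W'] [Module A W'] (Φ : W →ₗ[MatRing] W')
    (i : Fin 6) : typePart A W i →ₗ[A] typePart A W' i :=
  (linearOfSubring A Φ.toAddMonoidHom).restrict fun _ hw => map_mem_typePart Φ i hw

@[simp]
theorem typeMap_coe (Φ : W →ₗ[MatRing] W') (i : Fin 6) (w : typePart A W i) :
    (typeMap A Φ i w : W') = Φ w := rfl

theorem typeMap_injective {Φ : W →ₗ[MatRing] W'} (h : Function.Injective Φ) (i : Fin 6) :
    Function.Injective (typeMap A Φ i) := fun _ _ hab =>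
  Subtype.ext (h (congrArg Subtype.val hab))

/-- Injections both ways force the six type parts, free of finite rank, to have equal ranks; any
choice of isomorphisms between them extends. -/
theorem nonempty_equiv_of_injective (hA : IsUnit (6 : A)) (hW : IsCubicModule W)
    (hW' : IsCubicModule W') [Module.Finite A W] [Module.Finite A W']
    (tW : ∀ (n : ℤ) (w : W), n ≠ 0 → n • w = 0 → w = 0)
    (tW' : ∀ (n : ℤ) (w : W'), n ≠ 0 → n • w = 0 → w = 0)
    (Φ : W →ₗ[MatRing] W') (Ψ : W' →ₗ[MatRing] W) (hΦ : Function.Injective Φ)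
    (hΨ : Function.Injective Ψ) : Nonempty (W ≃ₗ[MatRing] W') := by
  have e : ∀ i, Nonempty (typePart A W i ≃ₗ[A] typePart A W' i) := fun i => by
    have := typePart_torsionFree (A := A) tW i
    have := typePart_torsionFree (A := A) tW' i
    have : Module.Free A (typePart A W i) := Module.free_of_finite_type_torsion_free'
    have : Module.Free A (typePart A W' i) := Module.free_of_finite_type_torsion_free'
    refine FiniteDimensional.nonempty_linearEquiv_of_finrank_eq (le_antisymm ?_ ?_)
    · exact LinearMap.finrank_le_finrank_of_injective (typeMap_injective (A := A) hΦ i)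
    · exact LinearMap.finrank_le_finrank_of_injective (typeMap_injective (A := A) hΨ i)
  have e := fun i => (e i).some
  obtain ⟨F, hF⟩ := exists_extension_of_typePart hA hW hW' fun i => (e i).toLinearMap
  obtain ⟨G, hG⟩ := exists_extension_of_typePart hA hW' hW fun i => (e i).symm.toLinearMap
  refine ⟨LinearEquiv.ofLinearMap F G (matLinear_ext_of_typePart hA hW' fun i w hw => ?_)
    (matLinear_ext_of_typePart hA hW fun i w hw => ?_)⟩
  · have h1 := hG i ⟨w, hw⟩
    simp only [LinearMap.comp_apply, LinearMap.id_apply]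
    rw [h1, hF]
    simp
  · have h1 := hF i ⟨w, hw⟩
    simp only [LinearMap.comp_apply, LinearMap.id_apply]
    rw [h1, hG]
    simp

end Splitting

/-! ### Lifting maps from a localization -/

section Lifting

/-- The conditions on a map to be a localization at a multiplicative set of integers, apart from
the divisibility of the target. -/
structure IsLocMap {N W : Type*} [AddCommGroup N] [AddCommGroup W] (S : Submonoid ℤ)
    (l : N → W) : Prop where
  surj : ∀ w, ∃ s ∈ S, ∃ y, s • w = l y
  ker : ∀ y, l y = 0 → ∃ s ∈ S, s • y = 0

variable {A : Subring ℚ} {M N W : Type*} [AddCommGroup M] [Module MatRing M] [Module A M]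
  [AddCommGroup N] [Module MatRing N] [Module A N] [AddCommGroup W] [Module MatRing W]
  [Module A W]

/-- By finite generation one s₁ moves ψ into the image of l, and one s₀ kills the kernel of l.
Preimages chosen pointwise are linear up to that kernel, so s₀ times the choice is linear. -/
theorem IsLocMap.exists_lift {S : Submonoid ℤ} [Module.Finite A M] [Module.Finite A N]
    {l : N →ₗ[MatRing] W} (hl : IsLocMap S l) (ψ : M →ₗ[MatRing] W) :
    ∃ s ∈ S, ∃ φ : M →ₗ[MatRing] N, ∀ x, l (φ x) = s • ψ x := by
  let lA := linearOfSubring A l.toAddMonoidHom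
  let ψA := linearOfSubring A ψ.toAddMonoidHom
  have : IsNoetherian A N := inferInstance
  obtain ⟨s₀, hs₀, h₀⟩ := exists_common_smul_mem (X := LinearMap.ker lA) (⊥ : Submodule A _) S
    (fun x => by
      obtain ⟨s, hs, h⟩ := hl.ker x.1 x.2
      exact ⟨s, hs, by rw [Submodule.mem_bot]; exact Subtype.ext h⟩)
  obtain ⟨s₁, hs₁, h₁⟩ := exists_common_smul_mem ((LinearMap.range lA).comap ψA) S
    (fun x => by
      obtain ⟨s, hs, y, h⟩ := hl.surj (ψ x)
      refine ⟨s, hs, y, ?_⟩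
      rw [map_zsmul]
      exact h.symm)
  choose g hg using h₁
  have hg' : ∀ x, l (g x) = s₁ • ψ x := fun x => by
    have := hg x
    rw [map_zsmul] at this
    exact this
  have h₀' : ∀ y, l y = 0 → s₀ • y = 0 := fun y hy => by
    have := h₀ ⟨y, hy⟩
    rw [Submodule.mem_bot] at this
    exact congrArg Subtype.val this
  refine ⟨s₀ * s₁, S.mul_mem hs₀ hs₁,
    { toFun := fun x => s₀ • g x, map_add' := fun x y => ?_, map_smul' := fun t x => ?_ },
    fun x => ?_⟩
  · rw [← smul_add, ← sub_eq_zero, ← smul_sub]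
    refine h₀' _ ?_
    rw [map_sub, map_add, hg', hg', hg', map_add, smul_add, sub_self]
  · rw [RingHom.id_apply, smul_comm t, ← sub_eq_zero, ← smul_sub]
    refine h₀' _ ?_
    rw [map_sub, map_smul, hg', hg', map_smul, smul_comm t, sub_self]
  · change l (s₀ • g x) = _
    rw [map_zsmul, hg', smul_smul]

end Lifting

/-! ### Extension of scalars as a localization -/

section Extension

open TensorProduct

theorem isLocMap_tensor {R R' : Type} [CommRing R] [IsDomain R] [CharZero R] [CommRing R']
    [Algebra R R'] (hinj : Function.Injective (algebraMap R R')) {S : Submonoid ℤ}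
    (hu : ∀ s ∈ S, IsUnit (s : R')) (hs : ∀ q : R', ∃ s ∈ S, ∃ r : R, (s : R') * q = algebraMap R R' r)
    (M : Type u) [AddCommGroup M] [Module R M] :
    IsLocMap S (fun m : M => (1 : R') ⊗ₜ[R] m) := by
  have hloc : IsLocalization (S.map (Int.castRingHom R)) R' :=
    { map_units := by
        rintro ⟨_, s, hsS, rfl⟩
        simpa using hu s hsS
      surj := by
        intro q
        obtain ⟨s, hsS, r, h⟩ := hs q
        refine ⟨(r, ⟨_, s, hsS, rfl⟩), ?_⟩
        rw [← h, mul_comm]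
        simp
      exists_of_eq := by
        intro x y h
        exact ⟨1, by rw [hinj h]⟩ }
  have hm : IsLocalizedModule (S.map (Int.castRingHom R)) (TensorProduct.mk R R' M 1) :=
    (isLocalizedModule_iff_isBaseChange _ R' _).2 (TensorProduct.isBaseChange R M R')
  constructor
  · intro w
    obtain ⟨⟨y, ⟨_, s, hsS, rfl⟩⟩, h⟩ := hm.surj w
    refine ⟨s, hsS, y, ?_⟩
    rw [← Int.cast_smul_eq_zsmul R]
    exact h
  · intro y hy
    obtain ⟨⟨_, s, hsS, rfl⟩, h⟩ := hm.exists_of_eq (x₁ := y) (x₂ := 0) (by simpa using hy)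
    refine ⟨s, hsS, ?_⟩
    rw [← Int.cast_smul_eq_zsmul R]
    simpa using h

open ModuleCat ChangeOfRings

variable {R R' : Type} [CommRing R] [CommRing R'] (f : R →+* R')

/-- The canonical map to the extension of scalars. -/
noncomputable def toExtension (M : ModuleCat.{u} R) : M →+ (extendScalars f).obj M where
  toFun m := (1 : R') ⊗ₜ[R, f] m
  map_zero' := by
    let := Module.compHom R' f
    exact TensorProduct.tmul_zero M (1 : R')
  map_add' x y := by
    let := Module.compHom R' f
    exact TensorProduct.tmul_add (1 : R') x y

variable {f}

theorem extendScalars_map_toExtension {M N : ModuleCat.{u} R} (g : M ⟶ N) (m : M) :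
    ((extendScalars f).map g).hom (toExtension f M m) = toExtension f N (g.hom m) := rfl

theorem isLocMap_toExtension [IsDomain R] [CharZero R] (hinj : Function.Injective f)
    {S : Submonoid ℤ} (hu : ∀ s ∈ S, IsUnit (s : R'))
    (hs : ∀ q : R', ∃ s ∈ S, ∃ r : R, (s : R') * q = f r) (M : ModuleCat.{u} R) :
    IsLocMap S (toExtension f M) := by
  let := f.toAlgebra
  exact isLocMap_tensor (R' := R') hinj hu hs M

theorem exists_extension_map {M : ModuleCat.{u} R} {W : Type u} [AddCommGroup W] [Module R' W]
    (g : M →+ W) (hg : ∀ (r : R) (m : M), g (r • m) = f r • g m) :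
    ∃ G : (extendScalars f).obj M →ₗ[R'] W, ∀ m, G (toExtension f M m) = g m := by
  let g' : M ⟶ (restrictScalars f).obj (ModuleCat.of R' W) :=
    ModuleCat.ofHom (Y := (restrictScalars f).obj (ModuleCat.of R' W))
      { toFun := g, map_add' := g.map_add, map_smul' := hg }
  refine ⟨(ExtendRestrictScalarsAdj.HomEquiv.fromExtendScalars f g').hom, fun m => ?_⟩
  exact one_smul R' (g m)

theorem extension_induction {M : ModuleCat.{u} R} {P : (extendScalars f).obj M → Prop}
    (h0 : ∀ (q : R') (m : M), P (q • toExtension f M m)) (hadd : ∀ x y, P x → P y → P (x + y))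
    (w : (extendScalars f).obj M) : P w := by
  have hz : P 0 := by simpa using h0 0 0
  let : Module R R' := Module.compHom R' f
  refine @TensorProduct.induction_on R _ R' M _ _ this _ P w hz (fun q m => ?_) hadd
  have := h0 q m
  have e : q • toExtension f M m = (q ⊗ₜ[R] m : TensorProduct R R' M) := by
    change (q * 1) ⊗ₜ[R] m = _
    rw [mul_one]
  rw [e] at this
  exact this

theorem finite_extension (M : ModuleCat.{u} R) [Module.Finite R M] :
    Module.Finite R' ((extendScalars f).obj M) := by
  let := f.toAlgebra
  exact (inferInstance : Module.Finite R' (TensorProduct R R' M))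

end Extension

/-! ### Density of the units of `ℤ[1/6]` -/

/-- The form of the statement that 2 is a primitive root modulo powers of 3: the cube of 1 + 3^(k+1)
u gains exactly one factor 3. -/
theorem two_pow_mod_three_pow (k : ℕ) :
    ∃ u : ℤ, ¬ 3 ∣ u ∧ (2 : ℤ) ^ (2 * 3 ^ k) = 1 + 3 ^ (k + 1) * u := by
  induction k with
  | zero => exact ⟨1, by norm_num, by norm_num⟩
  | succ k ih =>
    obtain ⟨u, hu, h⟩ := ih
    refine ⟨u + 3 * (3 ^ k * u ^ 2 + 3 ^ (2 * k) * u ^ 3), fun hd => hu ?_, ?_⟩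
    · rwa [dvd_add_left (Dvd.intro _ rfl)] at hd
    · rw [show 2 * 3 ^ (k + 1) = (2 * 3 ^ k) * 3 by ring, pow_mul, h]
      ring

/-- The exponent is corrected one ternary digit at a time: multiplication by 2^(2·3^k·i) changes the
next digit by a nonzero multiple of i and leaves the earlier ones. -/
theorem exists_two_pow_congr (k : ℕ) {m : ℤ} (hm : ¬ 3 ∣ m) :
    ∃ (j : ℕ) (t : ℤ), (2 : ℤ) ^ j = m + 3 ^ k * t := by
  induction k with
  | zero => exact ⟨0, 1 - m, by ring⟩
  | succ k ih =>
    obtain ⟨j, t, h⟩ := ih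
    rcases k with _ | k
    · have : m % 3 = 1 ∨ m % 3 = 2 := by omega
      rcases this with h1 | h1
      · exact ⟨0, (1 - m) / 3, by omega⟩
      · exact ⟨1, (2 - m) / 3, by omega⟩
    · obtain ⟨u, hu, h2⟩ := two_pow_mod_three_pow k
      have hp : Prime (3 : ℤ) := Int.prime_three
      have h2u : ¬ (3 : ℤ) ∣ 2 ^ j * u := fun hd => by
        rcases hp.dvd_or_dvd hd with h3 | h3
        · have := hp.dvd_of_dvd_pow h3
          omega
        · exact hu h3
      have hi : ∃ i : ℕ, (3 : ℤ) ∣ t + i * (2 ^ j * u) := by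
        generalize 2 ^ j * u = v at h2u
        have h3 : t % 3 = 0 ∨ t % 3 = 1 ∨ t % 3 = 2 := by omega
        have h4 : v % 3 = 1 ∨ v % 3 = 2 := by omega
        rcases h3 with h3 | h3 | h3 <;> rcases h4 with h4 | h4
        · exact ⟨0, by push_cast; omega⟩
        · exact ⟨0, by push_cast; omega⟩
        · exact ⟨2, by push_cast; omega⟩
        · exact ⟨1, by push_cast; omega⟩
        · exact ⟨1, by push_cast; omega⟩
        · exact ⟨2, by push_cast; omega⟩
      obtain ⟨i, w, hw⟩ := hi
      have hbin : ∃ r : ℤ, (1 + 3 ^ (k + 1) * u) ^ i = 1 + i * (3 ^ (k + 1) * u) + 3 ^ (k + 2) * r := by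
        clear hw
        induction i with
        | zero => exact ⟨0, by simp⟩
        | succ i ih =>
          obtain ⟨r, hr⟩ := ih
          refine ⟨r + r * 3 ^ (k + 1) * u + i * u ^ 2 * 3 ^ k, ?_⟩
          rw [pow_succ, hr]
          push_cast
          ring
      obtain ⟨r, hr⟩ := hbin
      refine ⟨j + 2 * 3 ^ k * i, w + 2 ^ j * r, ?_⟩
      rw [pow_add, pow_mul, h2, hr]
      have e : (2 : ℤ) ^ j * (1 + i * (3 ^ (k + 1) * u) + 3 ^ (k + 2) * r) =
          2 ^ j + 3 ^ (k + 1) * (i * (2 ^ j * u)) + 3 ^ (k + 2) * (2 ^ j * r) := by ring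
      rw [e]
      linear_combination h + (3 : ℤ) ^ (k + 1) * hw

/-- The ring `ℤ[1/6]`. -/
def ZInvSix : Subring ℚ where
  carrier := {q | ∃ k : ℕ, q.den ∣ 6 ^ k}
  zero_mem' := ⟨0, by simp⟩
  one_mem' := ⟨0, by simp⟩
  add_mem' := by
    rintro a b ⟨k, hk⟩ ⟨l, hl⟩
    exact ⟨k + l, (Rat.add_den_dvd a b).trans (by rw [pow_add]; exact mul_dvd_mul hk hl)⟩
  mul_mem' := by
    rintro a b ⟨k, hk⟩ ⟨l, hl⟩
    exact ⟨k + l, (Rat.mul_den_dvd a b).trans (by rw [pow_add]; exact mul_dvd_mul hk hl)⟩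
  neg_mem' := by
    rintro a ⟨k, hk⟩
    exact ⟨k, by simpa using hk⟩

theorem mem_of_int_mul {q : ℚ} {n : ℕ} (hn : n ≠ 0) {m : ℤ} (h : n * q = m) : q.den ∣ n := by
  have : q = Rat.divInt m n := by
    rw [Rat.divInt_eq_div]
    have : (n : ℚ) ≠ 0 := by exact_mod_cast hn
    push_cast
    field_simp
    linarith
  rw [this]
  exact_mod_cast Rat.den_dvd m n

theorem zInvTwo_le_zInvSix : ZInvTwo ≤ ZInvSix := by
  rintro q ⟨k, hk⟩
  exact ⟨k, hk.trans (pow_dvd_pow_of_dvd (by norm_num) k)⟩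

theorem exists_three_pow_mul_mem (q : ZInvSix) :
    ∃ (k : ℕ), ((3 : ℤ) ^ k : ℚ) * q.1 ∈ ZInvTwo := by
  obtain ⟨k, hk⟩ := q.2
  obtain ⟨c, hc⟩ := hk
  refine ⟨k, k, mem_of_int_mul (m := c * q.1.num) (by positivity) ?_⟩
  have h1 : (q.1.den : ℚ) * q.1 = q.1.num := Rat.den_mul_eq_num _
  have h2 : ((6 : ℕ) ^ k : ℚ) = q.1.den * c := by exact_mod_cast hc
  push_cast at h2 ⊢
  rw [← h1]
  rw [show (6 : ℚ) = 2 * 3 by norm_num, mul_pow] at h2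
  linear_combination q.1 * h2

theorem isUnit_zInvSix {q : ZInvSix} {q' : ℚ} (h : q' ∈ ZInvSix) (hq : q.1 * q' = 1) : IsUnit q :=
  IsUnit.of_mul_eq_one ⟨q', h⟩ (Subtype.ext hq)

theorem two_inv_mem : (2 : ℚ)⁻¹ ∈ ZInvTwo :=
  ⟨1, by norm_num [Rat.inv_ofNat_den]⟩

theorem six_inv_mem : (6 : ℚ)⁻¹ ∈ ZInvSix :=
  ⟨1, by norm_num [Rat.inv_ofNat_den]⟩

theorem isUnit_six : IsUnit (6 : ZInvSix) :=
  isUnit_zInvSix six_inv_mem (by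
    change (6 : ℚ) * 6⁻¹ = 1
    norm_num)

theorem three_inv_mem : (3 : ℚ)⁻¹ ∈ ZInvSix := by
  have := ZInvSix.mul_mem (ofNat_mem ZInvSix 2) six_inv_mem
  norm_num at this ⊢
  exact this

theorem isUnit_three_pow (k : ℕ) : IsUnit (((3 : ℤ) ^ k : ℤ) : ZInvSix) := by
  refine isUnit_zInvSix (ZInvSix.pow_mem three_inv_mem k) ?_
  change (((3 : ℤ) ^ k : ℤ) : ℚ) * _ = 1
  push_cast
  rw [← mul_pow]
  norm_num

/-- Every nonzero element of `ℤ[1/6]` is congruent to a unit modulo powers of `3` in `ℤ[1/2]`. -/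
theorem exists_unit_congr {d : ZInvSix} (hd : d ≠ 0) (c : ℕ) :
    ∃ (ε : ZInvSix) (z : ZInvTwo), IsUnit ε ∧ ε.1 = d.1 + 3 ^ c * z.1 := by
  obtain ⟨k, e, he⟩ := d.2
  have h1 : (d.1.den : ℚ) * d.1 = d.1.num := Rat.den_mul_eq_num _
  have h2 : (6 : ℚ) ^ k = d.1.den * e := by exact_mod_cast he
  have he0 : (e : ℤ) ≠ 0 := by
    rintro h
    have : (6 : ℚ) ^ k ≠ 0 := by positivity
    rw [h2] at this
    simp_all
  have hn0 : (e : ℤ) * d.1.num ≠ 0 :=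
    mul_ne_zero he0 (by rw [Ne, Rat.num_eq_zero]; exact fun h => hd (Subtype.ext h))
  have hfin : FiniteMultiplicity (3 : ℤ) (e * d.1.num) :=
    Int.finiteMultiplicity_iff.2 ⟨by decide, hn0⟩
  obtain ⟨m, hN, hm⟩ := hfin.exists_eq_pow_mul_and_not_dvd
  generalize multiplicity (3 : ℤ) (e * d.1.num) = v at hN
  -- Now d = 3^v m / 6^k with m prime to 3, and replacing m by the power 2^j gives a unit. The extra
  -- k in the modulus cancels the factor 3^k of the denominator, so the correction is 3^c times an
  -- element of ℤ[1/2].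
  obtain ⟨j, t, hj⟩ := exists_two_pow_congr (c + k) hm
  have hNq : (6 : ℚ) ^ k * d.1 = 3 ^ v * m := by
    have : ((e * d.1.num : ℤ) : ℚ) = 3 ^ v * m := by rw [hN]; push_cast; rfl
    rw [← this, h2]
    push_cast
    rw [← h1]; ring
  have hjq : (2 : ℚ) ^ j = m + 3 ^ (c + k) * t := by exact_mod_cast hj
  refine ⟨⟨3 ^ v * 2 ^ j * (6 : ℚ)⁻¹ ^ k, ?_⟩, ⟨3 ^ v * t * (2 : ℚ)⁻¹ ^ k, ?_⟩, ?_, ?_⟩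
  · exact ZInvSix.mul_mem (ZInvSix.mul_mem (ZInvSix.pow_mem (ofNat_mem _ 3) _)
      (ZInvSix.pow_mem (ofNat_mem _ 2) _)) (ZInvSix.pow_mem six_inv_mem _)
  · exact ZInvTwo.mul_mem (ZInvTwo.mul_mem (ZInvTwo.pow_mem (ofNat_mem _ 3) _)
      (intCast_mem _ t)) (ZInvTwo.pow_mem two_inv_mem _)
  · refine isUnit_zInvSix (q' := (3 : ℚ)⁻¹ ^ v * (2 : ℚ)⁻¹ ^ j * 6 ^ k)
      (ZInvSix.mul_mem (ZInvSix.mul_mem (ZInvSix.pow_mem three_inv_mem _)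
      (ZInvSix.pow_mem (zInvTwo_le_zInvSix two_inv_mem) _))
      (ZInvSix.pow_mem (ofNat_mem _ 6) _)) ?_
    simp only
    rw [show ∀ a b c d e f : ℚ, a * b * c * (d * e * f) = (a * d) * (b * e) * (c * f) by
      intros; ring, ← mul_pow, ← mul_pow, ← mul_pow]
    norm_num
  · simp only
    have h6 : (6 : ℚ) ^ k = 2 ^ k * 3 ^ k := by rw [← mul_pow]; norm_num
    have hdv : d.1 = 3 ^ v * m * (6 : ℚ)⁻¹ ^ k := by
      rw [← hNq, mul_assoc, mul_comm d.1, ← mul_assoc, ← mul_pow]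
      norm_num
    rw [hdv, hjq, inv_pow, inv_pow, h6, pow_add]
    field_simp

/-! ### Cubicity under injections and localization, and localization with its matrix action. -/

section Transfer

variable {M W : Type*} [AddCommGroup M] [Module MatRing M] [AddCommGroup W] [Module MatRing W]

theorem map_dev4_matAct (l : M →ₗ[MatRing] W) (a b c d : Mat3) (m : M) :
    l (dev4 (matAct M) a b c d m) = dev4 (matAct W) a b c d (l m) := by
  simp only [dev4, LinearMap.sub_apply, LinearMap.add_apply, matAct_apply, map_sub, map_add l,
    map_smul]

theorem IsCubicModule.of_injective (hW : IsCubicModule W) (l : M →ₗ[MatRing] W)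
    (hl : Function.Injective l) : IsCubicModule M where
  map_zero := LinearMap.ext fun m => hl <| by
    rw [matAct_apply, map_smul l, LinearMap.zero_apply, LinearMap.map_zero]
    exact LinearMap.congr_fun hW.map_zero (l m)
  dev4_eq_zero a b c d := LinearMap.ext fun m => hl <| by
    rw [map_dev4_matAct, hW.dev4_eq_zero, LinearMap.zero_apply, LinearMap.zero_apply, map_zero]

theorem IsCubicModule.of_isLocMap (hM : IsCubicModule M) (l : M →ₗ[MatRing] W) {S : Submonoid ℤ}
    (hl : IsLocMap S l) (hS : ∀ s ∈ S, ∀ w : W, s • w = 0 → w = 0) : IsCubicModule W where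
  map_zero := LinearMap.ext fun w => by
    obtain ⟨s, hs, m, h⟩ := hl.surj w
    refine hS s hs _ ?_
    rw [← LinearMap.map_smul_of_tower, h, matAct_apply, ← map_smul]
    have : mat 0 • m = 0 := LinearMap.congr_fun hM.map_zero m
    rw [this, map_zero]
  dev4_eq_zero a b c d := LinearMap.ext fun w => by
    obtain ⟨s, hs, m, h⟩ := hl.surj w
    refine hS s hs _ ?_
    rw [← LinearMap.map_smul_of_tower, h, ← map_dev4_matAct, hM.dev4_eq_zero,
      LinearMap.zero_apply, map_zero]

/-- The module over the monoid ring given by a representation of the matrices. -/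
noncomputable abbrev matModule {W : Type*} [AddCommGroup W] (ρ : Mat3 →* Module.End ℤ W) :
    Module MatRing W :=
  Module.compHom W (MonoidAlgebra.lift ℤ (Module.End ℤ W) Mat3 ρ).toRingHom

theorem matModule_smul {W : Type*} [AddCommGroup W] (ρ : Mat3 →* Module.End ℤ W) (x : Mat3)
    (w : W) : (letI := matModule ρ; mat x • w) = ρ x w := by
  change (MonoidAlgebra.lift ℤ (Module.End ℤ W) Mat3 ρ (mat x)) w = _
  simp

/-- W is the extension of scalars, with matrices acting functorially. Compatibility of the induced
map G with matrices may be checked after multiplication by some s in S, which brings the argument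
into the image of l. -/
theorem exists_localization {A A' : Subring ℚ} (hA : A ≤ A') (S : Submonoid ℤ)
    (hu : ∀ s ∈ S, IsUnit (s : A')) (hs : ∀ q : A', ∃ s ∈ S, (s : ℚ) * q.1 ∈ A)
    (M : Type u) [AddCommGroup M] [Module A M] [Module MatRing M] [Module.Finite A M]
    (hM : IsCubicModule M) :
    ∃ (W : Type u) (_ : AddCommGroup W) (_ : Module A' W) (_ : Module MatRing W)
      (_ : Module.Finite A' W) (l : M →ₗ[MatRing] W), IsCubicModule W ∧ IsLocMap S l ∧
      ∀ {W' : Type u} [AddCommGroup W'] [Module A' W'] [Module MatRing W'] (g : M →ₗ[MatRing] W'),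
        ∃ G : W →ₗ[MatRing] W', ∀ m, G (l m) = g m := by
  let f := Subring.inclusion hA
  let Mc := ModuleCat.of A M
  let act : Mat3 → (Mc ⟶ Mc) := fun x => ModuleCat.ofHom (smulLinear A M (mat x))
  let ρ : Mat3 →* Module.End ℤ ((ModuleCat.extendScalars f).obj Mc) :=
    { toFun := fun x => ((ModuleCat.extendScalars f).map (act x)).hom.toAddMonoidHom.toIntLinearMap
      map_one' := by
        have : act 1 = 𝟙 Mc := by
          ext m
          exact (congrArg (· • m) mat.map_one).trans (one_smul MatRing m)
        rw [this, CategoryTheory.Functor.map_id]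
        rfl
      map_mul' := fun x y => by
        have : act (x * y) = act y ≫ act x := by
          ext m
          exact (congrArg (· • m) (mat.map_mul x y)).trans (mul_smul _ _ m)
        rw [this, CategoryTheory.Functor.map_comp]
        rfl }
  let : Module MatRing ((ModuleCat.extendScalars f).obj Mc) := matModule ρ
  have hact : ∀ x m, mat x • toExtension f Mc m = toExtension f Mc (mat x • m : M) := fun x m =>
    (matModule_smul ρ x _).trans (extendScalars_map_toExtension (act x) m)
  let l : M →ₗ[MatRing] (ModuleCat.extendScalars f).obj Mc :=
    linearOfMat (toExtension f Mc) fun x m => (hact x m).symm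
  have hl : IsLocMap S l := by
    refine isLocMap_toExtension (Subring.inclusion_injective hA) hu (fun q => ?_) Mc
    obtain ⟨s, hsS, h⟩ := hs q
    exact ⟨s, hsS, ⟨_, h⟩, Subtype.ext rfl⟩
  have hinj : ∀ s ∈ S, ∀ w : (ModuleCat.extendScalars f).obj Mc, s • w = 0 → w = 0 := by
    intro s hsS w h
    rw [← Int.cast_smul_eq_zsmul A'] at h
    exact (hu s hsS).smul_eq_zero.1 h
  have : Module.Finite A Mc := (inferInstance : Module.Finite A M)
  refine ⟨(ModuleCat.extendScalars f).obj Mc, inferInstance, inferInstance, inferInstance,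
    finite_extension Mc, l, hM.of_isLocMap l hl hinj, hl, fun {W'} _ _ _ g => ?_⟩
  let : Module A W' := Module.compHom W' f
  obtain ⟨G, hG⟩ := exists_extension_map (f := f) (M := Mc) (W := W') g.toAddMonoidHom
    fun r m => map_subring_smul (A := A) g.toAddMonoidHom r m
  refine ⟨linearOfMat G.toAddMonoidHom fun x w => ?_, hG⟩
  obtain ⟨s, hsS, m, h⟩ := hl.surj w
  change G (mat x • w) = mat x • G w
  have h1 : ∀ v : W', s • v = 0 → v = 0 := fun v hv => by
    rw [← Int.cast_smul_eq_zsmul A'] at hv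
    exact (hu s hsS).smul_eq_zero.1 hv
  rw [← sub_eq_zero]
  refine h1 _ ?_
  rw [smul_sub, ← map_zsmul, smul_comm s, smul_comm s, ← map_zsmul G, h, ← map_smul l]
  change G (toExtension f Mc _) - mat x • G (toExtension f Mc _) = 0
  rw [hG, hG]
  simp

end Transfer

/-! ### Approximation of a map by a surjective one -/

section Approximation

theorem three_torsion_free_zInvSix {M W : Type*} [AddCommGroup M] [Module MatRing M]
    [AddCommGroup W] [Module MatRing W] [Module ZInvSix W] (l : M →ₗ[MatRing] W)
    (hl : IsLocMap (Submonoid.powers 3) l)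
    (hM : ∀ (n : ℤ) (m : M), ¬ 3 ∣ n → n • m = 0 → m = 0)
    (n : ℤ) (w : W) (hn : n ≠ 0) (h : n • w = 0) : w = 0 := by
  have h3 : ∀ (k : ℕ) (w : W), (3 : ℤ) ^ k • w = 0 → w = 0 := fun k w hw => by
    rw [← Int.cast_smul_eq_zsmul ZInvSix] at hw
    exact (isUnit_three_pow k).smul_eq_zero.1 hw
  obtain ⟨_, ⟨a, rfl⟩, m, hm⟩ := hl.surj w
  have h1 : l (n • m) = 0 := by rw [map_zsmul, ← hm, smul_comm, h, smul_zero]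
  obtain ⟨_, ⟨b, rfl⟩, hb⟩ := hl.ker _ h1
  have hfin : FiniteMultiplicity (3 : ℤ) n := Int.finiteMultiplicity_iff.2 ⟨by decide, hn⟩
  obtain ⟨n', hN, hn'⟩ := hfin.exists_eq_pow_mul_and_not_dvd
  have h2 : ((3 : ℤ) ^ b * 3 ^ multiplicity 3 n) • m = 0 := by
    refine hM n' _ hn' ?_
    rw [smul_smul, ← hb, smul_smul]
    congr 1
    conv_rhs => rw [hN]
    ring
  rw [← pow_add] at h2
  refine h3 a w (h3 (b + multiplicity 3 n) _ ?_)
  rw [hm, ← map_zsmul, h2, map_zero]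

/-- A submodule of full rank of a free module has a basis made of multiples of a basis. -/
theorem exists_diagonal_bases {R X Y : Type*} [CommRing R] [IsDomain R] [IsPrincipalIdealRing R]
    [CharZero R] [AddCommGroup X] [Module R X] [AddCommGroup Y] [Module R Y] [Module.Finite R Y]
    [Module.IsTorsionFree R Y] (φ : X →ₗ[R] Y) (hφ : Function.Injective φ)
    (hc : ∀ y, ∃ n : ℤ, n ≠ 0 ∧ ∃ x, φ x = n • y) :
    ∃ (m : ℕ) (b : Module.Basis (Fin m) R X) (b' : Module.Basis (Fin m) R Y) (d : Fin m → R),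
      (∀ r, d r ≠ 0) ∧ ∀ r, φ (b r) = d r • b' r := by
  have : Module.Free R Y := Module.free_of_finite_type_torsion_free'
  obtain ⟨n, hn, h⟩ := exists_common_smul_mem (LinearMap.range φ)
    { carrier := {n : ℤ | n ≠ 0}, one_mem' := one_ne_zero, mul_mem' := fun ha hb => mul_ne_zero ha hb }
    (fun y => by
      obtain ⟨n, hn, x, hx⟩ := hc y
      exact ⟨n, hn, x, hx⟩)
  -- Multiplication by n embeds Y into the image, so the ranks agree and the Smith normal form has
  -- no zero on its diagonal.
  have hrank : Module.finrank R (LinearMap.range φ) = Module.finrank R Y := by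
    refine le_antisymm (Submodule.finrank_le _) ?_
    let g : Y →ₗ[R] LinearMap.range φ := (LinearMap.lsmul R Y (n : R)).codRestrict _ fun y => by
      rw [LinearMap.lsmul_apply, Int.cast_smul_eq_zsmul]
      exact h y
    refine LinearMap.finrank_le_finrank_of_injective (f := g) ?_
    exact fun a b hab => smul_right_injective Y (Int.cast_ne_zero.2 hn) (congrArg Subtype.val hab)
  obtain ⟨b', d, ab', hab⟩ := Submodule.exists_smith_normal_form_of_rank_eq
    (Module.finBasis R Y) hrank
  refine ⟨_, ab'.map (LinearEquiv.ofInjective φ hφ).symm, b', d, fun r hr => ?_, fun r => ?_⟩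
  · have h1 := hab r
    rw [hr, zero_smul] at h1
    exact ab'.ne_zero r (Subtype.ext h1)
  · rw [← hab r, Module.Basis.map_apply]
    have := LinearEquiv.apply_symm_apply (LinearEquiv.ofInjective φ hφ) (ab' r)
    exact congrArg Subtype.val this

variable {M N : Type u} [AddCommGroup M] [Module ZInvTwo M] [Module MatRing M]
  [AddCommGroup N] [Module ZInvTwo N] [Module MatRing N]

instance smulCommClass_matRing {A : Subring ℚ} {W : Type*} [AddCommGroup W] [Module A W]
    [Module MatRing W] : SMulCommClass MatRing A W where
  smul_comm t a w := map_subring_smul (Module.toModuleEnd ℤ (S := MatRing) W t).toAddMonoidHom a w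

/-- The projection onto the cokernel vanishes on everything generated by the type parts, hence
vanishes. -/
theorem surjective_of_typePart {A : Subring ℚ} (hA : IsUnit (6 : A)) {W W' : Type*}
    [AddCommGroup W] [Module A W] [Module MatRing W] [AddCommGroup W'] [Module A W']
    [Module MatRing W'] (hW' : IsCubicModule W') (Θ : W →ₗ[MatRing] W')
    (h : ∀ i, ∀ w ∈ typePart A W' i, ∃ v, Θ v = w) : Function.Surjective Θ := by
  let ΘA := linearOfSubring A Θ.toAddMonoidHom
  have key := addMonoidHom_ext_of_type hW' (g := (LinearMap.range ΘA).mkQ.toAddMonoidHom) (h := 0)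
    (six_torsion_free (A := A) hA) (fun x i w => by
      obtain ⟨v, hv⟩ := h i _ (typeElt_smul_mem A i w)
      change (LinearMap.range ΘA).mkQ (mat x • typeElt i • w) = 0
      rw [Submodule.mkQ_apply, Submodule.Quotient.mk_eq_zero]
      refine ⟨mat x • v, ?_⟩
      change Θ _ = _
      rw [map_smul, hv])
  intro w
  have := DFunLike.congr_fun key w
  change (LinearMap.range ΘA).mkQ w = 0 at this
  rw [Submodule.mkQ_apply, Submodule.Quotient.mk_eq_zero] at this
  exact this

/-- The heart of uniqueness. The map φ is already surjective modulo 3; adding to it a multiple of 3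
preserves this and, by density of units, can make it surjective after inverting 3. -/
theorem exists_surjective_of_injective [Module.Finite ZInvTwo M] [Module.Finite ZInvTwo N]
    (hM : IsCubicModule M) (hN : IsCubicModule N)
    (tM : ∀ (n : ℤ) (m : M), ¬ 3 ∣ n → n • m = 0 → m = 0)
    (tN : ∀ (n : ℤ) (m : N), ¬ 3 ∣ n → n • m = 0 → m = 0)
    (φ : M →ₗ[MatRing] N) (hφ : Function.Injective φ)
    (hc : ∀ y, ∃ n : ℤ, ¬ 3 ∣ n ∧ ∃ x, φ x = n • y) :
    ∃ θ : M →ₗ[MatRing] N, Function.Surjective θ := by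
  have hu : ∀ s ∈ Submonoid.powers (3 : ℤ), IsUnit (s : ZInvSix) := by
    rintro _ ⟨k, rfl⟩
    exact isUnit_three_pow k
  have hs : ∀ q : ZInvSix, ∃ s ∈ Submonoid.powers (3 : ℤ), (s : ℚ) * q.1 ∈ ZInvTwo := fun q => by
    obtain ⟨k, hk⟩ := exists_three_pow_mul_mem q
    exact ⟨3 ^ k, ⟨k, rfl⟩, by exact_mod_cast hk⟩
  obtain ⟨W, _, _, _, _, l, cW, hl, lift⟩ := exists_localization zInvTwo_le_zInvSix
    (Submonoid.powers (3 : ℤ)) hu hs M hM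
  obtain ⟨W', _, _, _, _, l', cW', hl', -⟩ := exists_localization zInvTwo_le_zInvSix
    (Submonoid.powers (3 : ℤ)) hu hs N hN
  obtain ⟨φ', hφ'⟩ := lift (l'.comp φ)
  simp only [LinearMap.comp_apply] at hφ'
  have tW := three_torsion_free_zInvSix l hl tM
  have tW' := three_torsion_free_zInvSix l' hl' tN
  have injφ' : Function.Injective φ' := by
    rw [injective_iff_map_eq_zero]
    intro w hw
    obtain ⟨_, ⟨a, rfl⟩, m, hm⟩ := hl.surj w
    have h1 : l' (φ m) = 0 := by rw [← hφ', ← hm, map_zsmul, hw, smul_zero]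
    obtain ⟨_, ⟨b, rfl⟩, hb⟩ := hl'.ker _ h1
    rw [← map_zsmul, map_eq_zero_iff _ hφ] at hb
    refine tW (3 ^ b * 3 ^ a) w (by positivity) ?_
    rw [mul_smul]
    change (3 : ℤ) ^ b • ((fun n : ℕ => (3 : ℤ) ^ n) a • w) = 0
    rw [hm, ← map_zsmul]
    exact (congrArg l hb).trans (map_zero l)
  have cokφ' : ∀ y, ∃ n : ℤ, n ≠ 0 ∧ ∃ x, φ' x = n • y := by
    intro y
    obtain ⟨_, ⟨a, rfl⟩, m, hm⟩ := hl'.surj y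
    obtain ⟨n, hn, x, hx⟩ := hc m
    refine ⟨n * 3 ^ a, mul_ne_zero (by rintro rfl; simp at hn) (by positivity), l x, ?_⟩
    rw [hφ', hx, map_zsmul, ← hm, mul_smul]
  -- Over ℤ[1/6] the induced map is injective with torsion cokernel, so on each type part it becomes
  -- diagonal with nonzero entries d.
  have diag : ∀ i, _ := fun i => by
    have := typePart_torsionFree (A := ZInvSix) tW' i
    exact exists_diagonal_bases (typeMap ZInvSix φ' i) (typeMap_injective injφ' i) (fun y => by
      obtain ⟨w', hw'⟩ := y.2
      obtain ⟨n, hn, x, hx⟩ := cokφ' w'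
      refine ⟨n, hn, ⟨_, typeElt_smul_mem ZInvSix i x⟩, Subtype.ext ?_⟩
      rw [typeMap_coe]
      simp only
      rw [map_smul, hx, smul_comm]
      exact congrArg (n • ·) hw')
  choose r b b' d hd hbd using diag
  let J := Σ i, Fin (r i)
  -- The elementary diagonal maps: each changes a single diagonal entry and extends to all of W. Up
  -- to a power 3^c they lift to maps η between M and N.
  have ext : ∀ j : J, ∃ Ψ : W →ₗ[MatRing] W', ∀ k : J, Ψ (b k.1 k.2) =
      if k = j then (b' j.1 j.2 : W') else 0 := by
    classical
    rintro ⟨i, s⟩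
    obtain ⟨Ψ, hΨ⟩ := exists_extension_of_typePart isUnit_six cW cW'
      (Pi.single i (((b i).coord s).smulRight (b' i s)))
    refine ⟨Ψ, ?_⟩
    rintro ⟨i', s'⟩
    rw [hΨ]
    by_cases hi : i' = i
    · subst hi
      rw [Pi.single_eq_same, LinearMap.smulRight_apply, Module.Basis.coord_apply,
        Module.Basis.repr_self, Finsupp.single_apply]
      by_cases hs' : s' = s
      · subst hs'; simp
      · have : (⟨i', s'⟩ : J) ≠ ⟨i', s⟩ := fun h => hs' (by simpa using h)
        rw [if_neg this, if_neg hs', zero_smul, Submodule.coe_zero]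
    · rw [Pi.single_eq_of_ne hi]
      have : (⟨i', s'⟩ : J) ≠ ⟨i, s⟩ := fun h => hi (congrArg Sigma.fst h)
      rw [if_neg this]
      simp
  choose Ψ hΨ using ext
  have lifts := fun j =>
    letI : Module ZInvTwo W' := Module.compHom W' (Subring.inclusion zInvTwo_le_zInvSix)
    hl'.exists_lift (A := ZInvTwo) ((Ψ j).comp l)
  simp only [LinearMap.comp_apply] at lifts
  have lifts' : ∀ j, ∃ (c : ℕ) (η : M →ₗ[MatRing] N), ∀ x, l' (η x) = (3 : ℤ) ^ c • Ψ j (l x) :=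
    fun j => by
      obtain ⟨_, ⟨c, rfl⟩, η, h⟩ := lifts j
      exact ⟨c, η, h⟩
  choose c η hη using lifts'
  -- The exponent c absorbs the denominator of the lift η; the additional 1 provides the factor 3 in
  -- front of the correction in θ.
  have app := fun j : J => exists_unit_congr (hd j.1 j.2) (c j + 1)
  choose ε z hε hεz using app
  let θ : M →ₗ[MatRing] N := φ + (3 : ℤ) • ∑ j, z j • η j
  let z' : J → ZInvSix := fun j => ⟨(z j).1, zInvTwo_le_zInvSix (z j).2⟩
  let Θ : W →ₗ[MatRing] W' := φ' + ∑ j, ((3 : ZInvSix) ^ (c j + 1) * z' j) • Ψ j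
  have smul_l' : ∀ (q : ZInvTwo) (y : N), l' (q • y) =
      (⟨q.1, zInvTwo_le_zInvSix q.2⟩ : ZInvSix) • l' y := by
    intro q y
    let : Module ZInvTwo W' := Module.compHom W' (Subring.inclusion zInvTwo_le_zInvSix)
    exact map_subring_smul (A := ZInvTwo) l'.toAddMonoidHom q y
  have hθ : ∀ x, l' (θ x) = Θ (l x) := by
    intro x
    simp only [θ, Θ, LinearMap.add_apply, LinearMap.smul_apply, LinearMap.sum_apply, map_add,
      map_sum, map_zsmul, hφ', Finset.smul_sum, smul_l', hη]
    congr 1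
    refine Finset.sum_congr rfl fun j _ => ?_
    rw [← Int.cast_smul_eq_zsmul ZInvSix, ← Int.cast_smul_eq_zsmul ZInvSix, smul_smul, smul_smul]
    congr 1
    push_cast
    ring
  have surjΘ : Function.Surjective Θ := by
    refine surjective_of_typePart isUnit_six cW' Θ fun i => ?_
    let ΘA := linearOfSubring ZInvSix Θ.toAddMonoidHom
    have hb : ∀ s, (b' i s : W') ∈ LinearMap.range ΘA := by
      intro s
      have h1 : Θ (b i s) = ε ⟨i, s⟩ • (b' i s : W') := by
        simp only [Θ, LinearMap.add_apply, LinearMap.smul_apply, LinearMap.sum_apply]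
        rw [Finset.sum_eq_single (⟨i, s⟩ : J)]
        · rw [hΨ ⟨i, s⟩ ⟨i, s⟩, if_pos rfl]
          have h2 := congrArg Subtype.val (hbd i s)
          rw [typeMap_coe] at h2
          rw [h2, Submodule.coe_smul, ← add_smul]
          congr 1
          exact Subtype.ext (hεz ⟨i, s⟩).symm
        · intro j _ hj
          rw [hΨ j ⟨i, s⟩, if_neg (Ne.symm hj), smul_zero]
        · intro h; exact absurd (Finset.mem_univ _) h
      obtain ⟨e, he⟩ := hε ⟨i, s⟩
      have h3 : (b' i s : W') = (↑e⁻¹ : ZInvSix) • Θ (b i s) := by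
        rw [h1, ← he, smul_smul, Units.inv_mul, one_smul]
      rw [h3]
      exact Submodule.smul_mem _ _ ⟨b i s, rfl⟩
    intro w hw
    have h4 := (b' i).sum_repr ⟨w, hw⟩
    have h5 : w = ∑ s, (b' i).repr ⟨w, hw⟩ s • (b' i s : W') := by
      have := congrArg Subtype.val h4
      exact this.symm.trans (by rw [AddSubmonoidClass.coe_finsetSum]; rfl)
    have : w ∈ LinearMap.range ΘA := by
      rw [h5]
      exact Submodule.sum_mem _ fun s _ => Submodule.smul_mem _ _ (hb s)
    exact this
  refine ⟨θ, ?_⟩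
  let θA := linearOfSubring ZInvTwo θ.toAddMonoidHom
  obtain ⟨_, ⟨e, rfl⟩, he⟩ := exists_common_smul_mem (LinearMap.range θA) (Submonoid.powers (3 : ℤ))
    (fun y => by
      obtain ⟨w, hw⟩ := surjΘ (l' y)
      obtain ⟨_, ⟨a, rfl⟩, x, hx⟩ := hl.surj w
      have h1 : l' ((3 : ℤ) ^ a • y - θ x) = 0 := by
        rw [map_sub, map_zsmul, hθ, ← hx, map_zsmul, hw]
        exact sub_self _
      obtain ⟨_, ⟨k, rfl⟩, hk⟩ := hl'.ker _ h1
      refine ⟨3 ^ k * 3 ^ a, ⟨k + a, pow_add _ _ _⟩, (3 : ℤ) ^ k • x, ?_⟩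
      change θ _ = _
      rw [map_zsmul, mul_smul, ← sub_eq_zero, ← smul_sub, ← neg_sub, smul_neg, neg_eq_zero]
      exact hk)
  -- Surjectivity modulo 3: the cokernel of φ is prime to 3, and θ - φ is divisible by 3. Iteration
  -- reaches the power 3^e that annihilates the cokernel of θ.
  have step : ∀ y, ∃ x y', y = θ x + (3 : ℤ) • y' := by
    intro y
    obtain ⟨n, hn, x, hx⟩ := hc y
    have hcop : IsCoprime n 3 :=
      ((Int.prime_three.coprime_iff_not_dvd).2 hn).symm
    obtain ⟨α, β, hαβ⟩ := hcop
    refine ⟨α • x, β • y - α • (∑ j, z j • η j) x, ?_⟩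
    have h1 : θ x = n • y + (3 : ℤ) • (∑ j, z j • η j) x := by rw [← hx]; rfl
    rw [map_zsmul, h1]
    conv_lhs => rw [← one_smul ℤ y, ← hαβ]
    module
  have steps : ∀ (k : ℕ) y, ∃ x y', y = θ x + (3 : ℤ) ^ k • y' := by
    intro k
    induction k with
    | zero => exact fun y => ⟨0, y, by simp⟩
    | succ k ih =>
      intro y
      obtain ⟨x, y', rfl⟩ := ih y
      obtain ⟨x', y'', rfl⟩ := step y'
      refine ⟨x + (3 : ℤ) ^ k • x', y'', ?_⟩
      rw [map_add, map_zsmul, smul_add, smul_smul, pow_succ, add_assoc]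
  intro y
  obtain ⟨x, y', rfl⟩ := steps e y
  obtain ⟨x', hx'⟩ := he y'
  exact ⟨x + x', by rw [map_add]; exact congrArg (θ x + ·) hx'⟩

end Approximation

/-! ### The module of values at the free abelian group of rank three -/

section Values

theorem sum_finset_fin_four {B : Type*} [AddCommGroup B] (φ : Finset (Fin 4) → B) :
    ∑ T, φ T = φ {0, 1, 2, 3} + φ {0, 1, 2} + φ {0, 1, 3} + φ {0, 2, 3} + φ {1, 2, 3} + φ {0, 1} +
      φ {0, 2} + φ {0, 3} + φ {1, 2} + φ {1, 3} + φ {2, 3} + φ {0} + φ {1} + φ {2} + φ {3} + φ ∅ := by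
  rw [← Finset.powerset_univ,
    show (Finset.univ : Finset (Fin 4)) = insert 0 (insert 1 (insert 2 (insert 3 ∅))) from rfl]
  repeat rw [Finset.sum_powerset_insert (by decide)]
  simp only [Finset.powerset_empty, Finset.sum_singleton, insert_empty_eq]
  abel

theorem sum_finset_eq_dev4 {A B : Type*} [AddCommGroup A] [AddCommGroup B] (φ : A → B) (h0 : φ 0 = 0)
    (g : Fin 4 → A) : ∑ T : Finset (Fin 4), (-1 : ℤ) ^ (4 - T.card) • φ (∑ k ∈ T, g k) =
      dev4 φ (g 0) (g 1) (g 2) (g 3) := by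
  rw [sum_finset_fin_four]
  simp [h0, dev4, add_assoc, Finset.card_insert_of_notMem, Finset.sum_insert]
  abel

/-- The free abelian group of rank `n`. -/
def freeFab (n : ℕ) : Fab where
  obj := AddCommGrpCat.of (Fin n → ℤ)
  property := ⟨inferInstanceAs (Module.Free ℤ (Fin n → ℤ)), inferInstanceAs (Module.Finite ℤ (Fin n → ℤ))⟩

/-- The morphism given by a homomorphism of groups. -/
def fabHom {X Y : Fab} (f : X.obj →+ Y.obj) : X ⟶ Y := ObjectProperty.homMk (AddCommGrpCat.ofHom f)

theorem fabHom_ext {X Y : Fab} {f g : X ⟶ Y} (h : ∀ x, f.hom.hom x = g.hom.hom x) : f = g :=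
  ObjectProperty.hom_ext _ (AddCommGrpCat.hom_ext (AddMonoidHom.ext h))

theorem fab_add_apply {X Y : Fab} (f g : X ⟶ Y) (x : X.obj) :
    (f + g).hom.hom x = f.hom.hom x + g.hom.hom x := rfl

theorem fab_sum_apply {ι : Type*} {X Y : Fab} (T : Finset ι) (g : ι → (X ⟶ Y)) (x : X.obj) :
    (∑ k ∈ T, g k).hom.hom x = ∑ k ∈ T, (g k).hom.hom x :=
  map_sum (AddMonoidHom.mk' (fun f : X ⟶ Y => f.hom.hom x) fun f g => fab_add_apply f g x) g T

theorem fab_comp_apply {X Y Z : Fab} (f : X ⟶ Y) (g : Y ⟶ Z) (x : X.obj) :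
    (f ≫ g).hom.hom x = g.hom.hom (f.hom.hom x) := rfl

/-- The endomorphism given by a matrix. -/
def matHom (x : Mat3) : freeFab 3 ⟶ freeFab 3 := fabHom (Matrix.mulVecLin x).toAddMonoidHom

theorem matHom_one : matHom 1 = 𝟙 _ := fabHom_ext fun v => Matrix.one_mulVec v

theorem matHom_mul (x y : Mat3) : matHom (x * y) = matHom y ≫ matHom x :=
  fabHom_ext fun v => (Matrix.mulVec_mulVec v x y).symm

theorem matHom_add (x y : Mat3) : matHom (x + y) = matHom x + matHom y :=
  fabHom_ext fun v => Matrix.add_mulVec x y v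

theorem matHom_zero : matHom 0 = 0 := fabHom_ext fun v => Matrix.zero_mulVec v

theorem exists_matHom (f : freeFab 3 ⟶ freeFab 3) : ∃ x, matHom x = f := by
  let g : (Fin 3 → ℤ) →ₗ[ℤ] (Fin 3 → ℤ) := f.hom.hom.toIntLinearMap
  refine ⟨LinearMap.toMatrix' g, fabHom_ext fun v => ?_⟩
  exact LinearMap.toMatrix'_mulVec g v

variable {R : Type} [CommRing R]

noncomputable instance functorModule (F : Fab ⥤ ModuleCat.{u} R) : Module MatRing (F.obj (freeFab 3)) :=
  matModule
    { toFun := fun x => (F.map (matHom x)).hom.toAddMonoidHom.toIntLinearMap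
      map_one' := by
        rw [matHom_one, F.map_id]
        rfl
      map_mul' := fun x y => by
        rw [matHom_mul, F.map_comp]
        rfl }

theorem mat_smul (F : Fab ⥤ ModuleCat.{u} R) (x : Mat3) (w : F.obj (freeFab 3)) :
    mat x • w = (F.map (matHom x)).hom w :=
  matModule_smul _ x w

/-- The linear map of modules of values given by a natural additive map. -/
noncomputable def valueMap {R' : Type} [CommRing R'] {F : Fab ⥤ ModuleCat.{u} R}
    {G : Fab ⥤ ModuleCat.{u} R'} (j : F.obj (freeFab 3) →+ G.obj (freeFab 3))
    (hj : ∀ (f : freeFab 3 ⟶ freeFab 3) x, j ((F.map f).hom x) = (G.map f).hom (j x)) :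
    F.obj (freeFab 3) →ₗ[MatRing] G.obj (freeFab 3) :=
  linearOfMat j fun x w => by rw [mat_smul, mat_smul, hj]

/-- A functor all of whose values on morphisms are given by cubic maps. -/
def IsCubicFunctor (F : Fab ⥤ ModuleCat.{u} R) : Prop :=
  ∀ (X Y : Fab) (x : F.obj X), IsCubicMap fun f : X ⟶ Y => (F.map f).hom x

theorem IsCubicFunctor.isCubicModule {F : Fab ⥤ ModuleCat.{u} R} (hF : IsCubicFunctor F) :
    IsCubicModule (F.obj (freeFab 3)) where
  map_zero := LinearMap.ext fun w => by
    rw [matAct_apply, mat_smul, matHom_zero]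
    exact (hF _ _ w).map_zero
  dev4_eq_zero a b c d := LinearMap.ext fun w => by
    have := (hF _ _ w).dev4_eq_zero (matHom a) (matHom b) (matHom c) (matHom d)
    simp only [dev4, ← matHom_add, ← mat_smul] at this
    simpa only [dev4, LinearMap.sub_apply, LinearMap.add_apply, matAct_apply, LinearMap.zero_apply]
      using this

/-! ### Vanishing of cross-effects in terms of deviations -/

theorem crossIdem_apply (F : Fab ⥤ ModuleCat.{u} R) {m : ℕ} (A : Fin m → Fab)
    (x : F.obj (directSum A)) : (crossIdem F A).hom x =
      ∑ T : Finset (Fin m), (-1 : ℤ) ^ (m - T.card) • (F.map (summandIdem A T)).hom x := by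
  rw [crossIdem, ModuleCat.hom_sum, LinearMap.sum_apply]
  rfl

theorem crossEffect_eq_bot (F : Fab ⥤ ModuleCat.{u} R) {m : ℕ} (A : Fin m → Fab) :
    crossEffect F A = ⊥ ↔ ∀ x, ∑ T : Finset (Fin m),
      (-1 : ℤ) ^ (m - T.card) • (F.map (summandIdem A T)).hom x = 0 := by
  rw [crossEffect, LinearMap.range_eq_bot, LinearMap.ext_iff]
  exact forall_congr' fun x => by rw [crossIdem_apply]; rfl

theorem summandIdem_apply {m : ℕ} (A : Fin m → Fab) (T : Finset (Fin m)) (v : ∀ k, (A k).obj)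
    (k : Fin m) : (show ∀ k, (A k).obj from (summandIdem A T).hom.hom v) k =
      if k ∈ T then v k else 0 := by
  change (∑ k ∈ T, (AddMonoidHom.single (fun k => (A k).obj) k).comp
    (Pi.evalAddMonoidHom (fun k => (A k).obj) k)) v k = _
  rw [AddMonoidHom.finsetSum_apply, Finset.sum_apply]
  have : ∀ c, (((AddMonoidHom.single (fun k => (A k).obj) c).comp
      (Pi.evalAddMonoidHom (fun k => (A k).obj) c)) v) k = if k = c then v k else 0 := by
    intro c
    by_cases h : k = c
    · subst h
      rw [if_pos rfl]
      exact Pi.single_eq_same k _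
    · rw [if_neg h]
      exact Pi.single_eq_of_ne h _
  simp only [this]
  rw [Finset.sum_ite_eq]

/-- The fourth deviation at a, b, c, d is the cross-effect endomorphism on four copies of X,
preceded by the diagonal and followed by the map with components a, b, c, d. Only the case m = 4 of
the degree condition is used. -/
theorem IsCubic.isCubicFunctor {F : Fab ⥤ ModuleCat.{u} R} (hF : IsCubic F) : IsCubicFunctor F := by
  intro X Y x
  refine ⟨by rw [hF.map_zero]; rfl, fun a b c d => ?_⟩
  let A : Fin 4 → Fab := fun _ => X
  let g : Fin 4 → (X ⟶ Y) := ![a, b, c, d]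
  let diag : X ⟶ directSum A := fabHom (Y := directSum A) (AddMonoidHom.mk' (fun x _ => x) fun _ _ => rfl)
  let total : directSum A ⟶ Y := fabHom (X := directSum A)
    (∑ k, (g k).hom.hom.comp (Pi.evalAddMonoidHom (fun k => (A k).obj) k))
  have ht : ∀ w : ∀ k, (A k).obj, total.hom.hom w = ∑ k, (g k).hom.hom (w k) := fun w =>
    AddMonoidHom.finsetSum_apply _ _ _
  have h1 : ∀ T, diag ≫ summandIdem A T ≫ total = ∑ k ∈ T, g k := by
    intro T
    refine fabHom_ext fun v => ?_
    rw [fab_comp_apply, fab_comp_apply, fab_sum_apply]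
    refine (ht _).trans ?_
    rw [← Finset.sum_subset T.subset_univ]
    · refine Finset.sum_congr rfl fun k hk => congrArg (g k).hom.hom ?_
      exact (summandIdem_apply A T _ k).trans (if_pos hk)
    · intro k _ hk
      refine (congrArg (g k).hom.hom ((summandIdem_apply A T _ k).trans (if_neg hk))).trans ?_
      exact _root_.map_zero _
  have h2 := (crossEffect_eq_bot F A).1 (hF.degree_le 4 (by norm_num) A) ((F.map diag).hom x)
  have h3 := congrArg (F.map total).hom h2
  have h4 : ∀ T, (F.map total).hom ((F.map (summandIdem A T)).hom ((F.map diag).hom x)) =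
      (F.map (∑ k ∈ T, g k)).hom x := by
    intro T
    rw [← h1, F.map_comp, F.map_comp]
    rfl
  rw [map_sum, LinearMap.map_zero] at h3
  simp only [map_zsmul, h4] at h3
  rw [sum_finset_eq_dev4 (fun f : X ⟶ Y => (F.map f).hom x) (by rw [hF.map_zero]; rfl)] at h3
  exact h3

/-- The vanishing of cross-effects is inherited along injective natural maps. -/
theorem crossEffect_eq_bot_of_injective {ι : Type*} {S : ι → Type} [∀ i, CommRing (S i)]
    {F : Fab ⥤ ModuleCat.{u} R} {G : ∀ i, Fab ⥤ ModuleCat.{u} (S i)}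
    (j : ∀ i X, F.obj X →+ (G i).obj X)
    (hj : ∀ i {X Y} (f : X ⟶ Y) x, j i Y ((F.map f).hom x) = ((G i).map f).hom (j i X x))
    (hinj : ∀ X x, (∀ i, j i X x = 0) → x = 0) {m : ℕ} (A : Fin m → Fab)
    (hG : ∀ i, crossEffect (G i) A = ⊥) : crossEffect F A = ⊥ := by
  rw [crossEffect_eq_bot]
  refine fun x => hinj _ _ fun i => ?_
  rw [map_sum, ← (crossEffect_eq_bot _ A).1 (hG i) (j i _ x)]
  exact Finset.sum_congr rfl fun T _ => by rw [map_zsmul, hj]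

end Values

/-! ### Recovering a cubic functor from its module of values -/

section Recover

/-- A vanishing fourth deviation expresses the value at a long sum through values at shorter ones.
The element 0 of S pads sums of fewer than three terms. -/
theorem IsCubicMap.mem_closure {A B : Type*} [AddCommGroup A] [AddCommGroup B] {f : A → B}
    (hf : IsCubicMap f) {S : Set A} (h0 : 0 ∈ S) {a : A} (ha : a ∈ AddSubmonoid.closure S) :
    f a ∈ AddSubgroup.closure {b | ∃ x ∈ S, ∃ y ∈ S, ∃ z ∈ S, f (x + y + z) = b} := by
  obtain ⟨l, hl, rfl⟩ := AddSubmonoid.exists_list_of_mem_closure ha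
  have key : ∀ (n : ℕ) (l : List A), l.length ≤ n → (∀ y ∈ l, y ∈ S) →
      f l.sum ∈ AddSubgroup.closure {b | ∃ x ∈ S, ∃ y ∈ S, ∃ z ∈ S, f (x + y + z) = b} := by
    intro n
    induction n with
    | zero =>
      intro l hn hl
      rw [List.length_eq_zero_iff.1 (Nat.le_zero.1 hn)]
      exact AddSubgroup.subset_closure ⟨0, h0, 0, h0, 0, h0, by simp⟩
    | succ n ih =>
      intro l hn hl
      match l with
      | [] => exact ih [] (by simp) (by simp)
      | [a] =>
        exact AddSubgroup.subset_closure ⟨a, hl a (by simp), 0, h0, 0, h0, by simp⟩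
      | [a, b] =>
        exact AddSubgroup.subset_closure ⟨a, hl a (by simp), b, hl b (by simp), 0, h0, by simp⟩
      | [a, b, c] =>
        exact AddSubgroup.subset_closure
          ⟨a, hl a (by simp), b, hl b (by simp), c, hl c (by simp), by simp [add_assoc]⟩
      | a :: b :: c :: d :: l' =>
        -- The tail of the list serves as the fourth argument, so every other term is the value at a
        -- strictly shorter list.
        have h := hf.dev4_eq_zero a b c (d :: l').sum
        have hlen : l'.length + 3 ≤ n := by simp only [List.length_cons] at hn; lia
        simp only [List.forall_mem_cons] at hl
        obtain ⟨ha, hb, hc, hd, hl'⟩ := hl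
        have m1 := ih [a, b, c] (by simp; lia) (by simp [*])
        have m2 := ih (a :: b :: d :: l') (by simp; lia) (by simp_all)
        have m3 := ih (a :: c :: d :: l') (by simp; lia) (by simp_all)
        have m4 := ih (b :: c :: d :: l') (by simp; lia) (by simp_all)
        have m5 := ih [a, b] (by simp; lia) (by simp [*])
        have m6 := ih [a, c] (by simp; lia) (by simp [*])
        have m7 := ih (a :: d :: l') (by simp; lia) (by simp_all)
        have m8 := ih [b, c] (by simp; lia) (by simp [*])
        have m9 := ih (b :: d :: l') (by simp; lia) (by simp_all)
        have m10 := ih (c :: d :: l') (by simp; lia) (by simp_all)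
        have m11 := ih [a] (by simp; lia) (by simp [*])
        have m12 := ih [b] (by simp; lia) (by simp [*])
        have m13 := ih [c] (by simp; lia) (by simp [*])
        have m14 := ih (d :: l') (by simp; lia) (by simp_all)
        simp only [List.sum_cons, List.sum_nil, add_zero, ← add_assoc] at *
        rw [dev4] at h
        have h' : f (a + b + c + d + l'.sum) = f (a + b + c) + f (a + b + d + l'.sum)
            + f (a + c + d + l'.sum) + f (b + c + d + l'.sum) - f (a + b) - f (a + c)
            - f (a + d + l'.sum) - f (b + c) - f (b + d + l'.sum) - f (c + d + l'.sum)
            + f a + f b + f c + f (d + l'.sum) := by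
          simp only [← add_assoc] at h
          rw [← sub_eq_zero, ← h]
          abel
        rw [h']
        exact add_mem (add_mem (add_mem (add_mem (sub_mem (sub_mem (sub_mem (sub_mem (sub_mem
          (sub_mem (add_mem (add_mem (add_mem m1 m2) m3) m4) m5) m6) m7) m8) m9) m10) m11) m12)
          m13) m14
  exact key l.length l le_rfl hl

/-- The morphisms which factor through a group of rank one. -/
def rankOne (X Y : Fab) : Set (X ⟶ Y) :=
  {f | ∃ (b : X.obj →+ ℤ) (y : Y.obj), ∀ x, f.hom.hom x = b x • y}

theorem zero_mem_rankOne (X Y : Fab) : (0 : X ⟶ Y) ∈ rankOne X Y :=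
  ⟨0, 0, fun x => by simp⟩

theorem id_mem_closure_rankOne (X : Fab) : 𝟙 X ∈ AddSubmonoid.closure (rankOne X X) := by
  have := X.property.1
  have := X.property.2
  let b := Module.Free.chooseBasis ℤ X.obj
  have : 𝟙 X = ∑ i, fabHom (((b.coord i).smulRight (b i)).toAddMonoidHom) := by
    refine fabHom_ext fun x => ?_
    rw [fab_sum_apply]
    exact (b.sum_repr x).symm
  rw [this]
  exact sum_mem fun i _ => AddSubmonoid.subset_closure ⟨(b.coord i).toAddMonoidHom, b i, fun x => rfl⟩

theorem exists_factor_of_rankOne {X Y : Fab} {f g h : X ⟶ Y} (hf : f ∈ rankOne X Y)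
    (hg : g ∈ rankOne X Y) (hh : h ∈ rankOne X Y) :
    ∃ (b : X ⟶ freeFab 3) (a : freeFab 3 ⟶ Y), f + g + h = b ≫ a := by
  obtain ⟨b₀, y₀, h₀⟩ := hf
  obtain ⟨b₁, y₁, h₁⟩ := hg
  obtain ⟨b₂, y₂, h₂⟩ := hh
  let β : X.obj →+ (Fin 3 → ℤ) := AddMonoidHom.mk' (fun x => ![b₀ x, b₁ x, b₂ x]) (by simp)
  let α : (Fin 3 → ℤ) →+ Y.obj := AddMonoidHom.mk' (fun v => v 0 • y₀ + v 1 • y₁ + v 2 • y₂) (by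
    intro v w
    simp only [Pi.add_apply, add_smul]
    abel)
  refine ⟨fabHom (Y := freeFab 3) β, fabHom (X := freeFab 3) α, fabHom_ext fun x => ?_⟩
  rw [fab_add_apply, fab_add_apply, h₀, h₁, h₂]
  rfl

variable {R : Type} [CommRing R] {F : Fab ⥤ ModuleCat.{u} R}

/-- The identity of X is a sum of maps of rank one. Consequently F is both generated by its value at
ℤ³ and detected by maps to ℤ³. -/
theorem IsCubicFunctor.mem_closure (hF : IsCubicFunctor F) {X : Fab} (x : F.obj X) :
    x ∈ AddSubgroup.closure {y | ∃ (b : X ⟶ freeFab 3) (a : freeFab 3 ⟶ X),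
      (F.map a).hom ((F.map b).hom x) = y} := by
  have h := (hF X X x).mem_closure (zero_mem_rankOne X X) (id_mem_closure_rankOne X)
  rw [F.map_id] at h
  refine AddSubgroup.closure_mono ?_ h
  rintro y ⟨f, hf, g, hg, k, hk, rfl⟩
  obtain ⟨b, a, e⟩ := exists_factor_of_rankOne hf hg hk
  refine ⟨b, a, ?_⟩
  rw [e, F.map_comp]
  rfl

theorem IsCubicFunctor.induction (hF : IsCubicFunctor F) {X : Fab} {Q : F.obj X → Prop}
    (hmap : ∀ (a : freeFab 3 ⟶ X) v, Q ((F.map a).hom v)) (hadd : ∀ x y, Q x → Q y → Q (x + y))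
    (hneg : ∀ x, Q x → Q (-x)) (x : F.obj X) : Q x := by
  refine AddSubgroup.closure_induction (p := fun z _ => Q z) ?_ ?_ ?_ ?_ (hF.mem_closure x)
  · rintro y ⟨b, a, rfl⟩
    exact hmap _ _
  · simpa using hmap 0 0
  · exact fun y z _ _ => hadd y z
  · exact fun y _ => hneg y

theorem IsCubicFunctor.eq_zero (hF : IsCubicFunctor F) {X : Fab} {x : F.obj X}
    (h : ∀ b : X ⟶ freeFab 3, (F.map b).hom x = 0) : x = 0 := by
  have hx := hF.mem_closure x
  have : {y | ∃ (b : X ⟶ freeFab 3) (a : freeFab 3 ⟶ X),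
      (F.map a).hom ((F.map b).hom x) = y} ⊆ ((⊥ : AddSubgroup (F.obj X)) : Set (F.obj X)) := by
    rintro y ⟨b, a, rfl⟩
    rw [h, LinearMap.map_zero]
    rfl
  exact (AddSubgroup.closure_le _).2 this hx

theorem IsCubicFunctor.eq_of_map_eq (hF : IsCubicFunctor F) {X : Fab} {x y : F.obj X}
    (h : ∀ b : X ⟶ freeFab 3, (F.map b).hom x = (F.map b).hom y) : x = y := by
  rw [← sub_eq_zero]
  exact hF.eq_zero fun b => by rw [map_sub, h, sub_self]

variable {A : Subring ℚ} {F G : Fab ⥤ ModuleCat.{u} A}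

/-- The image of x is characterized by its values under all maps to ℤ³. Uniqueness is detection for
G; existence is checked on generators F(a)(v) of F, with image G(a)(Φ v). The characterization makes
additivity and naturality automatic. -/
theorem exists_natTrans (hF : IsCubicFunctor F) (hG : IsCubicFunctor G)
    (Φ : F.obj (freeFab 3) →ₗ[MatRing] G.obj (freeFab 3)) :
    ∃ η : F ⟶ G, ∀ v, (η.app (freeFab 3)).hom v = Φ v := by
  have hΦ : ∀ (f : freeFab 3 ⟶ freeFab 3) v, Φ ((F.map f).hom v) = (G.map f).hom (Φ v) := by
    intro f v
    obtain ⟨x, rfl⟩ := exists_matHom f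
    rw [← mat_smul, ← mat_smul, map_smul Φ]
  have ex : ∀ (X : Fab) (x : F.obj X), ∃ y : G.obj X, ∀ b : X ⟶ freeFab 3,
      (G.map b).hom y = Φ ((F.map b).hom x) := by
    intro X x
    induction x using hF.induction with
    | hmap a v =>
      refine ⟨(G.map a).hom (Φ v), fun b => ?_⟩
      have h := hΦ (a ≫ b) v
      rw [F.map_comp, G.map_comp] at h
      exact h.symm
    | hadd x x' h h' =>
      obtain ⟨y, hy⟩ := h
      obtain ⟨y', hy'⟩ := h'
      exact ⟨y + y', fun b => by rw [map_add, map_add, map_add Φ, hy, hy']⟩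
    | hneg x h =>
      obtain ⟨y, hy⟩ := h
      exact ⟨-y, fun b => by rw [map_neg, map_neg, map_neg Φ, hy]⟩
  choose φ hφ using ex
  have uniq : ∀ {X : Fab} {x : F.obj X} {y : G.obj X},
      (∀ b : X ⟶ freeFab 3, (G.map b).hom y = Φ ((F.map b).hom x)) → y = φ X x :=
    fun h => hG.eq_of_map_eq fun b => by rw [h, hφ]
  have hadd : ∀ X (x y : F.obj X), φ X (x + y) = φ X x + φ X y := fun X x y =>
    (uniq fun b => by rw [map_add, hφ, hφ, map_add, map_add Φ]).symm
  refine ⟨{ app := fun X => ModuleCat.ofHom (linearOfSubring A (AddMonoidHom.mk' (φ X) (hadd X)))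
            naturality := fun X Y f => ?_ }, fun v => ?_⟩
  · ext x
    refine (uniq fun b => ?_).symm
    have h := hφ X x (f ≫ b)
    rw [F.map_comp, G.map_comp] at h
    exact h
  · have h := hφ _ v (𝟙 _)
    rw [F.map_id, G.map_id] at h
    exact h

theorem natTrans_ext (hF : IsCubicFunctor F) {η θ : F ⟶ G}
    (h : ∀ v, (η.app (freeFab 3)).hom v = (θ.app (freeFab 3)).hom v) : η = θ := by
  ext X x
  induction x using hF.induction with
  | hmap a v =>
    have h1 := DFunLike.congr_fun (congrArg ModuleCat.Hom.hom (η.naturality a)) v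
    have h2 := DFunLike.congr_fun (congrArg ModuleCat.Hom.hom (θ.naturality a)) v
    refine h1.trans (Eq.trans ?_ h2.symm)
    exact congrArg (G.map a).hom (h v)
  | hadd x y hx hy => rw [map_add, map_add, hx, hy]
  | hneg x hx => rw [map_neg, map_neg, hx]

theorem nonempty_iso_of_equiv (hF : IsCubicFunctor F) (hG : IsCubicFunctor G)
    (Φ : F.obj (freeFab 3) ≃ₗ[MatRing] G.obj (freeFab 3)) : Nonempty (F ≅ G) := by
  obtain ⟨η, hη⟩ := exists_natTrans hF hG Φ.toLinearMap
  obtain ⟨θ, hθ⟩ := exists_natTrans hG hF Φ.symm.toLinearMap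
  refine ⟨⟨η, θ, natTrans_ext hF fun v => ?_, natTrans_ext hG fun v => ?_⟩⟩
  · change (θ.app _).hom ((η.app _).hom v) = v
    rw [hη, hθ]
    exact Φ.symm_apply_apply v
  · change (η.app _).hom ((θ.app _).hom v) = v
    rw [hη, hθ]
    exact Φ.apply_symm_apply v

/-- The isomorphism of the modules of values given by an isomorphism of functors. -/
noncomputable def valueEquiv {F G : Fab ⥤ ModuleCat.{u} R} (e : F ≅ G) : F.obj (freeFab 3) ≃ₗ[MatRing] G.obj (freeFab 3) :=
  LinearEquiv.ofBijective
    (valueMap (e.hom.app (freeFab 3)).hom.toAddMonoidHom fun f x =>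
      DFunLike.congr_fun (congrArg ModuleCat.Hom.hom (e.hom.naturality f)) x)
    ((e.app (freeFab 3)).toLinearEquiv).bijective

theorem nonempty_iso_of_bijective (j : ∀ X, F.obj X →+ G.obj X)
    (hj : ∀ {X Y} (f : X ⟶ Y) x, j Y ((F.map f).hom x) = (G.map f).hom (j X x))
    (hb : ∀ X, Function.Bijective (j X)) : Nonempty (F ≅ G) :=
  ⟨NatIso.ofComponents
    (fun X => (LinearEquiv.ofBijective (linearOfSubring A (j X)) (hb X)).toModuleIso)
    fun f => by
      ext x
      exact hj f x⟩

end Recover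

/-! ### Localization at a prime -/

section Localization

/-- The integers prime to `p`. -/
def primeTo (p : ℤ) : Submonoid ℤ where
  carrier := {s | IsCoprime s p}
  one_mem' := isCoprime_one_left
  mul_mem' := IsCoprime.mul_left

theorem isUnit_of_mem_primeTo {p : OddPrime} {s : ℤ} (hs : s ∈ primeTo p.1) :
    IsUnit (s : ZLoc p.1) := by
  have hs' : s.natAbs.Coprime p.1 := by simpa using Int.isCoprime_iff_nat_coprime.1 hs
  have h0 : s ≠ 0 := by
    rintro rfl
    exact p.2.1.ne_one (by simpa using hs')
  have h0' : (s : ℚ) ≠ 0 := by exact_mod_cast h0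
  refine IsUnit.of_mul_eq_one ⟨(s : ℚ)⁻¹, Nat.Coprime.of_dvd_left ?_ hs'⟩
    (Subtype.ext (mul_inv_cancel₀ h0'))
  refine mem_of_int_mul (m := s.sign) (by simpa using h0) ?_
  rw [← div_eq_mul_inv, div_eq_iff h0', ← Int.cast_mul, Int.sign_mul_self_eq_natAbs]
  simp

theorem eq_zero_of_isUnit {A W : Type*} [Ring A] [AddCommGroup W] [Module A W] {s : ℤ}
    (hs : IsUnit (s : A)) {w : W} (h : s • w = 0) : w = 0 := by
  rw [← Int.cast_smul_eq_zsmul A] at h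
  exact hs.smul_eq_zero.1 h

theorem exists_primeTo_smul_eq {p : ℕ} (q : ZLoc p) :
    ∃ s ∈ primeTo p, ∃ n : ℤ, (s : ℚ) * q.1 = n := by
  refine ⟨q.1.den, ?_, q.1.num, ?_⟩
  · exact Int.isCoprime_iff_nat_coprime.2 q.2
  · exact_mod_cast Rat.den_mul_eq_num q.1

theorem int_mem_primeTo_or_dvd {p : OddPrime} (n : ℤ) : n ∈ primeTo p.1 ∨ (p.1 : ℤ) ∣ n := by
  have hp : Prime (p.1 : ℤ) := Nat.prime_iff_prime_int.1 p.2.1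
  by_cases h : (p.1 : ℤ) ∣ n
  · exact Or.inr h
  · exact Or.inl ((hp.coprime_iff_not_dvd.2 h).symm)

theorem eq_pow_mul_of_ne_zero (p : OddPrime) {n : ℤ} (hn : n ≠ 0) :
    ∃ (k : ℕ) (m : ℤ), m ∈ primeTo p.1 ∧ n = (p.1 : ℤ) ^ k * m := by
  have hp := Nat.prime_iff_prime_int.1 p.2.1
  have hfin : FiniteMultiplicity (p.1 : ℤ) n := Int.finiteMultiplicity_iff.2
    ⟨by simpa using p.2.1.ne_one, hn⟩
  obtain ⟨m, hN, hm⟩ := hfin.exists_eq_pow_mul_and_not_dvd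
  exact ⟨_, m, (int_mem_primeTo_or_dvd m).resolve_right hm, hN⟩

theorem prime_mem_primeTo {p q : OddPrime} (h : p ≠ q) (k : ℕ) : (p.1 : ℤ) ^ k ∈ primeTo q.1 :=
  IsCoprime.pow_left (Int.isCoprime_iff_gcd_eq_one.2
    ((Nat.coprime_primes p.2.1 q.2.1).2 fun e => h (Subtype.ext e)))

/-- The canonical map to the localization. -/
noncomputable abbrev localizeMap (p : OddPrime) (M : Fab ⥤ ModuleCat.{u} ZInvTwo) (X : Fab) :
    M.obj X →+ (localize p M).obj X :=
  toExtension (zInvTwoToZLoc p) (M.obj X)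

theorem isLocMap_localizeMap (p : OddPrime) (M : Fab ⥤ ModuleCat.{u} ZInvTwo) (X : Fab) :
    IsLocMap (primeTo p.1) (localizeMap p M X) := by
  refine isLocMap_toExtension (Subring.inclusion_injective _)
    (fun s hs => isUnit_of_mem_primeTo hs) (fun q => ?_) _
  obtain ⟨s, hs, n, h⟩ := exists_primeTo_smul_eq q
  exact ⟨s, hs, n, Subtype.ext h⟩

theorem IsCubicMap.comp {A B C : Type*} [AddCommGroup A] [AddCommGroup B] [AddCommGroup C]
    {ρ : A → B} (hρ : IsCubicMap ρ) (g : B →+ C) : IsCubicMap fun a => g (ρ a) := by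
  refine ⟨by rw [hρ.map_zero, _root_.map_zero], fun a b c d => ?_⟩
  have h := congrArg g (hρ.dev4_eq_zero a b c d)
  simp only [dev4, map_add, map_sub, _root_.map_zero] at h
  exact h

theorem IsCubicMap.add {A B : Type*} [AddCommGroup A] [AddCommGroup B] {ρ σ : A → B}
    (hρ : IsCubicMap ρ) (hσ : IsCubicMap σ) : IsCubicMap fun a => ρ a + σ a := by
  refine ⟨by rw [hρ.map_zero, hσ.map_zero, add_zero], fun a b c d => ?_⟩
  have h := congrArg₂ (· + ·) (hρ.dev4_eq_zero a b c d) (hσ.dev4_eq_zero a b c d)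
  simp only [dev4, add_zero] at h ⊢
  rw [← h]
  abel

theorem isCubicFunctor_extendAlong {R S : Type} [CommRing R] [CommRing S] (f : R →+* S)
    {F : Fab ⥤ ModuleCat.{u} R} (hF : IsCubicFunctor F) : IsCubicFunctor (extendAlong f F) := by
  intro X Y x
  induction x using extension_induction with
  | h0 q m =>
    have := (hF X Y m).comp (((LinearMap.lsmul S _ q).toAddMonoidHom).comp
      (toExtension f (F.obj Y)))
    refine (funext fun g => ?_ : (fun g => _) = _) ▸ this
    exact (LinearMap.map_smul ((ModuleCat.extendScalars f).map (F.map g)).hom q _)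
  | hadd x y hx hy =>
    refine (funext fun g => ?_ : (fun g => _) = _) ▸ hx.add hy
    exact (LinearMap.map_add ((ModuleCat.extendScalars f).map (F.map g)).hom x y)

/-- Identifying a localization thus needs only a localization map at ℤ³. -/
theorem nonempty_localize_iso {p : OddPrime} {M : Fab ⥤ ModuleCat.{u} ZInvTwo}
    {N : Fab ⥤ ModuleCat.{u} (ZLoc p.1)} (hM : IsCubicFunctor M) (hN : IsCubicFunctor N)
    (l : M.obj (freeFab 3) →ₗ[MatRing] N.obj (freeFab 3)) (hl : IsLocMap (primeTo p.1) l) :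
    Nonempty (localize p M ≅ N) := by
  let : Module ZInvTwo (N.obj (freeFab 3)) := Module.compHom _ (zInvTwoToZLoc p)
  obtain ⟨G, hG⟩ := exists_extension_map (f := zInvTwoToZLoc p) (M := M.obj (freeFab 3))
    (W := N.obj (freeFab 3)) l.toAddMonoidHom
    fun r m => map_subring_smul (A := ZInvTwo) l.toAddMonoidHom r m
  have hj := isLocMap_localizeMap p M (freeFab 3)
  let G' : (localize p M).obj (freeFab 3) →ₗ[MatRing] N.obj (freeFab 3) :=
    linearOfMat G.toAddMonoidHom fun x w => by
      rw [mat_smul, mat_smul]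
      change G (((ModuleCat.extendScalars _).map (M.map (matHom x))).hom w) = (N.map (matHom x)).hom (G w)
      induction w using extension_induction with
      | h0 q m =>
        rw [LinearMap.map_smul, LinearMap.map_smul, extendScalars_map_toExtension, hG,
          LinearMap.map_smul, hG, LinearMap.map_smul]
        refine congrArg (q • ·) ?_
        rw [← mat_smul, ← mat_smul]
        exact map_smul l _ _
      | hadd v w hv hw => simp only [map_add, hv, hw]
  have hb : Function.Bijective G' := by
    constructor
    · rw [injective_iff_map_eq_zero]
      intro w hw
      obtain ⟨s, hs, m, h⟩ := hj.surj w
      have h1 : l m = 0 := by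
        refine (hG m).symm.trans ((congrArg G h).symm.trans ((map_zsmul G _ _).trans ?_))
        exact (congrArg (s • ·) hw).trans (smul_zero s)
      obtain ⟨s', hs', h2⟩ := hl.ker _ h1
      refine eq_zero_of_isUnit (isUnit_of_mem_primeTo (mul_mem hs' hs)) ?_
      rw [mul_smul, h, ← map_zsmul, h2, _root_.map_zero]
    · intro y
      obtain ⟨s, hs, m, h⟩ := hl.surj y
      obtain ⟨e, he⟩ := isUnit_of_mem_primeTo hs
      refine ⟨(↑e⁻¹ : ZLoc p.1) • localizeMap p M _ m, ?_⟩
      refine (LinearMap.map_smul G _ _).trans ((congrArg _ (hG m)).trans ?_)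
      change _ • l m = _
      rw [← h, ← Int.cast_smul_eq_zsmul (ZLoc p.1), ← he, smul_smul, Units.inv_mul, one_smul]
  exact nonempty_iso_of_equiv (isCubicFunctor_extendAlong _ hM) hN (LinearEquiv.ofBijective G' hb)

end Localization

/-! ### The decomposition of the torsion part -/

section Torsion

variable {V : Type u} [AddCommGroup V] [Module ZInvTwo V] {W : OddPrime → Type u}
  [∀ p, AddCommGroup (W p)] [∀ p, Module (ZLoc p.1) (W p)]

theorem isUnit_two_pow (k : ℕ) : IsUnit (((2 : ℤ) ^ k : ℤ) : ZInvTwo) := by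
  refine IsUnit.of_mul_eq_one ⟨_, ZInvTwo.pow_mem two_inv_mem k⟩ (Subtype.ext ?_)
  change (((2 : ℤ) ^ k : ℤ) : ℚ) * _ = 1
  push_cast
  rw [← mul_pow]
  norm_num

/-- Odd prime factors are removed from the annihilator one by one by Bézout; the remaining power of
2 is a unit. -/
theorem eq_zero_of_forall_primeTo {v : V} {n : ℤ} (hn : n ≠ 0) (hv : n • v = 0)
    (h : ∀ p : OddPrime, ∃ s ∈ primeTo p.1, s • v = 0) : v = 0 := by
  have key : ∀ m : ℕ, m ≠ 0 → (m : ℤ) • v = 0 → v = 0 := by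
    intro m
    induction m using Nat.strong_induction_on with
    | _ m ih =>
      intro hm hmv
      by_cases h2 : ∃ k, m = 2 ^ k
      · obtain ⟨k, rfl⟩ := h2
        exact eq_zero_of_isUnit (isUnit_two_pow k) (by exact_mod_cast hmv)
      · obtain ⟨p, hp, hpm, hp2⟩ : ∃ p, p.Prime ∧ p ∣ m ∧ p ≠ 2 := by
          by_contra! hc
          exact h2 ⟨_, Nat.eq_prime_pow_of_unique_prime_dvd hm fun {d} hd hdm => hc d hd hdm⟩
        obtain ⟨c, rfl⟩ := hpm
        obtain ⟨s, hs, hsv⟩ := h ⟨p, hp, hp.odd_of_ne_two hp2⟩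
        obtain ⟨a, b, hab⟩ := hs
        have hc0 : c ≠ 0 := fun h => hm (by simp [h])
        refine ih c ?_ hc0 ?_
        · exact (Nat.lt_mul_iff_one_lt_left (Nat.pos_of_ne_zero hc0)).2 hp.one_lt
        · have : (c : ℤ) = (a * c) * s + b * ((p * c : ℕ) : ℤ) := by
            push_cast
            linear_combination (-(c : ℤ)) * hab
          rw [this, add_smul, mul_smul, mul_smul b, hsv, hmv, smul_zero, smul_zero, add_zero]
  refine key n.natAbs (by simpa using hn) ?_
  rcases Int.natAbs_eq n with h | h
  · rw [← h, hv]
  · rw [h, neg_smul, neg_eq_zero] at hv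
    exact hv

/-- Primary decomposition. An element killed by n has nonzero components only at the primes dividing
n, so the family of localizations lands in the direct sum. -/
theorem exists_torsion_map (j : ∀ p, V →+ W p) (hj : ∀ p, IsLocMap (primeTo p.1) (j p)) :
    ∃ τ : Submodule.torsion ZInvTwo V →+ DirectSum OddPrime fun p => Submodule.torsion (ZLoc p.1) (W p),
      (∀ x p, (τ x p : W p) = j p x) ∧ Function.Bijective τ := by
  classical
  have hjt : ∀ (p) (x : Submodule.torsion ZInvTwo V), j p x ∈ Submodule.torsion (ZLoc p.1) (W p) := by
    intro p x
    obtain ⟨n, hn, h⟩ := mem_torsion_iff_int.1 x.2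
    exact mem_torsion_iff_int.2 ⟨n, hn, by rw [← map_zsmul, h, map_zero]⟩
  have hfin : ∀ x : Submodule.torsion ZInvTwo V, ∃ y : DirectSum OddPrime fun p =>
      Submodule.torsion (ZLoc p.1) (W p), ∀ p, (y p : W p) = j p x := by
    intro x
    obtain ⟨n, hn, h⟩ := mem_torsion_iff_int.1 x.2
    have hf : {p : OddPrime | p.1 ∣ n.natAbs}.Finite := by
      have : {m : ℕ | m ∣ n.natAbs}.Finite :=
        (Set.finite_le_nat n.natAbs).subset fun m hm => Nat.le_of_dvd (by simpa [Int.natAbs_pos] using hn) hm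
      exact Set.Finite.preimage (f := Subtype.val) (s := {m : ℕ | m ∣ n.natAbs})
        Subtype.val_injective.injOn this
    refine ⟨DFinsupp.mk hf.toFinset fun p => ⟨j p x, hjt p x⟩, fun p => ?_⟩
    refine (congrArg Subtype.val (DFinsupp.mk_apply (β := fun p : OddPrime =>
      Submodule.torsion (ZLoc p.1) (W p)) (i := p))).trans ?_
    split_ifs with hp
    · rfl
    · have hp' : ¬ (p.1 : ℤ) ∣ n := fun hd => hp (by simpa using Int.natCast_dvd.1 hd)
      have hu := isUnit_of_mem_primeTo ((int_mem_primeTo_or_dvd n).resolve_right hp')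
      exact (eq_zero_of_isUnit hu (by rw [← map_zsmul, h, map_zero])).symm
  choose τ hτ using hfin
  have ext : ∀ {y y' : DirectSum OddPrime fun p => Submodule.torsion (ZLoc p.1) (W p)},
      (∀ p, (y p : W p) = y' p) → y = y' := fun h => DFinsupp.ext fun p => Subtype.ext (h p)
  let τ' : Submodule.torsion ZInvTwo V →+ DirectSum OddPrime fun p =>
      Submodule.torsion (ZLoc p.1) (W p) := AddMonoidHom.mk' τ fun x y => ext fun p => by
    rw [hτ, DirectSum.add_apply, Submodule.coe_add, Submodule.coe_add, map_add, hτ, hτ]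
  refine ⟨τ', hτ, ?_, ?_⟩
  · rw [injective_iff_map_eq_zero]
    intro x hx
    obtain ⟨n, hn, h⟩ := mem_torsion_iff_int.1 x.2
    refine Subtype.ext (eq_zero_of_forall_primeTo hn h fun p => (hj p).ker _ ?_)
    rw [← hτ]
    have : τ x = 0 := hx
    rw [this]
    rfl
  · suffices h : ∀ y, y ∈ τ'.range from h
    intro y
    induction y using DirectSum.induction_on with
    | zero => exact zero_mem _
    | add y z hy hz => exact add_mem hy hz
    | of p y =>
      obtain ⟨n, hn, h⟩ := mem_torsion_iff_int.1 y.2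
      obtain ⟨k, m, hm, rfl⟩ := eq_pow_mul_of_ne_zero p hn
      have hk : (p.1 : ℤ) ^ k • (y : W p) = 0 :=
        eq_zero_of_isUnit (isUnit_of_mem_primeTo hm) (by rw [smul_smul, mul_comm m]; exact h)
      obtain ⟨s, hs, x, hx⟩ := (hj p).surj y
      have h1 : j p ((p.1 : ℤ) ^ k • x) = 0 := by
        rw [map_zsmul, ← hx, smul_comm, hk, smul_zero]
      obtain ⟨s', hs', h2⟩ := (hj p).ker _ h1
      -- The Bézout relation makes (a s')x a preimage: its p-component is a s' s y = y, and as it is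
      -- killed by p^k its components at other primes vanish.
      obtain ⟨a, b, hab⟩ : IsCoprime (s' * s) ((p.1 : ℤ) ^ k) :=
        IsCoprime.pow_right (mul_mem hs' hs)
      have h3 : (p.1 : ℤ) ^ k • ((a * s') • x) = 0 := by
        rw [mul_smul, smul_comm, smul_comm _ s', h2, smul_zero]
      have hp0 : (p.1 : ℤ) ^ k ≠ 0 := pow_ne_zero _ (by exact_mod_cast p.2.1.ne_zero)
      refine ⟨⟨(a * s') • x, mem_torsion_iff_int.2 ⟨_, hp0, h3⟩⟩, ext fun q => ?_⟩
      change (τ _ q : W q) = _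
      rw [hτ]
      by_cases hpq : p = q
      · subst hpq
        rw [DirectSum.of_eq_same]
        change j p ((a * s') • x) = _
        rw [map_zsmul, ← hx, smul_smul]
        have : a * s' * s = 1 - b * (p.1 : ℤ) ^ k := by linear_combination hab
        rw [this, sub_smul, one_smul, mul_smul, hk, smul_zero, sub_zero]
      · rw [DirectSum.of_eq_of_ne _ _ _ (Ne.symm hpq)]
        refine eq_zero_of_isUnit (isUnit_of_mem_primeTo (prime_mem_primeTo hpq k)) ?_
        rw [← map_zsmul]
        exact (congrArg (j q) h3).trans (map_zero _)

theorem nonempty_torsion_iso {M : Fab ⥤ ModuleCat.{u} ZInvTwo}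
    {N : ∀ p : OddPrime, Fab ⥤ ModuleCat.{u} (ZLoc p.1)} (h : ∀ p, Nonempty (localize p M ≅ N p)) :
    Nonempty (torsion M ≅ directSumFunctor fun p => toZInvTwo p (torsion (N p))) := by
  have e := fun p => (h p).some
  let j : ∀ X p, M.obj X →+ (N p).obj X := fun X p =>
    ((e p).hom.app X).hom.toAddMonoidHom.comp (localizeMap p M X)
  have hnat : ∀ {X Y} (f : X ⟶ Y) p x, j Y p ((M.map f).hom x) = ((N p).map f).hom (j X p x) :=
    fun f p x => DFunLike.congr_fun (congrArg ModuleCat.Hom.hom ((e p).hom.naturality f)) (localizeMap p M _ x)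
  have hj : ∀ X p, IsLocMap (primeTo p.1) (j X p) := by
    intro X p
    have hb : Function.Bijective ((e p).hom.app X).hom := ((e p).app X).toLinearEquiv.bijective
    constructor
    · intro w
      obtain ⟨v, rfl⟩ := hb.2 w
      obtain ⟨s, hs, y, hy⟩ := (isLocMap_localizeMap p M X).surj v
      refine ⟨s, hs, y, ?_⟩
      rw [← map_zsmul, hy]
      rfl
    · intro y hy
      exact (isLocMap_localizeMap p M X).ker y ((map_eq_zero_iff _ hb.1).1 hy)
  choose τ hτ hτb using fun X => exists_torsion_map (j X) (hj X)
  refine nonempty_iso_of_bijective (F := torsion M)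
    (G := directSumFunctor fun p => toZInvTwo p (torsion (N p))) τ (fun {X Y} f x => ?_) hτb
  refine DFinsupp.ext fun p => Subtype.ext ((hτ Y _ p).trans ?_)
  refine (hnat f p _).trans ?_
  exact congrArg ((N p).map f).hom (hτ X x p).symm

end Torsion

/-! ### Cubic modules with isomorphic localizations are isomorphic -/

section Genus

theorem exists_factor_of_injective {R X T M : Type*} [Ring R] [AddCommGroup X] [Module R X]
    [AddCommGroup T] [Module R T] [AddCommGroup M] [Module R M] (i : T →ₗ[R] M)
    (hi : Function.Injective i) (g : X →ₗ[R] M) (h : ∀ x, ∃ t, i t = g x) :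
    ∃ g' : X →ₗ[R] T, ∀ x, i (g' x) = g x := by
  refine ⟨(LinearEquiv.ofInjective i hi).symm.toLinearMap.comp (g.codRestrict _ h), fun x => ?_⟩
  exact congrArg Subtype.val ((LinearEquiv.ofInjective i hi).apply_symm_apply _)

theorem exists_complement {A : Subring ℚ} {M : Type u} [AddCommGroup M] [Module A M]
    [Module MatRing M] [Module.Finite A M] (r : M →ₗ[MatRing] M) (hr : ∀ x, r (r x) = r x) :
    ∃ (K : Type u) (_ : AddCommGroup K) (_ : Module A K) (_ : Module MatRing K)
      (_ : Module.Finite A K) (i : K →ₗ[MatRing] M) (π : M →ₗ[MatRing] K),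
      (∀ k, π (i k) = k) ∧ ∀ x, i (π x) = x - r x := by
  let K := LinearMap.ker r
  let _ : SMul A K := ⟨fun a k => ⟨a • (k : M), by
    rw [LinearMap.mem_ker]
    refine (map_subring_smul r.toAddMonoidHom a (k : M)).trans ?_
    exact (congrArg (a • ·) (LinearMap.mem_ker.1 k.2)).trans (smul_zero a)⟩⟩
  let _ : Module A K := Function.Injective.module A K.subtype.toAddMonoidHom
    Subtype.val_injective fun _ _ => rfl
  have hfin : Module.Finite A K :=
    Module.Finite.of_injective (linearOfSubring A K.subtype.toAddMonoidHom) Subtype.val_injective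
  let π : M →ₗ[MatRing] K := (LinearMap.id - r).codRestrict K fun x => by
    rw [LinearMap.mem_ker, LinearMap.sub_apply, LinearMap.id_apply, map_sub, hr, sub_self]
  refine ⟨K, inferInstance, inferInstance, inferInstance, hfin, K.subtype, π, fun k => ?_,
    fun x => rfl⟩
  refine Subtype.ext ?_
  change (k : M) - r k = k
  rw [LinearMap.mem_ker.1 k.2, sub_zero]

theorem mem_primeTo_three {n : ℤ} : n ∈ primeTo 3 ↔ ¬ 3 ∣ n := by
  rw [← Int.prime_three.coprime_iff_not_dvd]
  exact isCoprime_comm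

/-- Inverting 3 identifies the torsion of M prime to 3 with the whole torsion of the localization,
where a retraction exists because 6 is invertible. That retraction is pulled back to M. -/
theorem exists_primeToThree_retraction {M : Type u} [AddCommGroup M] [Module ZInvTwo M]
    [Module MatRing M] [Module.Finite ZInvTwo M] (hM : IsCubicModule M) :
    ∃ r : M →ₗ[MatRing] M, (∀ x, ∃ n ∈ primeTo 3, n • r x = 0) ∧
      ∀ x, ∀ n ∈ primeTo 3, n • x = 0 → r x = x := by
  have hu : ∀ s ∈ Submonoid.powers (3 : ℤ), IsUnit (s : ZInvSix) := by
    rintro _ ⟨k, rfl⟩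
    exact isUnit_three_pow k
  have hs : ∀ q : ZInvSix, ∃ s ∈ Submonoid.powers (3 : ℤ), (s : ℚ) * q.1 ∈ ZInvTwo := fun q => by
    obtain ⟨k, hk⟩ := exists_three_pow_mul_mem q
    exact ⟨3 ^ k, ⟨k, rfl⟩, by exact_mod_cast hk⟩
  obtain ⟨W, _, _, _, _, l, cW, hl, -⟩ := exists_localization zInvTwo_le_zInvSix
    (Submonoid.powers (3 : ℤ)) hu hs M hM
  obtain ⟨r, hr, hr'⟩ := exists_torsion_matRetraction isUnit_six cW
  let T : Submodule MatRing M :=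
    { carrier := {x | ∃ n ∈ primeTo 3, n • x = 0}
      zero_mem' := ⟨1, one_mem _, smul_zero _⟩
      add_mem' := by
        rintro x y ⟨n, hn, hx⟩ ⟨m, hm, hy⟩
        refine ⟨n * m, mul_mem hn hm, ?_⟩
        rw [smul_add, mul_smul, mul_smul, smul_comm n m x, hx, hy, smul_zero, smul_zero, add_zero]
      smul_mem' := by
        rintro t x ⟨n, hn, hx⟩
        exact ⟨n, hn, by rw [smul_comm, hx, smul_zero]⟩ }
  have hcop : ∀ {n : ℤ}, n ∈ primeTo 3 → ∀ k : ℕ, IsCoprime n (3 ^ k) := fun hn k => hn.pow_right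
  have hinj : Function.Injective (l.comp T.subtype) := by
    rw [injective_iff_map_eq_zero]
    rintro ⟨x, n, hn, hx⟩ h
    obtain ⟨_, ⟨k, rfl⟩, hk⟩ := hl.ker x h
    obtain ⟨a, b, hab⟩ := hcop hn k
    refine Subtype.ext ?_
    change x = 0
    rw [← one_smul ℤ x, ← hab, add_smul, mul_smul, hx, mul_smul]
    exact (congrArg (fun y => a • (0 : M) + b • y) hk).trans (by simp)
  obtain ⟨r', hr₂⟩ := exists_factor_of_injective (l.comp T.subtype) hinj (r.comp l) (fun x => by
    obtain ⟨n, hn, hx⟩ := mem_torsion_iff_int.1 (hr (l x))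
    have hfin : FiniteMultiplicity (3 : ℤ) n := Int.finiteMultiplicity_iff.2 ⟨by decide, hn⟩
    obtain ⟨n', hN, hn'⟩ := hfin.exists_eq_pow_mul_and_not_dvd
    rw [hN, mul_smul] at hx
    have hx' : n' • r (l x) = 0 := eq_zero_of_isUnit (isUnit_three_pow _) hx
    obtain ⟨_, ⟨a, rfl⟩, m, hm⟩ := hl.surj (r (l x))
    have h1 : l (n' • m) = 0 := by rw [map_zsmul, ← hm, smul_comm, hx', smul_zero]
    obtain ⟨_, ⟨b, rfl⟩, hb⟩ := hl.ker _ h1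
    obtain ⟨α, β, hαβ⟩ := hcop (mem_primeTo_three.2 hn') (b + a)
    refine ⟨⟨(β * 3 ^ b) • m, n', mem_primeTo_three.2 hn', ?_⟩, ?_⟩
    · rw [mul_smul, smul_comm, smul_comm n' ((3 : ℤ) ^ b)]
      exact (congrArg (β • ·) hb).trans (smul_zero _)
    · change l ((β * 3 ^ b) • m) = r (l x)
      have h2 : l m = (3 : ℤ) ^ a • r (l x) := hm.symm
      rw [map_zsmul, h2, smul_smul]
      have : β * 3 ^ b * 3 ^ a = 1 - α * n' := by rw [pow_add] at hαβ; linear_combination hαβ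
      rw [this, sub_smul, mul_smul, hx', smul_zero, sub_zero, one_smul])
  refine ⟨T.subtype.comp r', fun x => (r' x).2, fun x n hn hx => ?_⟩
  have hx' : r (l x) = l x := hr' _ (mem_torsion_iff_int.2 ⟨n, by
    rintro rfl
    exact mem_primeTo_three.1 hn (dvd_zero _), by rw [← map_zsmul, hx, map_zero]⟩)
  have h3 : r' x = ⟨x, n, hn, hx⟩ := hinj ((hr₂ x).trans hx')
  exact congrArg Subtype.val h3

variable {M N T T' W : Type u} [AddCommGroup M] [Module ZInvTwo M] [Module MatRing M]
  [AddCommGroup N] [Module ZInvTwo N] [Module MatRing N] [AddCommGroup T] [Module MatRing T]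
  [AddCommGroup T'] [Module MatRing T'] [AddCommGroup W] [Module ZInvTwo W] [Module MatRing W]

/-- The summands of torsion prime to 3 are matched by the given isomorphism τ of torsion parts, and
the complements by approximation. Here W is a common localization at 3 of M and N. -/
theorem exists_surjective_of_locMap [Module.Finite ZInvTwo M] [Module.Finite ZInvTwo N]
    (hM : IsCubicModule M) (hN : IsCubicModule N) (l : M →ₗ[MatRing] W) (l' : N →ₗ[MatRing] W)
    (hl : IsLocMap (primeTo 3) l) (hl' : IsLocMap (primeTo 3) l')
    (hW : ∀ s ∈ primeTo 3, ∀ w : W, s • w = 0 → w = 0)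
    (i : T →ₗ[MatRing] M) (hi : Function.Injective i)
    (hiT : ∀ x, (∃ n : ℤ, n ≠ 0 ∧ n • x = 0) → ∃ t, i t = x)
    (i' : T' →ₗ[MatRing] N)
    (hiT' : ∀ x, (∃ n : ℤ, n ≠ 0 ∧ n • x = 0) → ∃ t, i' t = x)
    (hi' : Function.Injective i') (τ : T ≃ₗ[MatRing] T') :
    ∃ θ : M →ₗ[MatRing] N, Function.Surjective θ := by
  have hne : ∀ {n : ℤ}, n ∈ primeTo 3 → n ≠ 0 := by
    rintro n hn rfl
    exact mem_primeTo_three.1 hn (dvd_zero _)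
  obtain ⟨r, hr, hr'⟩ := exists_primeToThree_retraction hM
  obtain ⟨ρ, hρ, hρ'⟩ := exists_primeToThree_retraction hN
  have hrr : ∀ x, r (r x) = r x := fun x => by
    obtain ⟨n, hn, h⟩ := hr x
    exact hr' _ n hn h
  have hρρ : ∀ x, ρ (ρ x) = ρ x := fun x => by
    obtain ⟨n, hn, h⟩ := hρ x
    exact hρ' _ n hn h
  obtain ⟨K, _, _, _, _, ι, π, hπ, hιπ⟩ := exists_complement (A := ZInvTwo) r hrr
  obtain ⟨K', _, _, _, _, ι', π', hπ', hιπ'⟩ := exists_complement (A := ZInvTwo) ρ hρρ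
  have hι : Function.Injective ι := Function.LeftInverse.injective hπ
  have hι' : Function.Injective ι' := Function.LeftInverse.injective hπ'
  have hrι : ∀ k, r (ι k) = 0 := fun k => by
    have := hιπ (ι k)
    rwa [hπ, eq_comm, sub_eq_self] at this
  have tK : ∀ (n : ℤ) (k : K), ¬ 3 ∣ n → n • k = 0 → k = 0 := fun n k hn hk => hι <| by
    rw [map_zero, ← hrι k, hr' _ n (mem_primeTo_three.2 hn) (by rw [← map_zsmul, hk, map_zero])]
  have hρι' : ∀ k, ρ (ι' k) = 0 := fun k => by
    have := hιπ' (ι' k)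
    rwa [hπ', eq_comm, sub_eq_self] at this
  have tK' : ∀ (n : ℤ) (k : K'), ¬ 3 ∣ n → n • k = 0 → k = 0 := fun n k hn hk => hι' <| by
    rw [map_zero, ← hρι' k, hρ' _ n (mem_primeTo_three.2 hn) (by rw [← map_zsmul, hk, map_zero])]
  have hlr : ∀ x, ρ x = x → l' x = 0 := fun x hx => by
    obtain ⟨n, hn, h⟩ := hρ x
    rw [hx] at h
    exact hW n hn _ (by rw [← map_zsmul, h, map_zero])
  obtain ⟨s, hs, φ, hφ⟩ := hl'.exists_lift (A := ZInvTwo) l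
  -- The lift φ of the localization map, restricted to the complements, is injective with cokernel
  -- prime to 3, since ρ retracts onto the torsion prime to 3, which l' kills.
  obtain ⟨θ, hθ⟩ := exists_surjective_of_injective (hM.of_injective ι hι) (hN.of_injective ι' hι')
    tK tK' (π'.comp (φ.comp ι)) (by
      rw [injective_iff_map_eq_zero]
      intro k hk
      have h1 : ρ (φ (ι k)) = φ (ι k) := by
        have := hιπ' (φ (ι k))
        have hk' : π' (φ (ι k)) = 0 := hk
        rw [hk', map_zero, eq_comm, sub_eq_zero] at this
        exact this.symm
      have h2 := hlr _ h1
      rw [hφ] at h2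
      obtain ⟨n, hn, h3⟩ := hl.ker _ (hW s hs _ h2)
      rw [← map_zsmul, map_eq_zero_iff _ hι] at h3
      exact tK n k (mem_primeTo_three.1 hn) h3) (fun y => by
      obtain ⟨n, hn, x, hx⟩ := hl.surj (l' (ι' y))
      have h1 : l' (φ x - (s * n) • ι' y) = 0 := by
        rw [map_sub, hφ, ← hx, map_zsmul, mul_smul, sub_self]
      obtain ⟨m, hm, h2⟩ := hl'.ker _ h1
      have h3 := hρ' _ m hm h2
      obtain ⟨c, hc, h4⟩ := hr x
      have h5 : c • φ (r x) = 0 := by rw [← map_zsmul, h4, map_zero]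
      have h6 := hρ' _ c hc h5
      refine ⟨s * n, mem_primeTo_three.1 (mul_mem hs hn), π x, hι' ?_⟩
      change ι' (π' (φ (ι (π x)))) = _
      rw [hιπ', hιπ, map_zsmul]
      rw [map_sub, map_zsmul, hρι', smul_zero, sub_zero] at h3
      rw [map_sub φ, map_sub ρ, h6, h3]
      abel)
  obtain ⟨r', hr₂⟩ := exists_factor_of_injective i hi r fun x => by
    obtain ⟨n, hn, h⟩ := hr x
    exact hiT _ ⟨n, hne hn, h⟩
  refine ⟨ι'.comp (θ.comp π) + i'.comp (τ.toLinearMap.comp r'), fun y => ?_⟩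
  obtain ⟨k, hk⟩ := hθ (π' y)
  obtain ⟨n, hn, h⟩ := hρ y
  obtain ⟨t', ht'⟩ := hiT' _ ⟨n, hne hn, h⟩
  obtain ⟨t, rfl⟩ := τ.surjective t'
  have h1 : r (i t) = i t := by
    refine hr' _ n hn ?_
    rw [← map_zsmul, map_eq_zero_iff _ hi, ← map_eq_zero_iff _ τ.injective, map_zsmul,
      ← map_eq_zero_iff _ hi', map_zsmul, ht', h]
  have h2 : r' (i t) = t := hi ((hr₂ _).trans h1)
  have h3 : r' (ι k) = 0 := hi ((hr₂ _).trans (by rw [hrι, map_zero]))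
  have h4 : π (i t) = 0 := hι (by rw [hιπ, h1, sub_self, map_zero])
  refine ⟨ι k + i t, ?_⟩
  change ι' (θ (π (ι k + i t))) + i' (τ (r' (ι k + i t))) = y
  rw [map_add π, map_add r', hπ, h4, add_zero, h3, h2, zero_add, hk, hιπ', ht']
  abel

/-- A surjective endomorphism of a Noetherian module is injective. -/
theorem nonempty_equiv_of_surjective {A : Subring ℚ} {M N : Type*} [AddCommGroup M] [Module A M]
    [Module MatRing M] [AddCommGroup N] [Module A N] [Module MatRing N] [Module.Finite A M]
    (θ : M →ₗ[MatRing] N) (η : N →ₗ[MatRing] M) (hθ : Function.Surjective θ)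
    (hη : Function.Surjective η) : Nonempty (M ≃ₗ[MatRing] N) := by
  have h := IsNoetherian.injective_of_surjective_endomorphism
    (linearOfSubring A (η.comp θ).toAddMonoidHom) (hη.comp hθ)
  exact ⟨LinearEquiv.ofBijective θ ⟨Function.Injective.of_comp (f := η) h, hθ⟩⟩

/-- The prime `3`. -/
def oddPrimeThree : OddPrime := ⟨3, Nat.prime_three, by decide⟩

theorem exists_surjective_value {M N : Fab ⥤ ModuleCat.{u} ZInvTwo} (hM : IsCubic M)
    (hN : IsCubic N) (h : ∀ p : OddPrime, Nonempty (localize p M ≅ localize p N)) :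
    ∃ θ : M.obj (freeFab 3) →ₗ[MatRing] N.obj (freeFab 3), Function.Surjective θ := by
  obtain ⟨e⟩ := nonempty_torsion_iso h
  -- Both torsion parts are the direct sum of the torsion parts of the localizations of N.
  obtain ⟨e'⟩ := nonempty_torsion_iso (M := N) (N := fun p => localize p N) fun p => ⟨Iso.refl _⟩
  let τ := valueEquiv (e ≪≫ e'.symm)
  let ψ := valueEquiv (h oddPrimeThree).some
  let l := valueMap (F := M) (G := localize oddPrimeThree M)
    (localizeMap oddPrimeThree M (freeFab 3)) fun f x => rfl
  let l' := valueMap (F := N) (G := localize oddPrimeThree N)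
    (localizeMap oddPrimeThree N (freeFab 3)) fun f x => rfl
  let i := fun M : Fab ⥤ ModuleCat.{u} ZInvTwo => valueMap (F := torsion M) (G := M)
    (Submodule.torsion ZInvTwo (M.obj (freeFab 3))).subtype.toAddMonoidHom fun f x => rfl
  have hi : ∀ M, Function.Injective (i M) := fun M => Subtype.val_injective
  have hiT : ∀ M (x : M.obj (freeFab 3)), (∃ n : ℤ, n ≠ 0 ∧ n • x = 0) → ∃ t, i M t = x :=
    fun M x hx => ⟨⟨x, mem_torsion_iff_int.2 hx⟩, rfl⟩
  have := hM.finite (freeFab 3)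
  have := hN.finite (freeFab 3)
  let : Module ZInvTwo ((localize oddPrimeThree N).obj (freeFab 3)) :=
    Module.compHom _ (zInvTwoToZLoc oddPrimeThree)
  have hl := isLocMap_localizeMap oddPrimeThree M (freeFab 3)
  refine exists_surjective_of_locMap hM.isCubicFunctor.isCubicModule
    hN.isCubicFunctor.isCubicModule (ψ.toLinearMap.comp l) l' ⟨fun w => ?_, fun y hy => ?_⟩
    (isLocMap_localizeMap oddPrimeThree N (freeFab 3))
    (fun s hs w hw => eq_zero_of_isUnit (isUnit_of_mem_primeTo (p := oddPrimeThree) hs) hw)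
    (i M) (hi M) (hiT M) (i N) (hiT N) (hi N) τ
  · obtain ⟨s, hs, y, hy⟩ := hl.surj (ψ.symm w)
    refine ⟨s, hs, y, ?_⟩
    rw [← map_zsmul, LinearEquiv.symm_apply_eq] at hy
    exact hy
  · exact hl.ker y ((map_eq_zero_iff _ ψ.injective).1 hy)

theorem nonempty_iso_of_localize {M N : Fab ⥤ ModuleCat.{u} ZInvTwo} (hM : IsCubic M)
    (hN : IsCubic N) (h : ∀ p : OddPrime, Nonempty (localize p M ≅ localize p N)) :
    Nonempty (M ≅ N) := by
  obtain ⟨θ, hθ⟩ := exists_surjective_value hM hN h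
  obtain ⟨η, hη⟩ := exists_surjective_value hN hM fun p => ⟨(h p).some.symm⟩
  have := hM.finite (freeFab 3)
  obtain ⟨Φ⟩ := nonempty_equiv_of_surjective (A := ZInvTwo) θ η hθ hη
  exact nonempty_iso_of_equiv hM.isCubicFunctor hN.isCubicFunctor Φ

end Genus

/-! ### Lattices with isomorphic rationalizations -/

section Lattices

/-- The nonzero integers. -/
def nonzeroInt : Submonoid ℤ where
  carrier := {n | n ≠ 0}
  one_mem' := one_ne_zero
  mul_mem' := mul_ne_zero

theorem mem_nonzeroInt {n : ℤ} : n ∈ nonzeroInt ↔ n ≠ 0 := Iff.rfl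

theorem primeTo_le_nonzeroInt (p : OddPrime) : primeTo p.1 ≤ nonzeroInt := by
  rintro n hn (rfl : n = 0)
  exact p.2.1.ne_one (by simpa using Int.isCoprime_iff_nat_coprime.1 hn)

theorem IsLocMap.comp {U V W : Type*} [AddCommGroup U] [AddCommGroup V] [AddCommGroup W]
    {S T : Submonoid ℤ} (hST : S ≤ T) {l : V → W} (hl : IsLocMap T l) {m : U →+ V}
    (hm : IsLocMap S m) (hz : ∀ (n : ℤ) v, l (n • v) = n • l v) : IsLocMap T (fun u => l (m u)) where
  surj w := by
    obtain ⟨s, hs, v, hv⟩ := hl.surj w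
    obtain ⟨s', hs', u, hu⟩ := hm.surj v
    exact ⟨s' * s, mul_mem (hST hs') hs, u, by rw [mul_smul, hv, ← hz, hu]⟩
  ker u hu := by
    obtain ⟨s, hs, h⟩ := hl.ker _ hu
    rw [← map_zsmul] at h
    obtain ⟨s', hs', h'⟩ := hm.ker _ h
    exact ⟨s' * s, mul_mem (hST hs') hs, by rw [mul_smul, h']⟩

variable {A : Subring ℚ} {W W' V : Type u} [AddCommGroup W] [Module A W] [Module MatRing W]
  [AddCommGroup W'] [Module A W'] [Module MatRing W'] [AddCommGroup V] [Module ℚ V]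
  [Module MatRing V]

omit [Module MatRing V] in
theorem rat_torsion_free {n : ℤ} (hn : n ≠ 0) {v : V} (h : n • v = 0) : v = 0 :=
  eq_zero_of_isUnit (A := ℚ) (by simpa using hn) h

/-- Two lattices in one rational module embed into each other after multiplication by an integer,
which suffices when 6 is invertible. -/
theorem nonempty_equiv_of_locMap (hA : IsUnit (6 : A)) (hW : IsCubicModule W)
    (hW' : IsCubicModule W') [Module.Finite A W] [Module.Finite A W']
    (c : W →ₗ[MatRing] V) (d : W' →ₗ[MatRing] V) (hc : IsLocMap nonzeroInt c)
    (hd : IsLocMap nonzeroInt d) (ic : Function.Injective c) (id : Function.Injective d) :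
    Nonempty (W ≃ₗ[MatRing] W') := by
  let : Module A V := Module.compHom V A.subtype
  have tV := fun (n : ℤ) (v : V) (hn : n ≠ 0) (h : n • v = 0) => rat_torsion_free hn h
  obtain ⟨s, hs, Φ, hΦ⟩ := hd.exists_lift (A := A) c
  obtain ⟨t, ht, Ψ, hΨ⟩ := hc.exists_lift (A := A) d
  refine nonempty_equiv_of_injective hA hW hW'
    (fun n w hn h => ic ?_) (fun n w hn h => id ?_) Φ Ψ ?_ ?_
  · rw [map_zero]
    exact tV n _ hn (by rw [← map_zsmul, h, map_zero])
  · rw [map_zero]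
    exact tV n _ hn (by rw [← map_zsmul, h, map_zero])
  · rw [injective_iff_map_eq_zero]
    refine fun w hw => (map_eq_zero_iff _ ic).1 (tV s _ hs ?_)
    rw [← hΦ, hw, map_zero]
  · rw [injective_iff_map_eq_zero]
    refine fun w hw => (map_eq_zero_iff _ id).1 (tV t _ ht ?_)
    rw [← hΨ, hw, map_zero]

theorem isUnit_six_zLoc {p : OddPrime} (hp : p ≠ oddPrimeThree) : IsUnit (6 : ZLoc p.1) := by
  have h3 : (3 : ℤ) ∈ primeTo p.1 := by
    simpa [oddPrimeThree] using prime_mem_primeTo (Ne.symm hp) 1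
  have h2 : (2 : ℤ) ∈ primeTo p.1 :=
    Int.isCoprime_iff_nat_coprime.2 (Nat.coprime_two_left.2 p.2.2)
  simpa using isUnit_of_mem_primeTo (mul_mem h2 h3)

/-- For p ≠ 3 the localization of L is torsion free, since L has only 3-primary torsion, and so is
isomorphic to a complement of the torsion of Y. The two conclusions say that L ⊕ tY → Y is a
localization at p. -/
theorem exists_lattice_map {p : OddPrime} (hp : p ≠ oddPrimeThree) {L Y V : Type u}
    [AddCommGroup L] [Module ZInvTwo L] [Module MatRing L] [Module.Finite ZInvTwo L]
    (hL : IsCubicModule L)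
    (tL : ∀ (n : ℤ) (x : L), n ≠ 0 → n • x = 0 → ∃ k : ℕ, (3 : ℤ) ^ k • x = 0)
    [AddCommGroup Y] [Module (ZLoc p.1) Y] [Module MatRing Y] [Module.Finite (ZLoc p.1) Y]
    (hY : IsCubicModule Y) [AddCommGroup V] [Module ℚ V] [Module MatRing V]
    (c : L →ₗ[MatRing] V) (d : Y →ₗ[MatRing] V) (hc : IsLocMap nonzeroInt c)
    (hd : IsLocMap nonzeroInt d) :
    ∃ μ : L →ₗ[MatRing] Y,
      (∀ y, ∃ s ∈ primeTo p.1, ∃ m, ∃ t ∈ Submodule.torsion (ZLoc p.1) Y, s • y = μ m + t) ∧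
      ∀ m, ∀ t ∈ Submodule.torsion (ZLoc p.1) Y, μ m + t = 0 →
        t = 0 ∧ ∃ s ∈ primeTo p.1, s • m = 0 := by
  have h6 := isUnit_six_zLoc hp
  obtain ⟨r, hr, hr'⟩ := exists_torsion_matRetraction h6 hY
  obtain ⟨K, _, _, _, _, i, π, hπ, hiπ⟩ := exists_complement (A := ZLoc p.1) r fun x => hr' _ (hr x)
  have hi : Function.Injective i := Function.LeftInverse.injective hπ
  have hri : ∀ k, r (i k) = 0 := fun k => by
    have := hiπ (i k)
    rwa [hπ, eq_comm, sub_eq_self] at this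
  have hdt : ∀ y ∈ Submodule.torsion (ZLoc p.1) Y, d y = 0 := fun y hy => by
    obtain ⟨n, hn, h⟩ := mem_torsion_iff_int.1 hy
    exact rat_torsion_free hn (by rw [← map_zsmul, h, map_zero])
  obtain ⟨W, _, _, _, _, l, cW, hl, lift⟩ := exists_localization (zInvTwo_le_zLoc p)
    (primeTo p.1) (fun s hs => isUnit_of_mem_primeTo hs) (fun q => by
      obtain ⟨s, hs, n, h⟩ := exists_primeTo_smul_eq q
      exact ⟨s, hs, by rw [h]; exact intCast_mem _ n⟩) L hL
  let : Module (ZLoc p.1) V := Module.compHom V (ZLoc p.1).subtype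
  obtain ⟨G, hG⟩ := lift c
  have iG : Function.Injective G := by
    rw [injective_iff_map_eq_zero]
    intro w hw
    obtain ⟨s, hs, m, h⟩ := hl.surj w
    have h1 : c m = 0 := by rw [← hG, ← h, map_zsmul, hw, smul_zero]
    obtain ⟨n, hn, h2⟩ := hc.ker _ h1
    obtain ⟨k, h3⟩ := tL n m hn h2
    refine eq_zero_of_isUnit (isUnit_of_mem_primeTo (p := p)
      (mul_mem (prime_mem_primeTo (Ne.symm hp) k) hs)) ?_
    rw [mul_smul, h, ← map_zsmul]
    exact (congrArg l h3).trans (map_zero l)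
  have hG' : IsLocMap nonzeroInt G := by
    refine ⟨fun v => ?_, fun w hw => ⟨1, one_mem _, ?_⟩⟩
    · obtain ⟨n, hn, m, h⟩ := hc.surj v
      exact ⟨n, hn, l m, by rw [h, hG]⟩
    · rw [(map_eq_zero_iff _ iG).1 hw, smul_zero]
  have id : Function.Injective (d.comp i) := by
    rw [injective_iff_map_eq_zero]
    intro k hk
    obtain ⟨n, hn, h⟩ := hd.ker _ hk
    have h1 := hr' _ (mem_torsion_iff_int.2 ⟨n, hn, h⟩)
    rw [hri] at h1
    exact (map_eq_zero_iff _ hi).1 h1.symm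
  have hd' : IsLocMap nonzeroInt (d.comp i) := by
    refine ⟨fun v => ?_, fun w hw => ⟨1, one_mem _, ?_⟩⟩
    · obtain ⟨n, hn, y, h⟩ := hd.surj v
      refine ⟨n, hn, π y, ?_⟩
      rw [LinearMap.comp_apply, hiπ, map_sub, hdt _ (hr y), sub_zero, h]
    · rw [(map_eq_zero_iff _ id).1 hw, smul_zero]
  obtain ⟨κ⟩ := nonempty_equiv_of_locMap h6 cW (hY.of_injective i hi) G (d.comp i) hG' hd' iG id
  refine ⟨i.comp (κ.toLinearMap.comp l), fun y => ?_, fun m t ht h => ?_⟩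
  · obtain ⟨s, hs, m, h⟩ := hl.surj (κ.symm (π y))
    refine ⟨s, hs, m, s • r y, zsmul_mem (hr y) s, ?_⟩
    change _ = i (κ (l m)) + _
    rw [← h, map_zsmul, map_zsmul, LinearEquiv.apply_symm_apply, hiπ, ← smul_add, sub_add_cancel]
  · change i (κ (l m)) + t = 0 at h
    have h1 := congrArg r h
    rw [map_add, hri, zero_add, hr' t ht, map_zero] at h1
    rw [h1, add_zero, map_eq_zero_iff _ hi, map_eq_zero_iff _ κ.injective] at h
    exact ⟨h1, hl.ker m h⟩

end Lattices

/-! ### Constructions of cubic functors -/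

section Constructions

variable {R : Type} [CommRing R]

theorem IsCubic.of_injective {ι : Type*} {S : ι → Type} [∀ i, CommRing (S i)]
    {F : Fab ⥤ ModuleCat.{u} R} {G : ∀ i, Fab ⥤ ModuleCat.{u} (S i)} (hG : ∀ i, IsCubic (G i))
    (j : ∀ i X, F.obj X →+ (G i).obj X)
    (hj : ∀ i {X Y} (f : X ⟶ Y) x, j i Y ((F.map f).hom x) = ((G i).map f).hom (j i X x))
    (hinj : ∀ X x, (∀ i, j i X x = 0) → x = 0) (hfin : ∀ X, Module.Finite R (F.obj X)) :
    IsCubic F where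
  map_zero X Y := by
    ext x
    refine hinj _ _ fun i => ?_
    rw [hj, (hG i).map_zero]
    rfl
  finite := hfin
  degree_le m hm A := crossEffect_eq_bot_of_injective j hj hinj A fun i => (hG i).degree_le m hm A

theorem isCubic_directSumFunctor {ι : Type} [Finite ι] {F : ι → Fab ⥤ ModuleCat.{u} R}
    (hF : ∀ i, IsCubic (F i)) : IsCubic (directSumFunctor F) := by
  have := Fintype.ofFinite ι
  refine IsCubic.of_injective hF
    (fun i X => (DirectSum.component R ι (fun i => (F i).obj X) i).toAddMonoidHom)
    (fun i X Y f x => ?_) (fun X x h => DFinsupp.ext h) fun X => ?_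
  · rfl
  · have := fun i => (hF i).finite X
    exact inferInstanceAs (Module.Finite R (DirectSum ι fun i => (F i).obj X))

/-- The subfunctor given by a family of submodules. -/
def subfunctor (F : Fab ⥤ ModuleCat.{u} R) (Q : ∀ X, Submodule R (F.obj X))
    (hQ : ∀ {X Y : Fab} (f : X ⟶ Y), ∀ x ∈ Q X, (F.map f).hom x ∈ Q Y) : Fab ⥤ ModuleCat.{u} R where
  obj X := ModuleCat.of R (Q X)
  map f := ModuleCat.ofHom ((F.map f).hom.restrict (hQ f))
  map_id A := by
    refine ModuleCat.hom_ext (LinearMap.ext fun x => Subtype.ext ?_)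
    change (F.map (𝟙 A)).hom x.1 = x.1
    rw [F.map_id]
    rfl
  map_comp f g := by
    refine ModuleCat.hom_ext (LinearMap.ext fun x => Subtype.ext ?_)
    change (F.map (f ≫ g)).hom x.1 = (F.map g).hom ((F.map f).hom x.1)
    rw [F.map_comp]
    rfl

theorem exists_finset_closure_hom (X Y : Fab) :
    ∃ S : Finset (X ⟶ Y), 0 ∈ S ∧ AddSubmonoid.closure (S : Set (X ⟶ Y)) = ⊤ := by
  classical
  have := X.property.1
  have := X.property.2
  have := Y.property.1
  have := Y.property.2
  let g : (X ⟶ Y) →+ (X.obj →ₗ[ℤ] Y.obj) :=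
    AddMonoidHom.mk' (fun f => f.hom.hom.toIntLinearMap) fun _ _ => rfl
  have hg : Function.Injective g := fun f f' h => fabHom_ext fun x => LinearMap.congr_fun h x
  have h1 : Module.Finite ℤ (X ⟶ Y) := Module.Finite.of_injective g.toIntLinearMap hg
  have h2 : AddMonoid.FG (X ⟶ Y) :=
    AddGroup.fg_iff_addMonoid_fg.1 (Module.Finite.iff_addGroup_fg.1 h1)
  obtain ⟨S, hS⟩ := h2.1
  refine ⟨insert 0 S, Finset.mem_insert_self _ _, top_unique ?_⟩
  rw [← hS]
  exact AddSubmonoid.closure_mono (by simp)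

/-- L is the subfunctor over ℤ[1/2] generated by finitely many generators of N(ℤ³). -/
theorem exists_lattice_subfunctor {p : OddPrime} {N : Fab ⥤ ModuleCat.{u} (ZLoc p.1)}
    (hN : IsCubic N) : ∃ L : Fab ⥤ ModuleCat.{u} ZInvTwo, IsCubic L ∧
      ∃ i : L.obj (freeFab 3) →ₗ[MatRing] N.obj (freeFab 3),
        Function.Injective i ∧ IsLocMap (primeTo p.1) i := by
  classical
  have hN' := hN.isCubicFunctor
  obtain ⟨E, hE⟩ := (hN.finite (freeFab 3)).fg_top
  let F := toZInvTwo p N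
  let Q : ∀ X, Submodule ZInvTwo (F.obj X) := fun X =>
    Submodule.span ZInvTwo {y | ∃ (f : freeFab 3 ⟶ X), ∃ x ∈ E, (N.map f).hom x = y}
  have hQ : ∀ {X Y : Fab} (f : X ⟶ Y), ∀ x ∈ Q X, (F.map f).hom x ∈ Q Y := by
    intro X Y f x hx
    have : Q X ≤ (Q Y).comap (F.map f).hom := by
      refine Submodule.span_le.2 ?_
      rintro _ ⟨g, x, hx, rfl⟩
      refine Submodule.subset_span ⟨g ≫ f, x, hx, ?_⟩
      rw [N.map_comp]
      rfl
    exact this hx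
  have hfin : ∀ X, Module.Finite ZInvTwo (Q X) := by
    intro X
    obtain ⟨S, h0, hS⟩ := exists_finset_closure_hom (freeFab 3) X
    let B : Set (F.obj X) := (fun a : ((freeFab 3 ⟶ X) × (freeFab 3 ⟶ X)) × ((freeFab 3 ⟶ X) ×
      N.obj (freeFab 3)) => (N.map (a.1.1 + a.1.2 + a.2.1)).hom a.2.2) '' ((S ×ˢ S) ×ˢ (S ×ˢ E))
    have hB : B.Finite := ((S ×ˢ S) ×ˢ (S ×ˢ E)).finite_toSet.image _ |>.subset
      (Set.image_mono (by simp))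
    -- Cubicity yields finite generation: only sums of three morphisms from a finite generating set
    -- of Hom(ℤ³, X) are needed.
    have : Q X = Submodule.span ZInvTwo B := by
      refine le_antisymm (Submodule.span_le.2 ?_) (Submodule.span_mono ?_)
      · rintro _ ⟨f, x, hx, rfl⟩
        have hf : f ∈ AddSubmonoid.closure (S : Set (freeFab 3 ⟶ X)) := by
          rw [hS]
          trivial
        have h1 := (hN' _ X x).mem_closure h0 hf
        refine (AddSubgroup.closure_le (Submodule.span ZInvTwo B).toAddSubgroup).2 ?_ h1
        rintro _ ⟨a, ha, b, hb, c, hc, rfl⟩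
        exact Submodule.subset_span ⟨((a, b), (c, x)), ⟨⟨ha, hb⟩, hc, hx⟩, rfl⟩
      · rintro _ ⟨⟨⟨a, b⟩, c, x⟩, ⟨-, -, hx⟩, rfl⟩
        exact ⟨_, x, hx, rfl⟩
    rw [this]
    exact Module.Finite.span_of_finite _ hB
  let L := subfunctor F Q hQ
  let j : ∀ X, L.obj X →+ N.obj X := fun X => (Q X).subtype.toAddMonoidHom
  refine ⟨L, IsCubic.of_injective (ι := Unit) (fun _ => hN) (fun _ => j) (fun _ _ _ f x => rfl)
    (fun X x h => Subtype.ext (h ())) hfin, valueMap (j (freeFab 3)) fun f x => rfl,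
    Subtype.val_injective, fun w => ?_, fun y hy => ⟨1, one_mem _, ?_⟩⟩
  · have hw : w ∈ Submodule.span (ZLoc p.1) (E : Set (N.obj (freeFab 3))) := by
      rw [hE]
      trivial
    suffices h : ∃ s ∈ primeTo p.1, s • w ∈ Q (freeFab 3) by
      obtain ⟨s, hs, h⟩ := h
      exact ⟨s, hs, ⟨_, h⟩, rfl⟩
    induction hw using Submodule.span_induction with
    | mem x hx =>
      refine ⟨1, one_mem _, ?_⟩
      rw [one_smul]
      refine Submodule.subset_span ⟨𝟙 _, x, hx, ?_⟩
      rw [N.map_id]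
      rfl
    | zero => exact ⟨1, one_mem _, by rw [smul_zero]; exact zero_mem _⟩
    | add x y _ _ hx hy =>
      obtain ⟨s, hs, h⟩ := hx
      obtain ⟨t, ht, h'⟩ := hy
      refine ⟨s * t, mul_mem hs ht, ?_⟩
      rw [smul_add, mul_smul s t y, mul_comm, mul_smul]
      exact add_mem (zsmul_mem (S := Submodule ZInvTwo (F.obj (freeFab 3))) h t)
        (zsmul_mem (S := Submodule ZInvTwo (F.obj (freeFab 3))) h' s)
    | smul a x _ hx =>
      obtain ⟨s, hs, h⟩ := hx
      obtain ⟨t, ht, n, hn⟩ := exists_primeTo_smul_eq a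
      refine ⟨t * s, mul_mem ht hs, ?_⟩
      have : (t * s) • a • x = n • s • x := by
        rw [mul_smul, smul_comm s, ← Int.cast_smul_eq_zsmul (ZLoc p.1) t, smul_smul,
          ← Int.cast_smul_eq_zsmul (ZLoc p.1) n]
        congr 1
        exact Subtype.ext hn
      rw [this]
      exact zsmul_mem (S := Submodule ZInvTwo (F.obj (freeFab 3))) h n
  · rw [one_smul]
    exact Subtype.ext hy

/-- On an element killed by p^k, a scalar of ℤ_(p) acts like an integer, so the same generators
serve. -/
theorem finite_of_torsion {p : OddPrime} {W : Type*} [AddCommGroup W] [Module (ZLoc p.1) W]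
    [Module ZInvTwo W] [Module.Finite (ZLoc p.1) W] (h : ∀ w : W, ∃ n : ℤ, n ≠ 0 ∧ n • w = 0) :
    Module.Finite ZInvTwo W := by
  obtain ⟨E, hE⟩ := (inferInstance : Module.Finite (ZLoc p.1) W).fg_top
  refine ⟨⟨E, top_unique fun w _ => ?_⟩⟩
  have hw : w ∈ Submodule.span (ZLoc p.1) (E : Set W) := by
    rw [hE]
    trivial
  induction hw using Submodule.span_induction with
  | mem x hx => exact Submodule.subset_span hx
  | zero => exact zero_mem _
  | add x y _ _ hx hy => exact add_mem (hx trivial) (hy trivial)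
  | smul q x _ hx =>
    obtain ⟨n, hn, h⟩ := h x
    obtain ⟨k, m, hm, rfl⟩ := eq_pow_mul_of_ne_zero p hn
    have hk : (p.1 : ℤ) ^ k • x = 0 :=
      eq_zero_of_isUnit (isUnit_of_mem_primeTo hm) (by rw [smul_smul, mul_comm m]; exact h)
    obtain ⟨s, hs, n, hq⟩ := exists_primeTo_smul_eq q
    obtain ⟨a, b, hab⟩ : IsCoprime s ((p.1 : ℤ) ^ k) := IsCoprime.pow_right hs
    have hq' : s • q • x = n • x := by
      rw [← Int.cast_smul_eq_zsmul (ZLoc p.1) s, smul_smul, ← Int.cast_smul_eq_zsmul (ZLoc p.1) n]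
      congr 1
      exact Subtype.ext hq
    have : q • x = (a * n) • x := by
      rw [← one_smul ℤ (q • x), ← hab, add_smul, mul_smul, hq', mul_smul b, smul_comm _ q, hk,
        smul_zero, smul_zero, add_zero, mul_smul]
    rw [this]
    exact zsmul_mem (hx trivial) _

theorem isCubic_torsion {p : OddPrime} {N : Fab ⥤ ModuleCat.{u} (ZLoc p.1)} (hN : IsCubic N) :
    IsCubic (toZInvTwo p (torsion N)) := by
  refine IsCubic.of_injective (ι := Unit) (G := fun _ => N) (fun _ => hN)
    (fun _ X => (Submodule.torsion (ZLoc p.1) (N.obj X)).subtype.toAddMonoidHom)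
    (fun _ _ _ f x => rfl) (fun X x h => Subtype.ext (h ())) fun X => ?_
  have := hN.finite X
  have : Module.Finite (ZLoc p.1) ((torsion N).obj X) :=
    inferInstanceAs (Module.Finite (ZLoc p.1) (Submodule.torsion (ZLoc p.1) (N.obj X)))
  let : Module ZInvTwo ((torsion N).obj X) := Module.compHom _ (zInvTwoToZLoc p)
  refine finite_of_torsion (p := p) (W := (torsion N).obj X) fun w => ?_
  obtain ⟨n, hn, h⟩ := mem_torsion_iff_int.1 w.2
  exact ⟨n, hn, Subtype.ext h⟩

theorem exists_smul_eq_zero_of_forall {ι : Type} [Finite ι] {V : ι → Type*} [∀ i, AddCommGroup (V i)]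
    (S : Submonoid ℤ) (x : DirectSum ι V) (h : ∀ i, ∃ s ∈ S, s • x i = 0) :
    ∃ s ∈ S, s • x = 0 := by
  have := Fintype.ofFinite ι
  choose s hs h using h
  refine ⟨∏ i, s i, S.prod_mem fun i _ => hs i, DFinsupp.ext fun i => ?_⟩
  obtain ⟨c, hc⟩ := Finset.dvd_prod_of_mem s (Finset.mem_univ i)
  change (∏ i, s i) • x i = 0
  rw [hc, mul_comm, mul_smul, h, smul_zero]

end Constructions

/-! ### Cubic modules with given localizations -/

section Gluing

theorem nonempty_rationalize_localize (p : OddPrime) (M : Fab ⥤ ModuleCat.{u} ZInvTwo) :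
    Nonempty (rationalize M ≅ rationalize (localize p M)) :=
  ⟨Functor.isoWhiskerLeft M (ModuleCat.extendScalarsComp (zInvTwoToZLoc p) (ZLoc p.1).subtype) ≪≫
    (Functor.associator _ _ _).symm⟩

theorem nonempty_rationalize_iso {M : Fab ⥤ ModuleCat.{u} ZInvTwo} {p : OddPrime}
    {N : Fab ⥤ ModuleCat.{u} (ZLoc p.1)} (h : Nonempty (localize p M ≅ N)) :
    Nonempty (rationalize M ≅ rationalize N) :=
  ⟨(nonempty_rationalize_localize p M).some ≪≫ Functor.isoWhiskerRight h.some _⟩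

theorem isLocMap_rationalize {A : Subring ℚ} (F : Fab ⥤ ModuleCat.{u} A) (X : Fab) :
    IsLocMap nonzeroInt (toExtension A.subtype (F.obj X)) := by
  refine isLocMap_toExtension Subtype.val_injective (fun s hs => ?_) (fun q => ?_) _
  · simpa using mem_nonzeroInt.1 hs
  · refine ⟨q.den, ?_, q.num, ?_⟩
    · exact Int.natCast_ne_zero.2 (Rat.den_nz _)
    · rw [Subring.subtype_apply]
      push_cast
      exact_mod_cast Rat.den_mul_eq_num q

theorem isTorsionFree_of_value {A : Subring ℚ} {F : Fab ⥤ ModuleCat.{u} A} (hF : IsCubicFunctor F)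
    (h : ∀ (n : ℤ) (x : F.obj (freeFab 3)), n ≠ 0 → n • x = 0 → x = 0) : IsTorsionFree F := by
  intro X
  rw [eq_bot_iff]
  intro x hx
  obtain ⟨n, hn, h'⟩ := mem_torsion_iff_int.1 hx
  exact hF.eq_zero fun b => h n _ hn (by rw [← map_zsmul, h', LinearMap.map_zero])

/-- One nonzero integer n annihilates the torsion of M(ℤ³), so torsion can survive only at the
primes dividing n; the value at ℤ³ detects it. -/
theorem finite_not_isTorsionFree {M : Fab ⥤ ModuleCat.{u} ZInvTwo} (hM : IsCubic M)
    {N : ∀ p : OddPrime, Fab ⥤ ModuleCat.{u} (ZLoc p.1)} (hN : ∀ p, IsCubic (N p))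
    (e : ∀ p, Nonempty (localize p M ≅ N p)) : {p | ¬ IsTorsionFree (N p)}.Finite := by
  have := hM.finite (freeFab 3)
  obtain ⟨n, hn, h⟩ := exists_common_smul_mem
    (⊥ : Submodule ZInvTwo (Submodule.torsion ZInvTwo (M.obj (freeFab 3)))) nonzeroInt fun x => by
      obtain ⟨n, hn, h⟩ := mem_torsion_iff_int.1 x.2
      exact ⟨n, hn, Subtype.ext h⟩
  have hf : {m : ℕ | m ∣ n.natAbs}.Finite := (Set.finite_le_nat n.natAbs).subset fun m hm =>
    Nat.le_of_dvd (Int.natAbs_pos.2 hn) hm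
  refine (Set.Finite.preimage (f := Subtype.val) (s := {m : ℕ | m ∣ n.natAbs})
    Subtype.val_injective.injOn hf).subset fun p hp => ?_
  by_contra hpn
  have hnp : n ∈ primeTo p.1 :=
    (int_mem_primeTo_or_dvd n).resolve_right fun hd => hpn (Int.natCast_dvd.1 hd)
  refine hp (isTorsionFree_of_value (hN p).isCubicFunctor fun m x hm hx => ?_)
  let ψ := valueEquiv (e p).some
  have hl := isLocMap_localizeMap p M (freeFab 3)
  obtain ⟨s, hs, y, hy⟩ := hl.surj (ψ.symm x)
  have h1 : localizeMap p M (freeFab 3) (m • y) = 0 := by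
    rw [map_zsmul, ← hy, smul_comm, ← map_zsmul, hx, map_zero, smul_zero]
  obtain ⟨s', hs', h2⟩ := hl.ker _ h1
  have h3 : n • y = 0 := congrArg Subtype.val (h ⟨y, mem_torsion_iff_int.2
    ⟨s' * m, mul_mem (primeTo_le_nonzeroInt p hs') hm, by rw [mul_smul, h2]⟩⟩)
  have h4 : ψ.symm x = 0 := by
    refine eq_zero_of_isUnit (isUnit_of_mem_primeTo (mul_mem hnp hs)) ?_
    rw [mul_smul, hy, ← map_zsmul, h3, map_zero]
  exact (map_eq_zero_iff _ ψ.symm.injective).1 h4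

theorem exists_of_rationalize {N : ∀ p : OddPrime, Fab ⥤ ModuleCat.{u} (ZLoc p.1)}
    (hN : ∀ p, IsCubic (N p)) (hfin : {p | ¬ IsTorsionFree (N p)}.Finite)
    (hQ : ∀ p q, Nonempty (rationalize (N p) ≅ rationalize (N q))) :
    ∃ M : Fab ⥤ ModuleCat.{u} ZInvTwo, IsCubic M ∧ ∀ p, Nonempty (localize p M ≅ N p) := by
  classical
  obtain ⟨L, hL, i, hi, hli⟩ := exists_lattice_subfunctor (hN oddPrimeThree)
  -- The prime 3 is excluded since L, being a lattice in the module at 3, already accounts for its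
  -- torsion.
  let S : Set OddPrime := {p | ¬ IsTorsionFree (N p) ∧ p ≠ oddPrimeThree}
  have : Finite S := (hfin.subset fun p hp => hp.1 : S.Finite)
  let F : Option S → (Fab ⥤ ModuleCat.{u} ZInvTwo) := fun o =>
    Option.elim o L fun q => toZInvTwo q.1 (torsion (N q.1))
  have hF : ∀ o, IsCubic (F o) := by
    rintro (_ | q)
    · exact hL
    · exact isCubic_torsion (hN q.1)
  let M := directSumFunctor F
  have hM : IsCubic M := isCubic_directSumFunctor hF
  refine ⟨M, hM, fun p => ?_⟩
  let c₀ : M.obj (freeFab 3) →ₗ[MatRing] L.obj (freeFab 3) :=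
    valueMap (F := M) (G := L)
      (DirectSum.component ZInvTwo (Option S) (fun o => (F o).obj (freeFab 3)) none).toAddMonoidHom
      fun f x => rfl
  let c₁ : M.obj (freeFab 3) →ₗ[MatRing] (N p).obj (freeFab 3) :=
    if h : p ∈ S then valueMap (F := M) (G := N p)
      ((Submodule.torsion (ZLoc p.1) ((N p).obj (freeFab 3))).subtype.toAddMonoidHom.comp
        (DirectSum.component ZInvTwo (Option S) (fun o => (F o).obj (freeFab 3))
          (some ⟨p, h⟩)).toAddMonoidHom) fun f x => rfl
    else 0
  have hc₁t : ∀ x, c₁ x ∈ Submodule.torsion (ZLoc p.1) ((N p).obj (freeFab 3)) := by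
    intro x
    simp only [c₁]
    split_ifs with h
    · exact Subtype.property (p := (· ∈ Submodule.torsion (ZLoc p.1) ((N p).obj (freeFab 3)))) _
    · exact zero_mem _
  have hc₁3 : ∀ x, p = oddPrimeThree → c₁ x = 0 := by
    intro x h3
    simp only [c₁]
    rw [dif_neg fun h => h.2 h3]
    rfl
  -- Only the L-component and the torsion component at p matter: every other summand is q-primary
  -- with q ≠ p and vanishes after localization at p.
  have hker : ∀ x, (∃ s ∈ primeTo p.1, s • c₀ x = 0) → c₁ x = 0 → ∃ s ∈ primeTo p.1, s • x = 0 := by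
    intro x h0 h1
    refine exists_smul_eq_zero_of_forall (V := fun o => (F o).obj (freeFab 3)) _ x ?_
    rintro (_ | q)
    · exact h0
    · by_cases hq : q.1 = p
      · have hp : p ∈ S := hq ▸ q.2
        have hq' : q = ⟨p, hp⟩ := Subtype.ext hq
        subst hq'
        simp only [c₁] at h1
        rw [dif_pos hp] at h1
        refine ⟨1, one_mem _, ?_⟩
        rw [one_smul]
        exact Subtype.ext h1
      · have key : ∀ z : Submodule.torsion (ZLoc q.1.1) ((N q.1).obj (freeFab 3)),
            ∃ s ∈ primeTo p.1, s • z = 0 := by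
          intro z
          obtain ⟨n, hn, h⟩ := mem_torsion_iff_int.1 z.2
          obtain ⟨k, m, hm, rfl⟩ := eq_pow_mul_of_ne_zero q.1 hn
          refine ⟨_, prime_mem_primeTo hq k, Subtype.ext ?_⟩
          refine eq_zero_of_isUnit (isUnit_of_mem_primeTo hm) ?_
          rw [Submodule.coe_smul_of_tower, smul_smul, mul_comm m]
          exact h
        exact key ((show DirectSum (Option S) fun o => (F o).obj (freeFab 3) from x) (some q))
  have hsurj : ∀ m, ∀ t ∈ Submodule.torsion (ZLoc p.1) ((N p).obj (freeFab 3)),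
      (p = oddPrimeThree → t = 0) → ∃ x, c₀ x = m ∧ c₁ x = t := by
    intro m t ht h3
    let x₀ : M.obj (freeFab 3) := DirectSum.of (fun o => (F o).obj (freeFab 3)) none m
    have hc₀ : c₀ x₀ = m := DirectSum.of_eq_same (β := fun o => (F o).obj (freeFab 3)) none m
    by_cases hp : p ∈ S
    · let x₁ : M.obj (freeFab 3) :=
        DirectSum.of (fun o => (F o).obj (freeFab 3)) (some ⟨p, hp⟩) ⟨t, ht⟩
      refine ⟨x₀ + x₁, ?_, ?_⟩
      · rw [map_add]
        have e0 : c₀ x₀ = m := hc₀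
        have e1 : c₀ x₁ = 0 := DirectSum.of_eq_of_ne
          (β := fun o => (F o).obj (freeFab 3)) (some ⟨p, hp⟩) none ⟨t, ht⟩ (by simp)
        rw [e0, e1, add_zero]
      · rw [map_add]
        have e0 : c₁ x₀ = 0 := by
          simp only [c₁]
          rw [dif_pos hp]
          exact congrArg Subtype.val (DirectSum.of_eq_of_ne
            (β := fun o => (F o).obj (freeFab 3)) none (some ⟨p, hp⟩) m (by simp))
        have e1 : c₁ x₁ = t := by
          simp only [c₁]
          rw [dif_pos hp]
          exact congrArg Subtype.val (DirectSum.of_eq_same (β := fun o => (F o).obj (freeFab 3))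
            (some ⟨p, hp⟩) ⟨t, ht⟩)
        rw [e0, e1, zero_add]
    · refine ⟨x₀, hc₀, ?_⟩
      have e0 : c₁ x₀ = 0 := by
        simp only [c₁]
        rw [dif_neg hp]
        rfl
      rw [e0]
      by_cases hp3 : p = oddPrimeThree
      · exact (h3 hp3).symm
      · have htf : IsTorsionFree (N p) := by
          by_contra h
          exact hp ⟨h, hp3⟩
        rw [htf] at ht
        exact ht.symm
  -- The map μ c₀ + c₁ is then a localization at p. For p = 3 it is the inclusion of L, the torsion
  -- summand being absent; for p ≠ 3 it comes from the comparison of lattices.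
  suffices h : ∃ μ : L.obj (freeFab 3) →ₗ[MatRing] (N p).obj (freeFab 3),
      (∀ y, ∃ s ∈ primeTo p.1, ∃ m, ∃ t ∈ Submodule.torsion (ZLoc p.1) ((N p).obj (freeFab 3)),
        (p = oddPrimeThree → t = 0) ∧ s • y = μ m + t) ∧
      ∀ m, ∀ t ∈ Submodule.torsion (ZLoc p.1) ((N p).obj (freeFab 3)),
        (p = oddPrimeThree → t = 0) → μ m + t = 0 → t = 0 ∧ ∃ s ∈ primeTo p.1, s • m = 0 by
    obtain ⟨μ, h1, h2⟩ := h
    refine nonempty_localize_iso hM.isCubicFunctor (hN p).isCubicFunctor (μ.comp c₀ + c₁)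
      ⟨fun y => ?_, fun x hx => ?_⟩
    · obtain ⟨s, hs, m, t, ht, h3, h⟩ := h1 y
      obtain ⟨x, rfl, rfl⟩ := hsurj m t ht h3
      exact ⟨s, hs, x, h⟩
    · obtain ⟨h3, h4⟩ := h2 (c₀ x) (c₁ x) (hc₁t x) (hc₁3 x) hx
      exact hker x h4 h3
  by_cases hp : p = oddPrimeThree
  · subst hp
    refine ⟨i, fun y => ?_, fun m t _ h3 h => ?_⟩
    · obtain ⟨s, hs, m, h⟩ := hli.surj y
      exact ⟨s, hs, m, 0, zero_mem _, fun _ => rfl, by rw [h, add_zero]⟩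
    · rw [h3 rfl, add_zero] at h
      exact ⟨h3 rfl, hli.ker m h⟩
  · have := hL.finite (freeFab 3)
    have := (hN p).finite (freeFab 3)
    let ψ := valueEquiv (hQ oddPrimeThree p).some
    let d := valueMap (F := N p) (G := rationalize (N p))
      (toExtension (ZLoc p.1).subtype ((N p).obj (freeFab 3))) fun f x => rfl
    let d' := valueMap (F := N oddPrimeThree) (G := rationalize (N oddPrimeThree))
      (toExtension (ZLoc oddPrimeThree.1).subtype ((N oddPrimeThree).obj (freeFab 3))) fun f x => rfl
    have hd' : IsLocMap nonzeroInt d' := isLocMap_rationalize (N oddPrimeThree) (freeFab 3)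
    have hψ : IsLocMap nonzeroInt (ψ.toLinearMap.comp d') := by
      refine ⟨fun w => ?_, fun y hy => hd'.ker y ((map_eq_zero_iff _ ψ.injective).1 hy)⟩
      obtain ⟨s, hs, y, hy⟩ := hd'.surj (ψ.symm w)
      refine ⟨s, hs, y, ?_⟩
      rw [← map_zsmul, LinearEquiv.symm_apply_eq] at hy
      exact hy
    have tL : ∀ (n : ℤ) (x : L.obj (freeFab 3)), n ≠ 0 → n • x = 0 → ∃ k : ℕ, (3 : ℤ) ^ k • x = 0 := by
      intro n x hn h
      obtain ⟨k, m, hm, rfl⟩ := eq_pow_mul_of_ne_zero oddPrimeThree hn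
      refine ⟨k, (map_eq_zero_iff _ hi).1 (eq_zero_of_isUnit (isUnit_of_mem_primeTo hm) ?_)⟩
      rw [← map_zsmul, smul_smul, mul_comm m]
      exact (congrArg i h).trans (map_zero i)
    obtain ⟨μ, h1, h2⟩ := exists_lattice_map hp hL.isCubicFunctor.isCubicModule tL
      (hN p).isCubicFunctor.isCubicModule ((ψ.toLinearMap.comp d').comp i) d
      (hψ.comp (primeTo_le_nonzeroInt oddPrimeThree) (m := i.toAddMonoidHom) hli
        fun n v => map_zsmul _ n v) (isLocMap_rationalize (N p) (freeFab 3))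
    refine ⟨μ, fun y => ?_, fun m t ht _ h => h2 m t ht h⟩
    obtain ⟨s, hs, m, t, ht, h⟩ := h1 y
    exact ⟨s, hs, m, t, ht, fun h => absurd h hp, h⟩

end Gluing

end CubicModules

open CubicModules in
theorem theoremt21 :
    (∀ M N : Fab ⥤ ModuleCat.{u} ZInvTwo, IsCubic M → IsCubic N →
      (Nonempty (M ≅ N) ↔ ∀ p : OddPrime, Nonempty (localize p M ≅ localize p N))) ∧
    (∀ N : (p : OddPrime) → Fab ⥤ ModuleCat.{u} (ZLoc p.1), (∀ p, IsCubic (N p)) →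
      ((∃ M : Fab ⥤ ModuleCat.{u} ZInvTwo, IsCubic M ∧
          ∀ p, Nonempty (localize p M ≅ N p)) ↔
        ({p | ¬ IsTorsionFree (N p)}.Finite ∧
          ∀ p q, Nonempty (rationalize (N p) ≅ rationalize (N q)))) ∧
      (∀ M : Fab ⥤ ModuleCat.{u} ZInvTwo, IsCubic M →
        (∀ p, Nonempty (localize p M ≅ N p)) →
          (∀ p, Nonempty (rationalize M ≅ rationalize (N p))) ∧
          Nonempty (torsion M ≅ directSumFunctor fun p => toZInvTwo p (torsion (N p))))) := by
  refine ⟨fun M N hM hN => ⟨fun ⟨e⟩ p => ⟨Functor.isoWhiskerRight e _⟩,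
    nonempty_iso_of_localize hM hN⟩, fun N hN => ⟨⟨?_, fun ⟨hfin, hQ⟩ => ?_⟩, fun M _ h =>
      ⟨fun p => nonempty_rationalize_iso (h p), nonempty_torsion_iso h⟩⟩⟩
  · rintro ⟨M, hM, h⟩
    exact ⟨finite_not_isTorsionFree hM hN h, fun p q =>
      ⟨(nonempty_rationalize_iso (h p)).some.symm ≪≫ (nonempty_rationalize_iso (h q)).some⟩⟩
  · exact exists_of_rationalize hN hfin hQ
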